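/- Let $p\neq q$ be prime numbers, both $\ge 5$, and let $k$ be an algebraic closure of $\mathbb F_q$. Let $S$ be the (finite) set of isomorphism classes of supersingular elliptic curves over $k$, and let $\mathcal E$ be the (finite) set of isomorphism classes of pairs $e=(E,C)$, where $E$ is a supersingular elliptic curve over $k$ and $C\subset E(k)$ is a subgroup of order $p$. (These are the edges of the dual graphs of the fibre at $q$ of $X_0(q)$ and of the fibre at $p$ of the Shimura curve $X^{pq}$ of discriminant $pq$, respectively.) For $e=(E,C)$ put $\operatorname{End}(e)=\{\alpha\in\operatorname{End}(E):\alpha(C)\subseteq C\}$. Define divisors with rational coefficients on $S$ and on $\mathcal E$, the Eisenstein-modular vector and the Eisenstein-Shimura vector, by $$A_E=\sum_{E\in S}\frac{1}{\#(\operatorname{End}(E)^{*}/\{\pm1\})}\,E,\qquad a_E=\sum_{e\in\mathcal E}\frac{1}{\#(\operatorname{End}(e)^{*}/\{\pm1\})}\,e .$$ For every pair $(E,C)$ as above the quotient $E/C$ exists and is a supersingular elliptic curve, well defined up to isomorphism. Let $s,t:\mathcal E\to S$ be the maps $s(E,C)=E$ and $t(E,C)=E/C$, and let $s_*,t_*$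 be the induced linear maps on divisors with rational coefficients, $s_*\big(\sum\lambda_e e\big)=\sum\lambda_e\, s(e)$ and $t_*\big(\sum\lambda_e e\big)=\sum\lambda_e\, t(e)$. Then $$s_*(a_E)=(p+1)\,A_E\qquad\text{and}\qquad t_*(a_E)=(p+1)\,A_E .$$ -/

import Mathlib

namespace EisensteinGraph

open WeierstrassCurve

universe u

section Morphisms

variable {k : Type u} [Field k]

/-- Homogeneous coordinates in the projective plane of a point of a Weierstrass curve. -/
def coords {W : Affine k} : W.Point → Fin 3 → k
  | .zero => ![0, 1, 0]
  | .some x y _ => ![x, y, 1]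

/-- The triple of polynomials `F` represents the map `φ` at the point `Q`: its value there is a
nonzero multiple of the homogeneous coordinates of `φ Q`. -/
def RepresentsAt {W W' : Affine k} (F : Fin 3 → MvPolynomial (Fin 3) k) (φ : W.Point → W'.Point)
    (Q : W.Point) : Prop :=
  ∃ c : k, c ≠ 0 ∧ ∀ i, MvPolynomial.eval (coords Q) (F i) = c * coords (φ Q) i

/-- A map between (the points of) two plane projective curves over an algebraically closed field is
regular, i.e. a morphism of varieties, if around every point it is given by a triple of homogeneous
polynomials of the same degree: the triple does not vanish at that point, and it represents the map
at every point where it does not vanish. -/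
def IsRegularMap {W W' : Affine k} (φ : W.Point → W'.Point) : Prop :=
  ∀ P : W.Point, ∃ (d : ℕ) (F : Fin 3 → MvPolynomial (Fin 3) k),
    (∀ i, (F i).IsHomogeneous d) ∧
    (∃ i, MvPolynomial.eval (coords P) (F i) ≠ 0) ∧
    ∀ Q : W.Point, (∃ i, MvPolynomial.eval (coords Q) (F i) ≠ 0) → RepresentsAt F φ Q

theorem coords_ne_zero {W : Affine k} (P : W.Point) : ∃ i, coords P i ≠ 0 := by
  cases P with
  | zero => exact ⟨1, by simp [coords]⟩
  | some x y h => exact ⟨2, by simp [coords]⟩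

theorem isRegularMap_id {W : Affine k} : IsRegularMap (fun P : W.Point => P) := by
  intro P
  refine ⟨1, fun i => MvPolynomial.X i, fun i => MvPolynomial.isHomogeneous_X _ _, ?_, ?_⟩
  · simpa using coords_ne_zero P
  · intro Q _
    exact ⟨1, one_ne_zero, fun i => by simp⟩

theorem isRegularMap_neg {W : Affine k} : IsRegularMap (fun P : W.Point => -P) := by
  intro P
  have key : ∀ Q : W.Point, RepresentsAt
      ![MvPolynomial.X 0,
        -MvPolynomial.X 1 - MvPolynomial.C W.a₁ * MvPolynomial.X 0
          - MvPolynomial.C W.a₃ * MvPolynomial.X 2,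
        MvPolynomial.X 2] (fun P : W.Point => -P) Q := by
    intro Q
    cases Q with
    | zero =>
      refine ⟨-1, by simp, fun i => ?_⟩
      have h0 : -(Affine.Point.zero : W.Point) = Affine.Point.zero := rfl
      fin_cases i <;> simp [coords, h0]
    | some x y h =>
      refine ⟨1, one_ne_zero, fun i => ?_⟩
      fin_cases i <;> simp [coords, Affine.Point.neg_some, Affine.negY]
  refine ⟨1, _, ?_, ?_, fun Q _ => key Q⟩
  · intro i
    have hX : ∀ j : Fin 3, (MvPolynomial.X j : MvPolynomial (Fin 3) k).IsHomogeneous 1 :=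
      fun j => MvPolynomial.isHomogeneous_X _ _
    fin_cases i
    · exact hX 0
    · exact ((hX 1).neg.sub ((hX 0).C_mul _)).sub ((hX 2).C_mul _)
    · exact hX 2
  · obtain ⟨c, hc, h⟩ := key P
    obtain ⟨i, hi⟩ := coords_ne_zero (-P)
    exact ⟨i, by rw [h i]; exact mul_ne_zero hc hi⟩

theorem eval_mul_of_isHomogeneous {G : MvPolynomial (Fin 3) k} {e : ℕ} (hG : G.IsHomogeneous e)
    (c : k) (v : Fin 3 → k) :
    MvPolynomial.eval (fun i => c * v i) G = c ^ e * MvPolynomial.eval v G := by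
  rw [MvPolynomial.eval_eq, MvPolynomial.eval_eq, Finset.mul_sum]
  refine Finset.sum_congr rfl fun m hm => ?_
  have hdeg : ∑ i ∈ m.support, m i = e := (hG.degree_eq_sum_deg_support hm).symm
  have hprod : ∏ i ∈ m.support, (c * v i) ^ m i = c ^ e * ∏ i ∈ m.support, v i ^ m i := by
    rw [← hdeg, ← Finset.prod_pow_eq_pow_sum, ← Finset.prod_mul_distrib]
    exact Finset.prod_congr rfl fun i _ => mul_pow _ _ _
  rw [hprod]
  ring

theorem IsRegularMap.comp {W W' W'' : Affine k} {ψ : W'.Point → W''.Point}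
    {φ : W.Point → W'.Point} (hψ : IsRegularMap ψ) (hφ : IsRegularMap φ) :
    IsRegularMap (fun P => ψ (φ P)) := by
  intro P
  obtain ⟨d, F, hF, ⟨i, hi⟩, hFr⟩ := hφ P
  obtain ⟨e, G, hG, ⟨j, hj⟩, hGr⟩ := hψ (φ P)
  have hev : ∀ (Q : W.Point) (c : k),
      (∀ l, MvPolynomial.eval (coords Q) (F l) = c * coords (φ Q) l) → ∀ l,
      MvPolynomial.eval (coords Q) (F i * MvPolynomial.aeval F (G l)) =
        MvPolynomial.eval (coords Q) (F i) *
          (c ^ e * MvPolynomial.eval (coords (φ Q)) (G l)) := by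
    intro Q c hc l
    rw [map_mul, ← eval_mul_of_isHomogeneous (hG l)]
    congr 1
    rw [← funext hc]
    induction G l using MvPolynomial.induction_on with
    | C a => simp
    | add a b ha hb => simp only [map_add, ha, hb]
    | mul_X a n ha => simp only [map_mul, ha, MvPolynomial.aeval_X, MvPolynomial.eval_X]
  refine ⟨d + d * e, fun l => F i * MvPolynomial.aeval F (G l),
    fun l => (hF i).mul ((hG l).aeval _ hF), ⟨j, ?_⟩, ?_⟩
  · obtain ⟨c, hc0, hc⟩ := hFr P ⟨i, hi⟩
    rw [hev P c hc j]
    exact mul_ne_zero hi (mul_ne_zero (pow_ne_zero _ hc0) hj)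
  · rintro Q ⟨l, hl⟩
    have hFi : MvPolynomial.eval (coords Q) (F i) ≠ 0 := fun h => hl (by rw [map_mul, h, zero_mul])
    obtain ⟨c, hc0, hc⟩ := hFr Q ⟨i, hFi⟩
    have hGl : MvPolynomial.eval (coords (φ Q)) (G l) ≠ 0 := fun h =>
      hl (by rw [hev Q c hc l, h, mul_zero, mul_zero])
    obtain ⟨c', hc0', hc'⟩ := hGr (φ Q) ⟨l, hGl⟩
    refine ⟨MvPolynomial.eval (coords Q) (F i) * c ^ e * c',
      mul_ne_zero (mul_ne_zero hFi (pow_ne_zero _ hc0)) hc0', fun m => ?_⟩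
    rw [hev Q c hc m, hc' m]
    ring

end Morphisms

section Endomorphisms

variable {k : Type u} [Field k] [DecidableEq k]

/-- The endomorphisms of the curve `W` (homomorphisms on points that are morphisms of varieties),
as a monoid under composition; this is the multiplicative monoid of the ring `End(W)`, which is all
that its unit group depends on. -/
def endMonoid (W : Affine k) : Submonoid (AddMonoid.End W.Point) where
  carrier := {α | IsRegularMap (fun P => α P)}
  one_mem' := isRegularMap_id
  mul_mem' := fun {α β} hα hβ =>
    IsRegularMap.comp (ψ := fun P => α P) (φ := fun P => β P) hα hβ

/-- The multiplicative monoid of `End(W, C) = {α ∈ End(W) : α(C) ⊆ C}`. -/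
def endPairMonoid (W : Affine k) (C : AddSubgroup W.Point) :
    Submonoid (AddMonoid.End W.Point) where
  carrier := {α | α ∈ endMonoid W ∧ ∀ P ∈ C, α P ∈ C}
  one_mem' := ⟨one_mem _, fun _ h => h⟩
  mul_mem' := fun hα hβ => ⟨mul_mem hα.1 hβ.1, fun P h => hα.2 _ (hβ.2 P h)⟩

theorem neg_one_mem_endMonoid (W : Affine k) : (-1 : AddMonoid.End W.Point) ∈ endMonoid W :=
  isRegularMap_neg

theorem neg_one_mem_endPairMonoid (W : Affine k) (C : AddSubgroup W.Point) :
    (-1 : AddMonoid.End W.Point) ∈ endPairMonoid W C :=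
  ⟨neg_one_mem_endMonoid W, fun _ h => C.neg_mem h⟩

/-- The unit `-1` of a monoid of endomorphisms of an abelian group that contains it. -/
def negOneUnit {A : Type u} [AddCommGroup A] (M : Submonoid (AddMonoid.End A))
    (h : (-1 : AddMonoid.End A) ∈ M) : Mˣ where
  val := ⟨-1, h⟩
  inv := ⟨-1, h⟩
  val_inv := Subtype.ext (by simp)
  inv_val := Subtype.ext (by simp)

/-- The cardinality of `Mˣ / {±1}`. -/
noncomputable def unitIndex {A : Type u} [AddCommGroup A] (M : Submonoid (AddMonoid.End A))
    (h : (-1 : AddMonoid.End A) ∈ M) : ℕ :=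
  Nat.card (Mˣ ⧸ Subgroup.zpowers (negOneUnit M h))

/-- `π : W → W'` is the quotient of the elliptic curve `W` by the finite subgroup `C`: it is a
homomorphism of elliptic curves with kernel `C`, and every homomorphism from `W` to an elliptic
curve that vanishes on `C` factors uniquely through it. -/
def IsQuotientMap {W W' : Affine k} (C : AddSubgroup W.Point) (π : W.Point →+ W'.Point) : Prop :=
  IsRegularMap (fun P => π P) ∧ π.ker = C ∧
    ∀ (V : Affine k), V.IsElliptic → ∀ ψ : W.Point →+ V.Point,
      IsRegularMap (fun P => ψ P) → C ≤ ψ.ker →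
      ∃! χ : W'.Point →+ V.Point, IsRegularMap (fun P => χ P) ∧ χ.comp π = ψ

end Endomorphisms

section Graphs

variable (q : ℕ) (k : Type u) [Field k] [DecidableEq k]

/-- A supersingular elliptic curve over `k`; this is meant for `k` an algebraic closure of the field
with `q` elements, where supersingular means without a nonzero point of `q`-torsion. -/
structure SupersingularCurve where
  curve : Affine k
  isElliptic : curve.IsElliptic
  supersingular : ∀ P : curve.Point, q • P = 0 → P = 0

/-- Isomorphism of elliptic curves. -/
instance curveSetoid : Setoid (SupersingularCurve q k) where
  r E E' := ∃ f : E.curve.Point ≃+ E'.curve.Point,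
    IsRegularMap (fun P => f P) ∧ IsRegularMap (fun P => f.symm P)
  iseqv :=
    { refl := fun _ => ⟨AddEquiv.refl _, isRegularMap_id, isRegularMap_id⟩
      symm := fun ⟨f, h, h'⟩ => ⟨f.symm, h', h⟩
      trans := fun ⟨f, h, h'⟩ ⟨g, hg, hg'⟩ => ⟨f.trans g, hg.comp h, h'.comp hg'⟩ }

/-- The set `S` of isomorphism classes of supersingular elliptic curves: the edges of the modular
graph. -/
abbrev SSClass := Quotient (curveSetoid q k)

variable (p : ℕ)

/-- A supersingular elliptic curve with a subgroup of order `p`. -/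
structure CurveWithSubgroup extends SupersingularCurve q k where
  subgroup : AddSubgroup curve.Point
  card_subgroup : Nat.card subgroup = p

/-- Isomorphism of pairs `(E, C)`. -/
instance pairSetoid : Setoid (CurveWithSubgroup q k p) where
  r E E' := ∃ f : E.curve.Point ≃+ E'.curve.Point,
    IsRegularMap (fun P => f P) ∧ IsRegularMap (fun P => f.symm P) ∧
      ∀ P, f P ∈ E'.subgroup ↔ P ∈ E.subgroup
  iseqv :=
    { refl := fun _ => ⟨AddEquiv.refl _, isRegularMap_id, isRegularMap_id, fun _ => Iff.rfl⟩
      symm := fun ⟨f, h, h', hC⟩ => ⟨f.symm, h', h, fun P => by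
        rw [← hC, AddEquiv.apply_symm_apply]⟩
      trans := fun ⟨f, h, h', hC⟩ ⟨g, hg, hg', hC'⟩ =>
        ⟨f.trans g, hg.comp h, h'.comp hg', fun P => (hC' (f P)).trans (hC P)⟩ }

/-- The set of isomorphism classes of pairs `(E, C)`: the edges of the Shimura graph. -/
abbrev ShimuraEdge := Quotient (pairSetoid q k p)

variable {q k p}

/-- The length `#(End(E)ˣ / {±1})` of an edge of the modular graph, computed on a representative. -/
noncomputable def modularLength (x : SSClass q k) : ℕ :=
  unitIndex (endMonoid x.out.curve) (neg_one_mem_endMonoid _)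

/-- The length `#(End(E, C)ˣ / {±1})` of an edge of the Shimura graph, computed on a
representative. -/
noncomputable def shimuraLength (e : ShimuraEdge q k p) : ℕ :=
  unitIndex (endPairMonoid e.out.curve e.out.subgroup) (neg_one_mem_endPairMonoid _ _)

/-- The map `s : (E, C) ↦ E`. -/
def source : ShimuraEdge q k p → SSClass q k :=
  Quotient.map CurveWithSubgroup.toSupersingularCurve
    (fun _ _ ⟨f, h, h', _⟩ => ⟨f, h, h'⟩)

/-- The class `x` is that of the quotient curve `E / C`, for a pair `(E, C)` in the class `e`. -/
def IsTarget (e : ShimuraEdge q k p) (x : SSClass q k) : Prop :=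
  ∃ (P : CurveWithSubgroup q k p) (E' : SupersingularCurve q k)
    (π : P.curve.Point →+ E'.curve.Point),
    ⟦P⟧ = e ∧ ⟦E'⟧ = x ∧ IsQuotientMap P.subgroup π

open Classical in
/-- The map `t : (E, C) ↦ E / C`. (The second case does not occur for the fields and primes
considered, since `E / C` exists and is supersingular.) -/
noncomputable def target (e : ShimuraEdge q k p) : SSClass q k :=
  if h : ∃ x, IsTarget e x then h.choose else source e

variable (q k p)

/-- The divisors with rational coefficients on the finite set `S`, `∑ λ_x x` being written as the
function `x ↦ λ_x`. -/
abbrev ModularDivisor := SSClass q k → ℚ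

/-- The divisors with rational coefficients on the finite set of edges of the Shimura graph. -/
abbrev ShimuraDivisor := ShimuraEdge q k p → ℚ

/-- The Eisenstein-modular vector `A_E = ∑ (1 / #(End(E)ˣ / {±1})) E`. -/
noncomputable def eisensteinModular : ModularDivisor q k :=
  fun x => 1 / (modularLength x : ℚ)

/-- The Eisenstein-Shimura vector `a_E = ∑ (1 / #(End(e)ˣ / {±1})) e`. -/
noncomputable def eisensteinShimura : ShimuraDivisor q k p :=
  fun e => 1 / (shimuraLength e : ℚ)

variable {q k p}

/-- The push-forward `f_* (∑ λ_e e) = ∑ λ_e f(e)` of divisors: the coefficient of `x` is the sum of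
the `λ_e` over the edges `e` with `f(e) = x`. -/
noncomputable def pushforward (f : ShimuraEdge q k p → SSClass q k) (v : ShimuraDivisor q k p) :
    ModularDivisor q k :=
  fun x => ∑ᶠ e : {e // f e = x}, v e

end Graphs

end EisensteinGraph

open EisensteinGraph

/-! Write `ℓ` for the orders in the denominators. The edges over `E` are the orbits of `End(E)ˣ` on
the subgroups `C` of order `p`, and the stabiliser of `C` is `End(E, C)ˣ`, which contains `±1`. So
the orbit of `C` has `ℓ(E) / ℓ(E, C)` elements, and the coefficient `∑ 1 / ℓ(e)` of `s_*(a_E)` at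
`E` is the number of subgroups of order `p` divided by `ℓ(E)`. That number is `p + 1` because `#E[p]
= p²`. The lemmas are `unitIndex_mul_card_orbit`, `card_fibre_mul_shimuraLength` and
`card_subgroups`, combined in `pushforward_source`.

For `t`, the involution `w : (E, C) ↦ (E/C, E[p]/C)` satisfies `s ∘ w = t`. Endomorphisms of a pair
descend along the quotient isogeny to the dual pair, and back, so `w` preserves `ℓ`; the sum for `t`
is the sum for `s` reindexed (`exists_involution`, `pushforward_target`).

Most of the work supplies the geometry. A curve is its set of points, and "generically" means off a
finite set, i.e. along the filter `cofinite`. Rational functions are written in `x` and the odd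
function `η = 2y + a₁x + a₃`, with `η² = Ψ₂Sq(x)`; this is where `2 ≠ 0` enters. Three facts are
needed.

The quotient by a subgroup `C` without 2-torsion exists, with its universal property
(`exists_quotient`). Its coordinates are the traces over `C` of `x` and `η / 2`. In place of
Riemann-Roch, an even `C`-invariant function regular off `C` is a polynomial in the trace of `x`.
The quotient map is additive because the norm of a line function is again a line function.

The `x`-coordinate of `nP` is a fraction in `x(P)` of degree `n²` (`exists_mulX`), and counting a
generic fibre gives `#E[n] = n²` when `n ≠ 0` in `k` (`card_torsion`).

Multiplication by `p` is itself the quotient by `E[p]` (`isQuotientMap_nsmul`), since it differs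
from the constructed quotient by a map of degree one. This yields the dual isogeny
(`IsQuotientMap.exists_dual`). -/

namespace EisensteinGraph

open WeierstrassCurve Filter
open Polynomial hiding X C
open scoped Pointwise

universe u

/-! ### Affine coordinates and generic statements -/

section Coordinates

variable {k : Type u} [Field k]

/-- The `x`-coordinate of a point, with junk value `0` at infinity. -/
def xc {W : Affine k} : W.Point → k
  | .zero => 0
  | .some x _ _ => x

/-- The `y`-coordinate of a point, with junk value `0` at infinity. -/
def yc {W : Affine k} : W.Point → k
  | .zero => 0
  | .some _ y _ => y

/-- The odd function `2y + a₁x + a₃`, with junk value `0` at infinity. -/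
def ηc {W : Affine k} : W.Point → k
  | .zero => 0
  | .some x y _ => 2 * y + W.a₁ * x + W.a₃

variable {W : Affine k}

@[simp] theorem xc_some {x y : k} (h : W.Nonsingular x y) : xc (.some x y h) = x := rfl
@[simp] theorem yc_some {x y : k} (h : W.Nonsingular x y) : yc (.some x y h) = y := rfl

theorem ηc_eq {P : W.Point} (hP : P ≠ 0) : ηc P = 2 * yc P + W.a₁ * xc P + W.a₃ := by
  cases P with
  | zero => exact absurd rfl hP
  | some x y h => rfl

theorem coords_zero : coords (0 : W.Point) = ![0, 1, 0] := rfl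

theorem coords_of_ne_zero {P : W.Point} (hP : P ≠ 0) : coords P = ![xc P, yc P, 1] := by
  cases P with
  | zero => exact absurd rfl hP
  | some x y h => rfl

theorem equation_of_ne_zero {P : W.Point} (hP : P ≠ 0) :
    yc P ^ 2 + W.a₁ * xc P * yc P + W.a₃ * yc P =
      xc P ^ 3 + W.a₂ * xc P ^ 2 + W.a₄ * xc P + W.a₆ := by
  cases P with
  | zero => exact absurd rfl hP
  | some x y h => exact (W.equation_iff x y).mp h.1

@[simp] theorem xc_neg (P : W.Point) : xc (-P) = xc P := by
  cases P <;> rfl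

@[simp] theorem ηc_neg (P : W.Point) : ηc (-P) = -ηc P := by
  cases P with
  | zero => exact neg_zero.symm
  | some x y h =>
    simp only [Affine.Point.neg_some, ηc, Affine.negY]
    ring

theorem ηc_sq {P : W.Point} (hP : P ≠ 0) : ηc P ^ 2 = W.Ψ₂Sq.eval (xc P) := by
  rw [ηc_eq hP, WeierstrassCurve.Ψ₂Sq]
  simp only [eval_add, eval_mul, eval_C, eval_pow, eval_X, b₂, b₄, b₆]
  linear_combination 4 * equation_of_ne_zero hP

theorem eq_or_eq_neg_of_xc_eq {P Q : W.Point} (hP : P ≠ 0) (hQ : Q ≠ 0) (h : xc P = xc Q) :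
    P = Q ∨ P = -Q := by
  cases P with
  | zero => exact absurd rfl hP
  | some x y hx =>
    cases Q with
    | zero => exact absurd rfl hQ
    | some x' y' hx' => exact Affine.Point.X_eq_iff.mp h

theorem point_ext {P Q : W.Point} (hP : P ≠ 0) (hQ : Q ≠ 0) (h : xc P = xc Q)
    (h' : yc P = yc Q) : P = Q := by
  cases P with
  | zero => exact absurd rfl hP
  | some x y hx =>
    cases Q with
    | zero => exact absurd rfl hQ
    | some x' y' hx' =>
      simp only [xc_some, yc_some] at h h'
      subst h h'
      rfl

theorem finite_xc_preimage (x : k) : {P : W.Point | xc P = x}.Finite := by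
  by_cases h : ∃ P : W.Point, P ≠ 0 ∧ xc P = x
  · obtain ⟨P, hP, rfl⟩ := h
    refine (Set.toFinite {0, P, -P}).subset fun Q hQ => ?_
    by_cases hQ0 : Q = 0
    · simp [hQ0]
    · rcases eq_or_eq_neg_of_xc_eq hQ0 hP hQ with h | h <;> simp [h]
  · push Not at h
    refine (Set.toFinite {0}).subset fun Q hQ => ?_
    by_contra hQ0
    exact h Q hQ0 hQ

/-- Only finitely many points share an `x`-coordinate, so a statement true for almost all `x` is
true at almost all points of the curve. -/
theorem tendsto_xc : Tendsto (xc : W.Point → k) cofinite cofinite :=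
  Tendsto.cofinite_of_finite_preimage_singleton fun x => finite_xc_preimage x

theorem eventually_ne (P : W.Point) : ∀ᶠ Q : W.Point in cofinite, Q ≠ P :=
  (Set.finite_singleton P).eventually_cofinite_notMem

theorem eventually_eval_xc_ne_zero {c : k[X]} (hc : c ≠ 0) :
    ∀ᶠ P : W.Point in cofinite, c.eval (xc P) ≠ 0 := by
  refine (tendsto_xc (W := W)).eventually (p := fun x => c.eval x ≠ 0) ?_
  exact (c.finite_setOfPred_isRoot hc).eventually_cofinite_notMem

theorem eq_zero_of_frequently_eval_xc {c : k[X]}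
    (h : ∃ᶠ P : W.Point in cofinite, c.eval (xc P) = 0) : c = 0 := by
  by_contra hc
  exact h (eventually_eval_xc_ne_zero hc)

end Coordinates

/-! ### Points from solutions of `η² = Ψ₂Sq(x)`; the functions `a(x) + b(x)η` -/

section Parametrization

variable {k : Type u} [Field k] [NeZero (2 : k)] {W : Affine k}

theorem four_ne_zero_of_two : (4 : k) ≠ 0 := by
  have : (4 : k) = 2 * 2 := by norm_num
  rw [this]
  exact mul_ne_zero two_ne_zero two_ne_zero

theorem natDegree_twoTorsion : W.Ψ₂Sq.natDegree = 3 :=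
  WeierstrassCurve.natDegree_Ψ₂Sq W four_ne_zero_of_two

theorem twoTorsion_ne_zero : W.Ψ₂Sq ≠ 0 := fun h => by
  have := natDegree_twoTorsion (W := W)
  simp [h] at this

theorem yc_eq {P : W.Point} (hP : P ≠ 0) : yc P = 2⁻¹ * (ηc P - W.a₁ * xc P - W.a₃) := by
  rw [ηc_eq hP]
  field_simp
  ring

theorem exists_point_of_ηc [W.IsElliptic] {x η : k} (h : η ^ 2 = W.Ψ₂Sq.eval x) :
    ∃ P : W.Point, P ≠ 0 ∧ xc P = x ∧ ηc P = η := by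
  have he : W.Equation x (2⁻¹ * (η - W.a₁ * x - W.a₃)) := by
    rw [W.equation_iff]
    rw [WeierstrassCurve.Ψ₂Sq] at h
    simp only [eval_add, eval_mul, eval_C, eval_pow, eval_X, b₂, b₄, b₆] at h
    apply mul_left_cancel₀ (four_ne_zero_of_two (k := k))
    have h2 : (2 : k) * 2⁻¹ = 1 := mul_inv_cancel₀ two_ne_zero
    have h4 : (4 : k) * (2⁻¹ * (η - W.a₁ * x - W.a₃)) = 2 * (η - W.a₁ * x - W.a₃) := by
      linear_combination 2 * (η - W.a₁ * x - W.a₃) * h2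
    have h4' : (4 : k) * (2⁻¹ * (η - W.a₁ * x - W.a₃)) ^ 2 = (η - W.a₁ * x - W.a₃) ^ 2 := by
      linear_combination (η - W.a₁ * x - W.a₃) ^ 2 * (2 * 2⁻¹ + 1) * h2
    linear_combination h + h4' + (W.a₁ * x + W.a₃) * h4
  refine ⟨.some _ _ (Affine.equation_iff_nonsingular.mp he), Affine.Point.some_ne_zero _, rfl, ?_⟩
  simp only [ηc]
  field_simp
  ring

theorem exists_point_of_xc [IsAlgClosed k] [W.IsElliptic] (x : k) :
    ∃ P : W.Point, P ≠ 0 ∧ xc P = x := by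
  obtain ⟨η, hη⟩ := IsAlgClosed.exists_pow_nat_eq (W.Ψ₂Sq.eval x) (n := 2) (by norm_num)
  obtain ⟨P, hP, hx, -⟩ := exists_point_of_ηc hη
  exact ⟨P, hP, hx⟩

instance [IsAlgClosed k] [W.IsElliptic] : Infinite W.Point :=
  have : Infinite k := IsAlgClosed.instInfinite
  Infinite.of_surjective xc fun x => (exists_point_of_xc x).imp fun _ h => h.2

/-- A polynomial function on the curve with infinitely many zeros vanishes identically. -/
theorem eq_zero_of_frequently {a b : k[X]}
    (h : ∃ᶠ P : W.Point in cofinite, a.eval (xc P) + b.eval (xc P) * ηc P = 0) :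
    a = 0 ∧ b = 0 := by
  -- This is the norm of `a + bη` down to `k[x]`. Once it vanishes, `b ≠ 0` is impossible, as `a²`
  -- has even degree and `b² Ψ₂Sq` odd degree.
  have h1 : a ^ 2 - b ^ 2 * W.Ψ₂Sq = 0 := by
    refine eq_zero_of_frequently_eval_xc (W := W) ?_
    refine (h.and_eventually (eventually_ne 0)).mono fun P ⟨hP, hP0⟩ => ?_
    simp only [eval_sub, eval_pow, eval_mul, ← ηc_sq hP0]
    linear_combination (a.eval (xc P) - b.eval (xc P) * ηc P) * hP
  have h2 : a ^ 2 = b ^ 2 * W.Ψ₂Sq := sub_eq_zero.mp h1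
  have hb : b = 0 := by
    by_contra hb
    have h3 := congrArg natDegree h2
    rw [natDegree_mul (pow_ne_zero _ hb) twoTorsion_ne_zero, natDegree_pow, natDegree_pow,
      natDegree_twoTorsion] at h3
    omega
  refine ⟨?_, hb⟩
  rw [hb] at h2
  simpa using h2

end Parametrization

/-! ### Translation by a point as a triple of quadratic forms -/

section Translation

variable {k : Type u} [Field k]

/-- The map `φ` is regular at the point `P`. -/
def RegMapAt {W W' : Affine k} (φ : W.Point → W'.Point) (P : W.Point) : Prop :=
  ∃ (d : ℕ) (F : Fin 3 → MvPolynomial (Fin 3) k),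
    (∀ i, (F i).IsHomogeneous d) ∧
    (∃ i, MvPolynomial.eval (coords P) (F i) ≠ 0) ∧
    ∀ Q : W.Point, (∃ i, MvPolynomial.eval (coords Q) (F i) ≠ 0) → RepresentsAt F φ Q

theorem eval_aeval {F : Fin 3 → MvPolynomial (Fin 3) k} (G : MvPolynomial (Fin 3) k)
    (v : Fin 3 → k) :
    MvPolynomial.eval v (MvPolynomial.aeval F G) =
      MvPolynomial.eval (fun i => MvPolynomial.eval v (F i)) G := by
  induction G using MvPolynomial.induction_on with
  | C a => simp
  | add a b ha hb => simp only [map_add, ha, hb]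
  | mul_X a n ha => simp only [map_mul, ha, MvPolynomial.aeval_X, MvPolynomial.eval_X]

theorem RegMapAt.comp {W W' W'' : Affine k} {ψ : W'.Point → W''.Point}
    {φ : W.Point → W'.Point} {P : W.Point} (hψ : RegMapAt ψ (φ P)) (hφ : RegMapAt φ P) :
    RegMapAt (fun P => ψ (φ P)) P := by
  obtain ⟨d, F, hF, ⟨i, hi⟩, hFr⟩ := hφ
  obtain ⟨e, G, hG, ⟨j, hj⟩, hGr⟩ := hψ
  have hev : ∀ (Q : W.Point) (c : k),
      (∀ l, MvPolynomial.eval (coords Q) (F l) = c * coords (φ Q) l) → ∀ l,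
      MvPolynomial.eval (coords Q) (F i * MvPolynomial.aeval F (G l)) =
        MvPolynomial.eval (coords Q) (F i) *
          (c ^ e * MvPolynomial.eval (coords (φ Q)) (G l)) := by
    intro Q c hc l
    rw [map_mul, ← eval_mul_of_isHomogeneous (hG l), eval_aeval, funext hc]
  refine ⟨d + d * e, fun l => F i * MvPolynomial.aeval F (G l),
    fun l => (hF i).mul ((hG l).aeval _ hF), ⟨j, ?_⟩, ?_⟩
  · obtain ⟨c, hc0, hc⟩ := hFr P ⟨i, hi⟩
    rw [hev P c hc j]
    exact mul_ne_zero hi (mul_ne_zero (pow_ne_zero _ hc0) hj)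
  · rintro Q ⟨l, hl⟩
    have hFi : MvPolynomial.eval (coords Q) (F i) ≠ 0 := fun h => hl (by rw [map_mul, h, zero_mul])
    obtain ⟨c, hc0, hc⟩ := hFr Q ⟨i, hFi⟩
    have hGl : MvPolynomial.eval (coords (φ Q)) (G l) ≠ 0 := fun h =>
      hl (by rw [hev Q c hc l, h, mul_zero, mul_zero])
    obtain ⟨c', hc0', hc'⟩ := hGr (φ Q) ⟨l, hGl⟩
    refine ⟨MvPolynomial.eval (coords Q) (F i) * c ^ e * c',
      mul_ne_zero (mul_ne_zero hFi (pow_ne_zero _ hc0)) hc0', fun m => ?_⟩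
    rw [hev Q c hc m, hc' m]
    ring

section Forms

open MvPolynomial

variable (W : Affine k) (x₀ y₀ : k)

/-- The quadratic form that agrees with `X³ / Z` on the curve. -/
noncomputable def cubeForm : MvPolynomial (Fin 3) k :=
  X 1 * X 1 + C W.a₁ * (X 0 * X 1) + C W.a₃ * (X 1 * X 2) - C W.a₂ * (X 0 * X 0)
    - C W.a₄ * (X 0 * X 2) - C W.a₆ * (X 2 * X 2)

/-- The quadratic form that agrees with `(X - x₀ Z)³ / Z` on the curve. -/
noncomputable def translateZ : MvPolynomial (Fin 3) k :=
  cubeForm W - C (3 * x₀) * (X 0 * X 0) + C (3 * x₀ ^ 2) * (X 0 * X 2) - C (x₀ ^ 3) * (X 2 * X 2)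

/-- The numerator of the `x`-coordinate of the translate by `(x₀, y₀)`. -/
noncomputable def translateX : MvPolynomial (Fin 3) k :=
  C x₀ * cubeForm W
    + C (W.a₄ + x₀ ^ 2 + 2 * W.a₂ * x₀ - W.a₁ * y₀) * (X 0 * X 0)
    + C (-W.a₃ - 2 * y₀ - W.a₁ * x₀) * (X 0 * X 1)
    + C (W.a₆ + y₀ ^ 2 + W.a₁ * x₀ * y₀ - (W.a₂ + x₀) * x₀ ^ 2) * (X 0 * X 2)
    - C x₀ * (C x₀ * (X 0 * X 0)
      + C (W.a₄ + x₀ ^ 2 + 2 * W.a₂ * x₀ - W.a₁ * y₀) * (X 0 * X 2)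
      + C (-W.a₃ - 2 * y₀ - W.a₁ * x₀) * (X 1 * X 2)
      + C (W.a₆ + y₀ ^ 2 + W.a₁ * x₀ * y₀ - (W.a₂ + x₀) * x₀ ^ 2) * (X 2 * X 2))

/-- The numerator of the `y`-coordinate of the translate by `(x₀, y₀)`. -/
noncomputable def translateY : MvPolynomial (Fin 3) k :=
  -((X 1 - C y₀ * X 2) * (C (W.a₄ + 3 * x₀ ^ 2 + 2 * W.a₂ * x₀ - W.a₁ * y₀) * X 0
      + C (-W.a₃ - 2 * y₀ - W.a₁ * x₀) * X 1
      + C (W.a₆ + y₀ ^ 2 + W.a₁ * x₀ * y₀ - W.a₂ * x₀ ^ 2 - 2 * x₀ ^ 3) * X 2))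
    - C (y₀ + W.a₃) * translateZ W x₀ - C W.a₁ * translateX W x₀ y₀

theorem isHomogeneous_X_mul_X (i j : Fin 3) :
    (X i * X j : MvPolynomial (Fin 3) k).IsHomogeneous 2 :=
  (isHomogeneous_X _ _).mul (isHomogeneous_X _ _)

theorem isHomogeneous_cubeForm : (cubeForm W).IsHomogeneous 2 := by
  have h := isHomogeneous_X_mul_X (k := k)
  exact (((((h 1 1).add ((h 0 1).C_mul _)).add ((h 1 2).C_mul _)).sub ((h 0 0).C_mul _)).sub
    ((h 0 2).C_mul _)).sub ((h 2 2).C_mul _)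

theorem isHomogeneous_translateZ : (translateZ W x₀).IsHomogeneous 2 := by
  have h := isHomogeneous_X_mul_X (k := k)
  exact (((isHomogeneous_cubeForm W).sub ((h 0 0).C_mul _)).add ((h 0 2).C_mul _)).sub
    ((h 2 2).C_mul _)

theorem isHomogeneous_translateX : (translateX W x₀ y₀).IsHomogeneous 2 := by
  have h := isHomogeneous_X_mul_X (k := k)
  refine ((((((isHomogeneous_cubeForm W).C_mul _).add ((h 0 0).C_mul _)).add
    ((h 0 1).C_mul _)).add ((h 0 2).C_mul _)).sub (IsHomogeneous.C_mul ?_ _))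
  exact ((((h 0 0).C_mul _).add ((h 0 2).C_mul _)).add ((h 1 2).C_mul _)).add ((h 2 2).C_mul _)

theorem isHomogeneous_translateY : (translateY W x₀ y₀).IsHomogeneous 2 := by
  have h : ∀ i, (X i : MvPolynomial (Fin 3) k).IsHomogeneous 1 := fun i => isHomogeneous_X _ _
  refine ((IsHomogeneous.neg ?_).sub ((isHomogeneous_translateZ W x₀).C_mul _)).sub
    ((isHomogeneous_translateX W x₀ y₀).C_mul _)
  exact ((h 1).sub ((h 2).C_mul _)).mul
    ((((h 0).C_mul _).add ((h 1).C_mul _)).add ((h 2).C_mul _))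

end Forms

variable [DecidableEq k]

theorem xc_add_ne {W : Affine k} {P Q : W.Point} (hP : P ≠ 0) (hQ : Q ≠ 0) (h : xc P ≠ xc Q) :
    P + Q ≠ 0 ∧
    xc (P + Q) = ((yc P - yc Q) / (xc P - xc Q)) ^ 2 + W.a₁ * ((yc P - yc Q) / (xc P - xc Q))
      - W.a₂ - xc P - xc Q ∧
    yc (P + Q) = -((yc P - yc Q) / (xc P - xc Q) * (xc (P + Q) - xc P) + yc P)
      - W.a₁ * xc (P + Q) - W.a₃ := by
  cases P with
  | zero => exact absurd rfl hP
  | some x y hx =>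
    cases Q with
    | zero => exact absurd rfl hQ
    | some x' y' hx' =>
      simp only [xc_some] at h
      rw [Affine.Point.add_of_X_ne h]
      refine ⟨Affine.Point.some_ne_zero _, ?_, ?_⟩
      · simp only [xc_some, yc_some, Affine.addX, Affine.slope_of_X_ne h]
      · simp only [xc_some, yc_some, Affine.addY, Affine.negAddY, Affine.negY,
          Affine.slope_of_X_ne h]

/-- The chord formula has denominator `(x - x₀)³`; after clearing it, the numerators become
quadratic forms because `X³ / Z` is one on the curve. The scalar is `(x - x₀)³` in general, `-(y -
y₀)³` at the opposite point and `1` at infinity. At `(x₀, y₀)` itself all three forms vanish, hence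
the exclusion. -/
theorem representsAt_translate {W : Affine k} {x₀ y₀ : k} (h₀ : W.Nonsingular x₀ y₀)
    {P : W.Point} (hP : P ≠ .some x₀ y₀ h₀) :
    RepresentsAt ![translateX W x₀ y₀, translateY W x₀ y₀, translateZ W x₀]
      (fun P : W.Point => P + .some x₀ y₀ h₀) P := by
  have e₀ := (W.equation_iff x₀ y₀).mp h₀.1
  by_cases hP0 : P = 0
  · subst hP0
    refine ⟨1, one_ne_zero, fun i => ?_⟩
    simp only [zero_add]
    fin_cases i
    · simp [coords, translateX, cubeForm]
    · simp [coords, translateX, translateY, translateZ, cubeForm]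
      ring
    · simp [coords, translateX, translateY, translateZ, cubeForm]
  have e := equation_of_ne_zero hP0
  by_cases hx : xc P = x₀
  · have hP' : P = -.some x₀ y₀ h₀ :=
      (eq_or_eq_neg_of_xc_eq hP0 (Affine.Point.some_ne_zero h₀) hx).resolve_left hP
    have hy : yc P ≠ y₀ := fun hy => hP (point_ext hP0 (Affine.Point.some_ne_zero h₀) hx hy)
    refine ⟨-(yc P - y₀) ^ 3, neg_ne_zero.mpr (pow_ne_zero _ (sub_ne_zero.mpr hy)), fun i => ?_⟩
    have hsum : P + .some x₀ y₀ h₀ = 0 := by rw [hP', neg_add_cancel]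
    simp only [hsum]
    rw [coords_of_ne_zero hP0, coords_zero, hx]
    rw [hx] at e
    fin_cases i
    · simp [translateX, cubeForm]
      linear_combination x₀ * e
    · simp [translateX, translateY, translateZ, cubeForm]
      linear_combination (yc P - 2 * y₀ - W.a₃ - W.a₁ * x₀) * e
    · simp [translateZ, cubeForm]
      linear_combination e
  · obtain ⟨hne, hX, hY⟩ := xc_add_ne hP0 (Affine.Point.some_ne_zero h₀) hx
    simp only [xc_some, yc_some] at hX hY
    have hx' : xc P - x₀ ≠ 0 := sub_ne_zero.mpr hx
    refine ⟨(xc P - x₀) ^ 3, pow_ne_zero _ hx', fun i => ?_⟩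
    have hX' : (xc P - x₀) ^ 2 * xc (P + .some x₀ y₀ h₀) = (yc P - y₀) ^ 2 +
        W.a₁ * (yc P - y₀) * (xc P - x₀) - (W.a₂ + xc P + x₀) * (xc P - x₀) ^ 2 := by
      rw [hX]
      field_simp
      ring
    have hY' : (xc P - x₀) * yc (P + .some x₀ y₀ h₀) =
        -((yc P - y₀) * (xc (P + .some x₀ y₀ h₀) - xc P) + yc P * (xc P - x₀))
        - W.a₁ * xc (P + .some x₀ y₀ h₀) * (xc P - x₀) - W.a₃ * (xc P - x₀) := by
      rw [hY]
      field_simp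
    rw [coords_of_ne_zero hP0]
    simp only [coords_of_ne_zero hne]
    generalize xc (P + .some x₀ y₀ h₀) = x₃ at *
    generalize yc (P + .some x₀ y₀ h₀) = y₃ at *
    generalize xc P = x at *
    generalize yc P = y at *
    fin_cases i
    · simp [translateX, cubeForm]
      linear_combination (2 * x₀ - x) * e - (x - x₀) * hX'
    · simp [translateX, translateY, translateZ, cubeForm]
      linear_combination (y - 2 * y₀ - W.a₃ - W.a₁ * (2 * x₀ - x)) * e
        + (y - y₀ + W.a₁ * (x - x₀)) * hX' - (x - x₀) ^ 2 * hY'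
    · simp [translateZ, cubeForm]
      linear_combination e

end Translation

/-! ### Translations are regular everywhere -/

section Translation

variable {k : Type u} [Field k] [DecidableEq k]

theorem regMapAt_add_right_of_ne {W : Affine k} {P Q : W.Point} (h : P ≠ Q) :
    RegMapAt (fun P : W.Point => P + Q) P := by
  cases Q with
  | zero =>
    have : (fun P : W.Point => P + Affine.Point.zero) = fun P => P := funext fun P => add_zero P
    rw [this]
    exact isRegularMap_id P
  | some x₀ y₀ h₀ =>
    refine ⟨2, ![translateX W x₀ y₀, translateY W x₀ y₀, translateZ W x₀], ?_, ?_, ?_⟩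
    · intro i
      fin_cases i
      · exact isHomogeneous_translateX W x₀ y₀
      · exact isHomogeneous_translateY W x₀ y₀
      · exact isHomogeneous_translateZ W x₀
    · obtain ⟨c, hc, hr⟩ := representsAt_translate h₀ h
      obtain ⟨i, hi⟩ := coords_ne_zero (P + .some x₀ y₀ h₀)
      exact ⟨i, by rw [hr i]; exact mul_ne_zero hc hi⟩
    · intro R hR
      by_cases hRQ : R = .some x₀ y₀ h₀
      · exfalso
        obtain ⟨i, hi⟩ := hR
        apply hi
        have e := (W.equation_iff x₀ y₀).mp h₀.1
        subst hRQ
        fin_cases i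
        · simp [translateX, cubeForm, coords]
          linear_combination x₀ * e
        · simp [translateX, translateY, translateZ, cubeForm, coords]
          linear_combination (- y₀ - W.a₃ - W.a₁ * x₀) * e
        · simp [translateZ, cubeForm, coords]
          linear_combination e
      · exact representsAt_translate h₀ hRQ

variable [NeZero (2 : k)] {W : Affine k}

theorem finite_two_nsmul_eq_zero : {P : W.Point | 2 • P = 0}.Finite := by
  have h : ∀ᶠ P : W.Point in cofinite, ¬ 2 • P = 0 := by
    filter_upwards [eventually_ne 0, eventually_eval_xc_ne_zero (twoTorsion_ne_zero (W := W))]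
      with P hP0 hP h
    rw [two_nsmul, add_eq_zero_iff_eq_neg] at h
    have h1 : ηc P = -ηc P := by conv_lhs => rw [h, ηc_neg]
    have h2 : ηc P = 0 := by
      have : 2 * ηc P = 0 := by linear_combination h1
      exact (mul_eq_zero.mp this).resolve_left two_ne_zero
    rw [← ηc_sq hP0, h2] at hP
    exact hP (by ring)
  simpa using h

theorem eventually_two_nsmul_ne (R : W.Point) : ∀ᶠ P : W.Point in cofinite, 2 • P ≠ R := by
  by_cases h : ∃ P₀ : W.Point, 2 • P₀ = R
  · obtain ⟨P₀, rfl⟩ := h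
    have hf : {P : W.Point | 2 • (P - P₀) = 0}.Finite :=
      finite_two_nsmul_eq_zero.preimage (sub_left_injective.injOn)
    filter_upwards [hf.eventually_cofinite_notMem] with P hP h
    exact hP (by simp [nsmul_sub, h])
  · exact Eventually.of_forall fun P hP => h ⟨P, hP⟩

variable [IsAlgClosed k] [W.IsElliptic]

/-- The quadratic forms for translation by `Q` fail only at `Q`. At that point, factor the
translation through those by `R` and `Q - R`; a generic `R` avoids the bad point of each factor. -/
theorem regMapAt_add_right (P Q : W.Point) : RegMapAt (fun P : W.Point => P + Q) P := by
  by_cases h : P = Q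
  · obtain ⟨R, hR1, hR2⟩ :=
      ((eventually_ne P).and (eventually_two_nsmul_ne (W := W) (Q - P))).exists
    have h1 : RegMapAt (fun P : W.Point => P + R) P := regMapAt_add_right_of_ne hR1.symm
    have h2 : RegMapAt (fun P : W.Point => P + (Q - R)) (P + R) := by
      refine regMapAt_add_right_of_ne fun h' => hR2 ?_
      rw [two_nsmul, eq_sub_iff_add_eq]
      rw [eq_sub_iff_add_eq] at h'
      rw [← h']
      abel
    have := RegMapAt.comp (φ := fun P : W.Point => P + R) h2 h1
    convert this using 2 with Z
    abel
  · exact regMapAt_add_right_of_ne h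

theorem isRegularMap_add_right (Q : W.Point) : IsRegularMap (fun P : W.Point => P + Q) :=
  fun P => regMapAt_add_right P Q

end Translation

/-! ### Irreducibility of the curve -/

section Irreducibility

variable {k : Type u} [Field k] [NeZero (2 : k)] {W : Affine k}

/-- The affine coordinate ring is generated over `k[x]` by `1` and `η`: `y` is a combination of `η`,
`x` and `1`, and `η²` lies in `k[x]`. -/
theorem exists_form_eq (H : MvPolynomial (Fin 3) k) : ∃ a b : k[X], ∀ P : W.Point, P ≠ 0 →
    MvPolynomial.eval (coords P) H = a.eval (xc P) + b.eval (xc P) * ηc P := by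
  induction H using MvPolynomial.induction_on with
  | C c => exact ⟨Polynomial.C c, 0, fun P _ => by simp⟩
  | add f g hf hg =>
    obtain ⟨a, b, h⟩ := hf
    obtain ⟨a', b', h'⟩ := hg
    refine ⟨a + a', b + b', fun P hP => ?_⟩
    simp only [map_add, h P hP, h' P hP, eval_add]
    ring
  | mul_X f i hf =>
    obtain ⟨a, b, h⟩ := hf
    fin_cases i
    · refine ⟨a * Polynomial.X, b * Polynomial.X, fun P hP => ?_⟩
      simp only [map_mul, h P hP, MvPolynomial.eval_X]
      simp [coords_of_ne_zero hP]
      ring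
    · refine ⟨Polynomial.C 2⁻¹ * (b * W.Ψ₂Sq -
          a * (Polynomial.C W.a₁ * Polynomial.X + Polynomial.C W.a₃)),
        Polynomial.C 2⁻¹ * (a - b * (Polynomial.C W.a₁ * Polynomial.X + Polynomial.C W.a₃)),
        fun P hP => ?_⟩
      simp only [map_mul, h P hP, MvPolynomial.eval_X]
      simp [coords_of_ne_zero hP, ← ηc_sq hP, yc_eq hP]
      ring
    · refine ⟨a, b, fun P hP => ?_⟩
      simp only [map_mul, h P hP, MvPolynomial.eval_X]
      simp [coords_of_ne_zero hP]

theorem form_eq_zero_of_frequently {H : MvPolynomial (Fin 3) k}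
    (h : ∃ᶠ P : W.Point in cofinite, MvPolynomial.eval (coords P) H = 0) {P : W.Point}
    (hP : P ≠ 0) : MvPolynomial.eval (coords P) H = 0 := by
  obtain ⟨a, b, hab⟩ := exists_form_eq (W := W) H
  obtain ⟨rfl, rfl⟩ := eq_zero_of_frequently (W := W) (a := a) (b := b)
    ((h.and_eventually (eventually_ne 0)).mono fun P ⟨h1, h2⟩ => by rw [← hab P h2, h1])
  rw [hab P hP]
  simp

variable [DecidableEq k] [IsAlgClosed k] [W.IsElliptic]

/-- A homogeneous form that does not vanish at some point of the curve has only finitely many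
zeros on it. -/
theorem eventually_form_ne_zero {H : MvPolynomial (Fin 3) k} {d : ℕ} (hH : H.IsHomogeneous d)
    {P : W.Point} (hP : MvPolynomial.eval (coords P) H ≠ 0) :
    ∀ᶠ Q : W.Point in cofinite, MvPolynomial.eval (coords Q) H ≠ 0 := by
  by_contra hcon
  have hfr : ∃ᶠ Q : W.Point in cofinite, MvPolynomial.eval (coords Q) H = 0 := by
    intro h
    exact hcon h
  have haff : ∀ Q : W.Point, Q ≠ 0 → MvPolynomial.eval (coords Q) H = 0 :=
    fun Q hQ => form_eq_zero_of_frequently hfr hQ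
  have hP0 : P = 0 := by
    by_contra h
    exact hP (haff P h)
  subst hP0
  -- The form vanishes at every affine point, so only infinity can remain. Translation by `Q`
  -- carries the affine point `-Q` to infinity, and the pulled-back form falls under the affine
  -- case.
  obtain ⟨Q, hQ0⟩ := (eventually_ne (0 : W.Point)).exists
  obtain ⟨e, F, hF, ⟨i, hi⟩, hr⟩ := regMapAt_add_right (-Q) Q
  have hev : ∀ R : W.Point, MvPolynomial.eval (coords R) (F i) ≠ 0 → ∃ c : k, c ≠ 0 ∧
      MvPolynomial.eval (coords R) (MvPolynomial.aeval F H) =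
        c * MvPolynomial.eval (coords (R + Q)) H := by
    intro R hR
    obtain ⟨c, hc, h⟩ := hr R ⟨i, hR⟩
    exact ⟨c ^ d, pow_ne_zero _ hc, by
      rw [eval_aeval, funext h, eval_mul_of_isHomogeneous hH]⟩
  obtain ⟨c, hc, h⟩ := hev (-Q) hi
  rw [neg_add_cancel] at h
  -- The factor `F i` makes the product vanish also where the triple `F` may fail to represent the
  -- translation.
  have hz : ∃ᶠ R : W.Point in cofinite, MvPolynomial.eval (coords R)
      (F i * MvPolynomial.aeval F H) = 0 := by
    refine Eventually.frequently ?_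
    filter_upwards [eventually_ne (-Q)] with R hR
    by_cases hRi : MvPolynomial.eval (coords R) (F i) = 0
    · rw [map_mul, hRi, zero_mul]
    · obtain ⟨c', _, h'⟩ := hev R hRi
      rw [map_mul, h', haff _ fun h0 => hR (eq_neg_of_add_eq_zero_left h0), mul_zero, mul_zero]
  have := form_eq_zero_of_frequently hz (neg_ne_zero.mpr hQ0)
  rw [map_mul, h] at this
  exact mul_ne_zero hi (mul_ne_zero hc hP) this

end Irreducibility

/-! ### Germs of rational functions and their values at a point -/

section RegVal

variable {k : Type u} [Field k] {W : Affine k}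

/-- The germ of the function `f` along cofinite sets is a rational function that is regular at the
point `P`, with value `v` there. -/
def RegVal (f : W.Point → k) (P : W.Point) (v : k) : Prop :=
  ∃ (d : ℕ) (G H : MvPolynomial (Fin 3) k), G.IsHomogeneous d ∧ H.IsHomogeneous d ∧
    MvPolynomial.eval (coords P) H ≠ 0 ∧
    MvPolynomial.eval (coords P) G = v * MvPolynomial.eval (coords P) H ∧
    ∀ᶠ Q : W.Point in cofinite, f Q * MvPolynomial.eval (coords Q) H =
      MvPolynomial.eval (coords Q) G

/-- The function `f` is a rational function (up to finitely many values). -/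
def IsRat (f : W.Point → k) : Prop :=
  ∃ a b c : k[X], c ≠ 0 ∧ ∀ᶠ P : W.Point in cofinite,
    c.eval (xc P) * f P = a.eval (xc P) + b.eval (xc P) * ηc P

theorem RegVal.congr {f g : W.Point → k} {P : W.Point} {v : k} (hf : RegVal f P v)
    (h : f =ᶠ[cofinite] g) : RegVal g P v := by
  obtain ⟨d, G, H, hG, hH, h1, h2, h3⟩ := hf
  refine ⟨d, G, H, hG, hH, h1, h2, ?_⟩
  filter_upwards [h3, h] with Q hQ hQ'
  rw [← hQ', hQ]

theorem RegVal.const (c : k) (P : W.Point) : RegVal (fun _ => c) P c :=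
  ⟨0, MvPolynomial.C c, 1, MvPolynomial.isHomogeneous_C _ _, MvPolynomial.isHomogeneous_one _ _,
    by simp, by simp, by simp⟩

theorem RegVal.add {f g : W.Point → k} {P : W.Point} {v w : k} (hf : RegVal f P v)
    (hg : RegVal g P w) : RegVal (fun Q => f Q + g Q) P (v + w) := by
  obtain ⟨d, G, H, hG, hH, h1, h2, h3⟩ := hf
  obtain ⟨d', G', H', hG', hH', h1', h2', h3'⟩ := hg
  refine ⟨d + d', G * H' + H * G', H * H', (hG.mul hH').add (hH.mul hG'), hH.mul hH', ?_, ?_, ?_⟩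
  · rw [map_mul]
    exact mul_ne_zero h1 h1'
  · simp only [map_mul, map_add, h2, h2']
    ring
  · filter_upwards [h3, h3'] with Q hQ hQ'
    simp only [map_mul, map_add, ← hQ, ← hQ']
    ring

theorem RegVal.mul {f g : W.Point → k} {P : W.Point} {v w : k} (hf : RegVal f P v)
    (hg : RegVal g P w) : RegVal (fun Q => f Q * g Q) P (v * w) := by
  obtain ⟨d, G, H, hG, hH, h1, h2, h3⟩ := hf
  obtain ⟨d', G', H', hG', hH', h1', h2', h3'⟩ := hg
  refine ⟨d + d', G * G', H * H', hG.mul hG', hH.mul hH', ?_, ?_, ?_⟩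
  · rw [map_mul]
    exact mul_ne_zero h1 h1'
  · simp only [map_mul, h2, h2']
    ring
  · filter_upwards [h3, h3'] with Q hQ hQ'
    simp only [map_mul, ← hQ, ← hQ']
    ring

theorem RegVal.const_mul {f : W.Point → k} {P : W.Point} {v : k} (c : k) (hf : RegVal f P v) :
    RegVal (fun Q => c * f Q) P (c * v) :=
  (RegVal.const c P).mul hf

theorem RegVal.neg {f : W.Point → k} {P : W.Point} {v : k} (hf : RegVal f P v) :
    RegVal (fun Q => -f Q) P (-v) := by
  simpa using hf.const_mul (-1)

theorem RegVal.sub {f g : W.Point → k} {P : W.Point} {v w : k} (hf : RegVal f P v)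
    (hg : RegVal g P w) : RegVal (fun Q => f Q - g Q) P (v - w) := by
  simpa [sub_eq_add_neg] using hf.add hg.neg

theorem RegVal.pow {f : W.Point → k} {P : W.Point} {v : k} (hf : RegVal f P v) (n : ℕ) :
    RegVal (fun Q => f Q ^ n) P (v ^ n) := by
  induction n with
  | zero => simpa using RegVal.const 1 P
  | succ n ih => simpa [pow_succ] using ih.mul hf

theorem RegVal.sum {ι : Type*} {f : ι → W.Point → k} {P : W.Point} {v : ι → k} (s : Finset ι)
    (hf : ∀ i ∈ s, RegVal (f i) P (v i)) :
    RegVal (fun Q => ∑ i ∈ s, f i Q) P (∑ i ∈ s, v i) := by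
  classical
  induction s using Finset.induction_on with
  | empty => simpa using RegVal.const 0 P
  | insert a s ha ih =>
    simp only [Finset.sum_insert ha]
    exact (hf a (Finset.mem_insert_self a s)).add
      (ih fun i hi => hf i (Finset.mem_insert_of_mem hi))

theorem RegVal.prod {ι : Type*} {f : ι → W.Point → k} {P : W.Point} {v : ι → k} (s : Finset ι)
    (hf : ∀ i ∈ s, RegVal (f i) P (v i)) :
    RegVal (fun Q => ∏ i ∈ s, f i Q) P (∏ i ∈ s, v i) := by
  classical
  induction s using Finset.induction_on with
  | empty => simpa using RegVal.const 1 P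
  | insert a s ha ih =>
    simp only [Finset.prod_insert ha]
    exact (hf a (Finset.mem_insert_self a s)).mul
      (ih fun i hi => hf i (Finset.mem_insert_of_mem hi))

theorem RegVal.eval {f : W.Point → k} {P : W.Point} {v : k} (hf : RegVal f P v) (a : k[X]) :
    RegVal (fun Q => a.eval (f Q)) P (a.eval v) := by
  simp only [Polynomial.eval_eq_sum, Polynomial.sum]
  exact RegVal.sum _ fun i _ => (hf.pow i).const_mul _

theorem regVal_xc {P : W.Point} (hP : P ≠ 0) : RegVal xc P (xc P) := by
  refine ⟨1, MvPolynomial.X 0, MvPolynomial.X 2, MvPolynomial.isHomogeneous_X _ _,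
    MvPolynomial.isHomogeneous_X _ _, ?_, ?_, ?_⟩
  · simp [coords_of_ne_zero hP]
  · simp [coords_of_ne_zero hP]
  · filter_upwards [eventually_ne 0] with Q hQ
    simp [coords_of_ne_zero hQ]

theorem regVal_yc {P : W.Point} (hP : P ≠ 0) : RegVal yc P (yc P) := by
  refine ⟨1, MvPolynomial.X 1, MvPolynomial.X 2, MvPolynomial.isHomogeneous_X _ _,
    MvPolynomial.isHomogeneous_X _ _, ?_, ?_, ?_⟩
  · simp [coords_of_ne_zero hP]
  · simp [coords_of_ne_zero hP]
  · filter_upwards [eventually_ne 0] with Q hQ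
    simp [coords_of_ne_zero hQ]

theorem regVal_ηc {P : W.Point} (hP : P ≠ 0) : RegVal ηc P (ηc P) := by
  rw [ηc_eq hP]
  refine ((((regVal_yc hP).const_mul 2).add ((regVal_xc hP).const_mul W.a₁)).add
    (RegVal.const W.a₃ P)).congr ?_
  filter_upwards [eventually_ne 0] with Q hQ
  rw [ηc_eq hQ]

/-- The function `1 / x` vanishes at infinity. -/
theorem regVal_inv_xc_zero : RegVal (fun Q : W.Point => (xc Q)⁻¹) 0 0 := by
  -- `1 / x = Z / X` is indeterminate at infinity; multiplied through by `X²` it becomes `X² / (X³ /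
  -- Z)`, whose denominator is `Y²` plus terms vanishing there.
  refine ⟨2, MvPolynomial.X 0 * MvPolynomial.X 0, cubeForm W, isHomogeneous_X_mul_X 0 0,
    isHomogeneous_cubeForm W, ?_, ?_, ?_⟩
  · simp [coords_zero, cubeForm]
  · simp [coords_zero]
  · have hx : ∀ᶠ Q : W.Point in cofinite, xc Q ≠ 0 := by
      simpa using eventually_eval_xc_ne_zero (W := W) (Polynomial.X_ne_zero (R := k))
    filter_upwards [eventually_ne 0, hx] with Q hQ hx
    have e := equation_of_ne_zero hQ
    rw [inv_mul_eq_iff_eq_mul₀ hx]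
    simp [coords_of_ne_zero hQ, cubeForm]
    linear_combination e

section Irred

variable [DecidableEq k] [NeZero (2 : k)] [IsAlgClosed k] [W.IsElliptic]

theorem RegVal.eventually_ne_zero {f : W.Point → k} {P : W.Point} {v : k} (hf : RegVal f P v)
    (hv : v ≠ 0) : ∀ᶠ Q in cofinite, f Q ≠ 0 := by
  obtain ⟨d, G, H, hG, hH, h1, h2, h3⟩ := hf
  have hGP : MvPolynomial.eval (coords P) G ≠ 0 := by
    rw [h2]
    exact mul_ne_zero hv h1
  filter_upwards [h3, eventually_form_ne_zero hG hGP] with Q hQ hQG h0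
  rw [h0, zero_mul] at hQ
  exact hQG hQ.symm

theorem RegVal.eq_zero_of_frequently {f : W.Point → k} {P : W.Point} {v : k} (hf : RegVal f P v)
    (h : ∃ᶠ Q in cofinite, f Q = 0) : v = 0 := by
  by_contra hv
  exact h (hf.eventually_ne_zero hv)

/-- A function with a nonzero value at one point is generically nonzero, so the zero germ has only
the value zero. This makes values at infinity and at poles of the formulas well defined. -/
theorem RegVal.unique {f : W.Point → k} {P : W.Point} {v w : k} (hf : RegVal f P v)
    (hg : RegVal f P w) : v = w := by
  have := (hf.sub hg).eq_zero_of_frequently 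
    (Eventually.frequently (Eventually.of_forall fun _ => sub_self _))
  exact sub_eq_zero.mp this

theorem RegVal.inv {f : W.Point → k} {P : W.Point} {v : k} (hf : RegVal f P v) (hv : v ≠ 0) :
    RegVal (fun Q => (f Q)⁻¹) P v⁻¹ := by
  have hne := hf.eventually_ne_zero hv
  obtain ⟨d, G, H, hG, hH, h1, h2, h3⟩ := hf
  refine ⟨d, H, G, hH, hG, ?_, ?_, ?_⟩
  · rw [h2]
    exact mul_ne_zero hv h1
  · rw [h2, inv_mul_cancel_left₀ hv]
  · filter_upwards [h3, hne] with Q hQ hQ0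
    rw [← hQ, inv_mul_cancel_left₀ hQ0]

theorem RegVal.div {f g : W.Point → k} {P : W.Point} {v w : k} (hf : RegVal f P v)
    (hg : RegVal g P w) (hw : w ≠ 0) : RegVal (fun Q => f Q / g Q) P (v / w) := by
  simpa only [div_eq_mul_inv] using hf.mul (hg.inv hw)

end Irred

/-- Substitute the local triple into numerator and denominator. The extra factor `F i` keeps the
generic identity true at points where the triple does not represent `φ`; `hfin` is needed because
that identity is only known off a finite set of the target. -/
theorem RegVal.comp {W' : Affine k} {φ : W.Point → W'.Point} {f : W'.Point → k} {P : W.Point}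
    {v : k} (hf : RegVal f (φ P) v) (hφ : RegMapAt φ P)
    (hfin : Tendsto φ cofinite cofinite) : RegVal (fun Q => f (φ Q)) P v := by
  obtain ⟨d, G, H, hG, hH, h1, h2, h3⟩ := hf
  obtain ⟨e, F, hF, ⟨i, hi⟩, hr⟩ := hφ
  have hev : ∀ (K : MvPolynomial (Fin 3) k), K.IsHomogeneous d → ∀ (Q : W.Point) (c : k),
      (∀ l, MvPolynomial.eval (coords Q) (F l) = c * coords (φ Q) l) →
      MvPolynomial.eval (coords Q) (F i * MvPolynomial.aeval F K) =
        MvPolynomial.eval (coords Q) (F i) * (c ^ d * MvPolynomial.eval (coords (φ Q)) K) := by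
    intro K hK Q c hc
    rw [map_mul, ← eval_mul_of_isHomogeneous hK, eval_aeval, funext hc]
  refine ⟨e + e * d, F i * MvPolynomial.aeval F G, F i * MvPolynomial.aeval F H,
    (hF i).mul (hG.aeval _ hF), (hF i).mul (hH.aeval _ hF), ?_, ?_, ?_⟩
  · obtain ⟨c, hc, h⟩ := hr P ⟨i, hi⟩
    rw [hev H hH P c h]
    exact mul_ne_zero hi (mul_ne_zero (pow_ne_zero _ hc) h1)
  · obtain ⟨c, hc, h⟩ := hr P ⟨i, hi⟩
    rw [hev H hH P c h, hev G hG P c h, h2]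
    ring
  · filter_upwards [hfin.eventually h3] with Q hQ
    by_cases hQi : MvPolynomial.eval (coords Q) (F i) = 0
    · simp [hQi]
    · obtain ⟨c, hc, h⟩ := hr Q ⟨i, hQi⟩
      rw [hev H hH Q c h, hev G hG Q c h, ← hQ]
      ring

end RegVal

/-! ### The field of rational functions -/

section RationalFunctions

variable {k : Type u} [Field k] {W : Affine k}

theorem IsRat.congr {f g : W.Point → k} (hf : IsRat f) (h : f =ᶠ[cofinite] g) : IsRat g := by
  obtain ⟨a, b, c, hc, habc⟩ := hf
  refine ⟨a, b, c, hc, ?_⟩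
  filter_upwards [habc, h] with P hP hP'
  rw [← hP', hP]

theorem tendsto_neg : Tendsto (fun P : W.Point => -P) cofinite cofinite :=
  neg_injective.tendsto_cofinite

theorem tendsto_add_right [DecidableEq k] (Q : W.Point) :
    Tendsto (fun P : W.Point => P + Q) cofinite cofinite :=
  (add_left_injective Q).tendsto_cofinite

theorem RegVal.comp_neg {f : W.Point → k} {P : W.Point} {v : k} (hf : RegVal f (-P) v) :
    RegVal (fun Q => f (-Q)) P v :=
  hf.comp (isRegularMap_neg P) tendsto_neg

theorem eventually_ηc_ne_zero [NeZero (2 : k)] : ∀ᶠ P : W.Point in cofinite, ηc P ≠ 0 := by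
  filter_upwards [eventually_eval_xc_ne_zero (twoTorsion_ne_zero (W := W)), eventually_ne 0]
    with P hP hP0 h
  rw [← ηc_sq hP0, h] at hP
  exact hP (by ring)

theorem exists_coprime_factors (a : k[X]) {c : k[X]} (hc : c ≠ 0) :
    ∃ g a' c' : k[X], g ≠ 0 ∧ a = g * a' ∧ c = g * c' ∧ IsCoprime a' c' := by
  classical
  have hg : EuclideanDomain.gcd a c ≠ 0 := fun h => hc (EuclideanDomain.gcd_eq_zero_iff.mp h).2
  have hbez := EuclideanDomain.gcd_eq_gcd_ab a c
  obtain ⟨a', ha⟩ := EuclideanDomain.gcd_dvd_left a c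
  obtain ⟨c', hc'⟩ := EuclideanDomain.gcd_dvd_right a c
  generalize EuclideanDomain.gcd a c = g at *
  refine ⟨g, a', c', hg, ha, hc', EuclideanDomain.gcdA a c, EuclideanDomain.gcdB a c, ?_⟩
  generalize EuclideanDomain.gcdA a c = u at *
  generalize EuclideanDomain.gcdB a c = v at *
  apply mul_left_cancel₀ hg
  rw [mul_one]
  conv_rhs => rw [hbez, ha, hc']
  ring

variable [NeZero (2 : k)]

/-- Comparing the expressions at `P` and `-P`, where only `η` changes sign, removes the term in `η`.
An even rational function is thus a function of `x`. -/
theorem IsRat.exists_even {f : W.Point → k} (hf : IsRat f)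
    (he : ∀ᶠ P in cofinite, f (-P) = f P) :
    ∃ a c : k[X], c ≠ 0 ∧ IsCoprime a c ∧
      ∀ᶠ P : W.Point in cofinite, c.eval (xc P) * f P = a.eval (xc P) := by
  obtain ⟨a, b, c, hc, h⟩ := hf
  have hb : ∀ᶠ P : W.Point in cofinite, c.eval (xc P) * f P = a.eval (xc P) := by
    filter_upwards [h, tendsto_neg.eventually h, he] with P hP hP' heP
    rw [heP, xc_neg, ηc_neg] at hP'
    have : (2 : k) * (b.eval (xc P) * ηc P) = 0 := by linear_combination hP' - hP
    rw [hP, (mul_eq_zero.mp this).resolve_left two_ne_zero, add_zero]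
  obtain ⟨g, a', c', hg, ha, hc', hcop⟩ := exists_coprime_factors a hc
  refine ⟨a', c', fun h0 => hc (by rw [hc', h0, mul_zero]), hcop, ?_⟩
  filter_upwards [hb, eventually_eval_xc_ne_zero hg] with P hP hgP
  rw [ha, hc', eval_mul, eval_mul, mul_assoc] at hP
  exact mul_left_cancel₀ hgP hP

theorem IsRat.exists_odd {f : W.Point → k} (hf : IsRat f)
    (ho : ∀ᶠ P in cofinite, f (-P) = -f P) :
    ∃ a c : k[X], c ≠ 0 ∧
      ∀ᶠ P : W.Point in cofinite, c.eval (xc P) * f P = a.eval (xc P) * ηc P := by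
  obtain ⟨a, b, c, hc, h⟩ := hf
  refine ⟨b, c, hc, ?_⟩
  filter_upwards [h, tendsto_neg.eventually h, ho] with P hP hP' hoP
  rw [hoP, xc_neg, ηc_neg] at hP'
  have : (2 : k) * a.eval (xc P) = 0 := by linear_combination -hP' - hP
  rw [hP, (mul_eq_zero.mp this).resolve_left two_ne_zero, zero_add]

variable [DecidableEq k] [IsAlgClosed k] [W.IsElliptic]

/-- Rationalise the denominator `a' + b'η` with its conjugate `a' - b'η`. -/
theorem RegVal.isRat {f : W.Point → k} {P : W.Point} {v : k} (hf : RegVal f P v) : IsRat f := by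
  obtain ⟨d, G, H, -, hH, h1, -, h3⟩ := hf
  obtain ⟨a, b, hab⟩ := exists_form_eq (W := W) G
  obtain ⟨a', b', hab'⟩ := exists_form_eq (W := W) H
  have hne := eventually_form_ne_zero hH h1
  refine ⟨a * a' - b * b' * W.Ψ₂Sq, b * a' - a * b', a' ^ 2 - b' ^ 2 * W.Ψ₂Sq, ?_, ?_⟩
  · intro h0
    have hz : ∀ᶠ Q : W.Point in cofinite, a'.eval (xc Q) + (-b').eval (xc Q) * ηc Q = 0 := by
      filter_upwards [hne, eventually_ne 0] with Q hQ hQ0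
      rw [hab' Q hQ0] at hQ
      have := congrArg (Polynomial.eval (xc Q)) h0
      simp only [eval_sub, eval_pow, eval_mul, ← ηc_sq hQ0, eval_zero] at this
      refine (mul_eq_zero.mp (?_ : (a'.eval (xc Q) + b'.eval (xc Q) * ηc Q) * _ = 0)).resolve_left
        hQ
      rw [eval_neg]
      linear_combination this
    obtain ⟨ha, hb⟩ := EisensteinGraph.eq_zero_of_frequently hz.frequently
    obtain ⟨Q, hQ, hQ0⟩ := (hne.and (eventually_ne 0)).exists
    rw [hab' Q hQ0, ha, neg_eq_zero.mp hb] at hQ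
    simp at hQ
  · filter_upwards [h3, eventually_ne 0] with Q hQ hQ0
    rw [hab Q hQ0, hab' Q hQ0] at hQ
    simp only [eval_sub, eval_mul, eval_pow, ← ηc_sq hQ0]
    linear_combination (a'.eval (xc Q) - b'.eval (xc Q) * ηc Q) * hQ

/-- Converse passage to `RegVal.isRat`: closure of `IsRat` under an operation is read off from
`RegVal` at any one point where all the functions involved are regular. -/
theorem IsRat.eventually_regVal {f : W.Point → k} (hf : IsRat f) :
    ∀ᶠ P in cofinite, RegVal f P (f P) := by
  obtain ⟨a, b, c, hc, h⟩ := hf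
  filter_upwards [h, eventually_ne 0, eventually_eval_xc_ne_zero hc] with P hP hP0 hcP
  have hx := regVal_xc hP0
  have := ((hx.eval a).add ((hx.eval b).mul (regVal_ηc hP0))).div (hx.eval c) hcP
  rw [← hP, mul_div_cancel_left₀ _ hcP] at this
  refine this.congr ?_
  filter_upwards [h, eventually_eval_xc_ne_zero hc] with Q hQ hcQ
  rw [← hQ, mul_div_cancel_left₀ _ hcQ]

theorem isRat_xc : IsRat (xc : W.Point → k) := by
  obtain ⟨P, hP⟩ := (eventually_ne (0 : W.Point)).exists
  exact (regVal_xc hP).isRat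

theorem isRat_yc : IsRat (yc : W.Point → k) := by
  obtain ⟨P, hP⟩ := (eventually_ne (0 : W.Point)).exists
  exact (regVal_yc hP).isRat

theorem isRat_ηc : IsRat (ηc : W.Point → k) := by
  obtain ⟨P, hP⟩ := (eventually_ne (0 : W.Point)).exists
  exact (regVal_ηc hP).isRat

theorem isRat_const (c : k) : IsRat (fun _ : W.Point => c) :=
  (RegVal.const c 0).isRat

theorem IsRat.add {f g : W.Point → k} (hf : IsRat f) (hg : IsRat g) :
    IsRat (fun P => f P + g P) := by
  obtain ⟨P, h, h'⟩ := (hf.eventually_regVal.and hg.eventually_regVal).exists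
  exact (h.add h').isRat

theorem IsRat.mul {f g : W.Point → k} (hf : IsRat f) (hg : IsRat g) :
    IsRat (fun P => f P * g P) := by
  obtain ⟨P, h, h'⟩ := (hf.eventually_regVal.and hg.eventually_regVal).exists
  exact (h.mul h').isRat

theorem IsRat.const_mul {f : W.Point → k} (c : k) (hf : IsRat f) : IsRat (fun P => c * f P) :=
  (isRat_const c).mul hf

theorem IsRat.neg {f : W.Point → k} (hf : IsRat f) : IsRat (fun P => -f P) := by
  simpa using hf.const_mul (-1)

theorem IsRat.sub {f g : W.Point → k} (hf : IsRat f) (hg : IsRat g) :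
    IsRat (fun P => f P - g P) := by
  simpa [sub_eq_add_neg] using hf.add hg.neg

theorem IsRat.pow {f : W.Point → k} (hf : IsRat f) (n : ℕ) : IsRat (fun P => f P ^ n) := by
  obtain ⟨P, h⟩ := hf.eventually_regVal.exists
  exact (h.pow n).isRat

theorem IsRat.eval {f : W.Point → k} (hf : IsRat f) (a : k[X]) :
    IsRat (fun P => a.eval (f P)) := by
  obtain ⟨P, h⟩ := hf.eventually_regVal.exists
  exact (h.eval a).isRat

theorem IsRat.inv {f : W.Point → k} (hf : IsRat f) : IsRat (fun P => (f P)⁻¹) := by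
  by_cases h : ∃ P, RegVal f P (f P) ∧ f P ≠ 0
  · obtain ⟨P, h, h'⟩ := h
    exact (h.inv h').isRat
  · push Not at h
    refine (isRat_const 0).congr ?_
    filter_upwards [hf.eventually_regVal] with P hP
    rw [h P hP, inv_zero]

theorem IsRat.div {f g : W.Point → k} (hf : IsRat f) (hg : IsRat g) :
    IsRat (fun P => f P / g P) := by
  simpa only [div_eq_mul_inv] using hf.mul hg.inv

theorem IsRat.comp {W' : Affine k} [W'.IsElliptic] {φ : W.Point → W'.Point} {f : W'.Point → k}
    (hf : IsRat f) (hφ : IsRegularMap φ) (hfin : Tendsto φ cofinite cofinite) :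
    IsRat (fun P => f (φ P)) := by
  obtain ⟨P, h⟩ := (hfin.eventually hf.eventually_regVal).exists
  exact (h.comp (hφ P) hfin).isRat

theorem RegVal.comp_add {f : W.Point → k} {P : W.Point} {v : k} (R : W.Point)
    (hf : RegVal f (P + R) v) : RegVal (fun Q => f (Q + R)) P v :=
  hf.comp (φ := fun Q => Q + R) (regMapAt_add_right P R) (tendsto_add_right R)

end RationalFunctions

/-! ### Rational homomorphisms are regular -/

section RegularMaps

variable {k : Type u} [Field k] {W W' : Affine k}

theorem exists_linear_form {P Q : W.Point} (h : P ≠ Q) : ∃ l : MvPolynomial (Fin 3) k,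
    l.IsHomogeneous 1 ∧ MvPolynomial.eval (coords P) l ≠ 0 ∧
      MvPolynomial.eval (coords Q) l = 0 := by
  have hX : ∀ i, (MvPolynomial.X i : MvPolynomial (Fin 3) k).IsHomogeneous 1 :=
    fun i => MvPolynomial.isHomogeneous_X _ _
  by_cases hQ : Q = 0
  · refine ⟨MvPolynomial.X 2, hX 2, ?_, ?_⟩
    · rw [coords_of_ne_zero (hQ ▸ h)]
      simp
    · simp [hQ, coords_zero]
  by_cases hP : P = 0
  · refine ⟨MvPolynomial.X 1 - MvPolynomial.C (yc Q) * MvPolynomial.X 2,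
      (hX 1).sub ((hX 2).C_mul _), ?_, ?_⟩
    · simp [hP, coords_zero]
    · simp [coords_of_ne_zero hQ]
  by_cases hx : xc P = xc Q
  · refine ⟨MvPolynomial.X 1 - MvPolynomial.C (yc Q) * MvPolynomial.X 2,
      (hX 1).sub ((hX 2).C_mul _), ?_, ?_⟩
    · simp [coords_of_ne_zero hP, sub_eq_zero]
      exact fun hy => h (point_ext hP hQ hx hy)
    · simp [coords_of_ne_zero hQ]
  · refine ⟨MvPolynomial.X 0 - MvPolynomial.C (xc Q) * MvPolynomial.X 2,
      (hX 0).sub ((hX 2).C_mul _), ?_, ?_⟩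
    · simpa [coords_of_ne_zero hP, sub_eq_zero] using hx
    · simp [coords_of_ne_zero hQ]

theorem exists_form_vanishing {P : W.Point} (s : Finset W.Point) (h : P ∉ s) :
    ∃ (d : ℕ) (l : MvPolynomial (Fin 3) k), l.IsHomogeneous d ∧
      MvPolynomial.eval (coords P) l ≠ 0 ∧ ∀ Q ∈ s, MvPolynomial.eval (coords Q) l = 0 := by
  classical
  induction s using Finset.induction_on with
  | empty => exact ⟨0, 1, MvPolynomial.isHomogeneous_one _ _, by simp, by simp⟩
  | insert Q s hQ ih =>
    obtain ⟨d, l, hl, h1, h2⟩ := ih fun h' => h (Finset.mem_insert_of_mem h')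
    obtain ⟨m, hm, h3, h4⟩ := exists_linear_form (P := P) (Q := Q)
      fun h' => h (h' ▸ Finset.mem_insert_self _ _)
    refine ⟨d + 1, l * m, hl.mul hm, ?_, fun R hR => ?_⟩
    · rw [map_mul]
      exact mul_ne_zero h1 h3
    · rw [map_mul]
      rcases Finset.mem_insert.mp hR with rfl | hR
      · rw [h4, mul_zero]
      · rw [h2 R hR, zero_mul]

theorem regMapAt_of_regVal {φ : W.Point → W'.Point} {P : W.Point} (hP : φ P ≠ 0)
    (hfin : ∀ᶠ Q in cofinite, φ Q ≠ 0) (hx : RegVal (fun Q => xc (φ Q)) P (xc (φ P)))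
    (hy : RegVal (fun Q => yc (φ Q)) P (yc (φ P))) : RegMapAt φ P := by
  obtain ⟨d, G, H, hG, hH, h1, h2, h3⟩ := hx
  obtain ⟨d', G', H', hG', hH', h1', h2', h3'⟩ := hy
  have hev : ∀ᶠ Q in cofinite, φ Q ≠ 0 ∧
      xc (φ Q) * MvPolynomial.eval (coords Q) H = MvPolynomial.eval (coords Q) G ∧
      yc (φ Q) * MvPolynomial.eval (coords Q) H' = MvPolynomial.eval (coords Q) G' :=
    hfin.and (h3.and h3')
  have hbad : Set.Finite _ := hev
  -- The formulas for the coordinates of `φ` may fail at finitely many points. Multiplying the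
  -- triple by a form `l` that vanishes there, but not at `P`, removes these points from the locus
  -- where the triple must represent `φ`.
  obtain ⟨e, l, hl, hlP, hl0⟩ := exists_form_vanishing (P := P) hbad.toFinset (by
    simp only [Set.Finite.mem_toFinset, Set.mem_compl_iff, not_not]
    exact ⟨hP, h2.symm, h2'.symm⟩)
  have hgood : ∀ Q : W.Point, MvPolynomial.eval (coords Q) l ≠ 0 → φ Q ≠ 0 ∧
      xc (φ Q) * MvPolynomial.eval (coords Q) H = MvPolynomial.eval (coords Q) G ∧
      yc (φ Q) * MvPolynomial.eval (coords Q) H' = MvPolynomial.eval (coords Q) G' := by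
    intro Q hQ
    by_contra hcon
    exact hQ (hl0 Q (by
      simp only [Set.Finite.mem_toFinset]
      exact hcon))
  have key : ∀ Q : W.Point, MvPolynomial.eval (coords Q) l ≠ 0 →
      ∀ i, MvPolynomial.eval (coords Q) (![l * H * H' * (G * H'), l * H * H' * (H * G'),
        l * H * H' * (H * H')] i) = MvPolynomial.eval (coords Q) (l * H * H' * (H * H')) *
          coords (φ Q) i := by
    intro Q hQ i
    obtain ⟨hQ0, hQ1, hQ2⟩ := hgood Q hQ
    rw [coords_of_ne_zero hQ0]
    fin_cases i
    · simp [← hQ1]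
      ring
    · simp [← hQ2]
      ring
    · simp
  refine ⟨e + d + d' + (d + d'), ![l * H * H' * (G * H'), l * H * H' * (H * G'),
        l * H * H' * (H * H')], ?_, ⟨2, ?_⟩, ?_⟩
  · intro i
    fin_cases i
    · exact ((hl.mul hH).mul hH').mul (hG.mul hH')
    · exact ((hl.mul hH).mul hH').mul (hH.mul hG')
    · exact ((hl.mul hH).mul hH').mul (hH.mul hH')
  · simp [hlP, h1, h1']
  · rintro Q ⟨i, hi⟩
    have hlQ : MvPolynomial.eval (coords Q) l ≠ 0 := by
      intro h0
      apply hi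
      fin_cases i <;> simp [h0]
    refine ⟨_, ?_, key Q hlQ⟩
    intro h0
    apply hi
    rw [key Q hlQ, h0, zero_mul]

theorem isRegularMap_zero [DecidableEq k] : IsRegularMap (fun _ : W.Point => (0 : W'.Point)) := by
  intro P
  have hr : ∀ Q : W.Point, RepresentsAt (![0, 1, 0] : Fin 3 → MvPolynomial (Fin 3) k)
      (fun _ : W.Point => (0 : W'.Point)) Q := by
    intro Q
    refine ⟨1, one_ne_zero, fun i => ?_⟩
    rw [coords_zero]
    fin_cases i <;> simp
  refine ⟨0, ![0, 1, 0], fun i => ?_, ⟨1, by simp⟩, fun Q _ => hr Q⟩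
  fin_cases i
  · exact MvPolynomial.isHomogeneous_zero _ _ _
  · exact MvPolynomial.isHomogeneous_one _ _
  · exact MvPolynomial.isHomogeneous_zero _ _ _

theorem tendsto_of_eventually_ne_zero [DecidableEq k] {φ : W.Point →+ W'.Point}
    (h : ∀ᶠ P in cofinite, φ P ≠ 0) : Tendsto φ cofinite cofinite := by
  have hker : {P | φ P = 0}.Finite := by simpa using h
  refine Tendsto.cofinite_of_finite_preimage_singleton fun R => ?_
  by_cases hR : ∃ P₀, φ P₀ = R
  · obtain ⟨P₀, rfl⟩ := hR
    have : (φ ⁻¹' {φ P₀}) = (fun P => P - P₀) ⁻¹' {P | φ P = 0} := by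
      ext P
      simp [sub_eq_zero]
    rw [this]
    exact hker.preimage sub_left_injective.injOn
  · push Not at hR
    have : φ ⁻¹' {R} = ∅ := by
      ext P
      simpa using hR P
    rw [this]
    exact Set.finite_empty

variable [DecidableEq k] [NeZero (2 : k)] [IsAlgClosed k] [W.IsElliptic]

/-- A map of curves that is generically given by rational functions. -/
def RatMap (φ : W.Point → W'.Point) : Prop :=
  IsRat (fun P => xc (φ P)) ∧ IsRat (fun P => yc (φ P)) ∧ ∀ᶠ P in cofinite, φ P ≠ 0

theorem eventually_ne_zero_of_regular {φ : W.Point → W'.Point} (hφ : IsRegularMap φ)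
    (h : ∃ P, φ P ≠ 0) : ∀ᶠ P in cofinite, φ P ≠ 0 := by
  obtain ⟨P, hP⟩ := h
  obtain ⟨d, F, hF, hi, hr⟩ := hφ P
  obtain ⟨c, hc, h⟩ := hr P hi
  have h2 : MvPolynomial.eval (coords P) (F 2) ≠ 0 := by
    rw [h 2, coords_of_ne_zero hP]
    simpa using hc
  filter_upwards [eventually_form_ne_zero (hF 2) h2] with Q hQ hQ0
  obtain ⟨c', hc', h'⟩ := hr Q ⟨2, hQ⟩
  apply hQ
  rw [h' 2, hQ0, coords_zero]
  simp

theorem ratMap_of_regular [W'.IsElliptic] {φ : W.Point → W'.Point} (hφ : IsRegularMap φ)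
    (hfin : Tendsto φ cofinite cofinite) : RatMap φ :=
  ⟨isRat_xc.comp hφ hfin, isRat_yc.comp hφ hfin, hfin.eventually (eventually_ne 0)⟩

theorem RatMap.add {f g : W.Point → W'.Point} (hf : RatMap f) (hg : RatMap g)
    (h : ∀ᶠ P in cofinite, xc (f P) ≠ xc (g P)) : RatMap (fun P => f P + g P) := by
  obtain ⟨hfx, hfy, hf0⟩ := hf
  obtain ⟨hgx, hgy, hg0⟩ := hg
  have hs := (hfy.sub hgy).div (hfx.sub hgx)
  have hX : IsRat (fun P => xc (f P + g P)) := by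
    refine ((((hs.pow 2).add (hs.const_mul W'.a₁)).sub (isRat_const W'.a₂)).sub hfx).sub hgx
      |>.congr ?_
    filter_upwards [h, hf0, hg0] with P hP hP1 hP2
    exact (xc_add_ne hP1 hP2 hP).2.1.symm
  refine ⟨hX, ?_, ?_⟩
  · refine ((((hs.mul (hX.sub hfx)).add hfy).neg).sub (hX.const_mul W'.a₁)).sub
      (isRat_const W'.a₃) |>.congr ?_
    filter_upwards [h, hf0, hg0] with P hP hP1 hP2
    exact (xc_add_ne hP1 hP2 hP).2.2.symm
  · filter_upwards [h, hf0, hg0] with P hP hP1 hP2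
    exact (xc_add_ne hP1 hP2 hP).1

/-- A homomorphism that is generically given by rational functions is a regular map. -/
theorem isRegularMap_of_ratMap [W'.IsElliptic] {φ : W.Point →+ W'.Point} (hφ : RatMap φ) :
    IsRegularMap φ := by
  obtain ⟨hx, hy, h0⟩ := hφ
  obtain ⟨P₀, h1, h2, h3⟩ := (hx.eventually_regVal.and (hy.eventually_regVal.and h0)).exists
  have hreg : RegMapAt φ P₀ := regMapAt_of_regVal h3 h0 h1 h2
  intro P
  -- Regularity at the single point `P₀` moves to `P` by translations: `φ(Q) = φ(Q + (P₀ - P)) + φ(P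
  -- - P₀)`.
  have e1 : RegMapAt (fun Q : W.Point => φ (Q + (P₀ - P))) P :=
    RegMapAt.comp (φ := fun Q : W.Point => Q + (P₀ - P)) (ψ := φ)
      (by simpa using hreg) (regMapAt_add_right P _)
  have e2 := RegMapAt.comp (φ := fun Q : W.Point => φ (Q + (P₀ - P)))
    (ψ := fun Q : W'.Point => Q + φ (P - P₀)) (regMapAt_add_right _ _) e1
  have heq : (fun Q : W.Point => φ (Q + (P₀ - P)) + φ (P - P₀)) = φ := by
    funext Q
    rw [← map_add]
    congr 1
    abel
  rw [heq] at e2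
  exact e2

end RegularMaps

/-! ### Behaviour at infinity -/

section Infinity

variable {k : Type u} [Field k] {W : Affine k}

theorem eventually_xc_ne_zero : ∀ᶠ Q : W.Point in cofinite, xc Q ≠ 0 := by
  simpa using eventually_eval_xc_ne_zero (W := W) (Polynomial.X_ne_zero (R := k))

/-- Expand in powers of `1 / x`, which vanishes at infinity. Pole orders at infinity are measured
throughout by multiplying with powers of `1 / x`, each of which accounts for two orders. -/
theorem regVal_inv_pow_mul_eval (a : k[X]) {n : ℕ} (h : a.natDegree ≤ n) :
    RegVal (fun Q : W.Point => (xc Q)⁻¹ ^ n * a.eval (xc Q)) 0 (a.coeff n) := by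
  have h1 : RegVal (fun Q : W.Point => ∑ i ∈ Finset.range (n + 1),
      a.coeff i * (xc Q)⁻¹ ^ (n - i)) 0 (∑ i ∈ Finset.range (n + 1), a.coeff i * 0 ^ (n - i)) :=
    RegVal.sum _ fun i _ => (regVal_inv_xc_zero.pow (n - i)).const_mul _
  rw [Finset.sum_eq_single n] at h1
  · simp only [Nat.sub_self, pow_zero, mul_one] at h1
    refine h1.congr ?_
    filter_upwards [eventually_xc_ne_zero] with Q hQ
    rw [eval_eq_sum_range' (Nat.lt_succ_of_le h), Finset.mul_sum]
    refine Finset.sum_congr rfl fun i hi => ?_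
    have hi' : i ≤ n := Nat.lt_succ_iff.mp (Finset.mem_range.mp hi)
    have : (xc Q)⁻¹ ^ n = (xc Q)⁻¹ ^ (n - i) * (xc Q)⁻¹ ^ i := by
      rw [← pow_add, Nat.sub_add_cancel hi']
    rw [this, inv_pow _ i]
    field_simp
  · intro i hi hin
    have : n - i ≠ 0 := by
      have := Finset.mem_range.mp hi
      omega
    rw [zero_pow this, mul_zero]
  · simp

/-- The function `y / x²` vanishes at infinity. -/
theorem regVal_inv_sq_mul_ηc : RegVal (fun Q : W.Point => (xc Q)⁻¹ ^ 2 * ηc Q) 0 0 := by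
  have h1 : RegVal (fun Q : W.Point => (xc Q)⁻¹ ^ 2 * yc Q) 0 0 := by
    -- `y / x² = YZ / X²`, rewritten as `XY / (X³ / Z)`.
    refine ⟨2, MvPolynomial.X 0 * MvPolynomial.X 1, cubeForm W, isHomogeneous_X_mul_X 0 1,
      isHomogeneous_cubeForm W, ?_, ?_, ?_⟩
    · simp [coords_zero, cubeForm]
    · simp [coords_zero]
    · filter_upwards [eventually_ne 0, eventually_xc_ne_zero] with Q hQ hx
      have e := equation_of_ne_zero hQ
      have : MvPolynomial.eval (coords Q) (cubeForm W) = xc Q ^ 3 := by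
        simp [coords_of_ne_zero hQ, cubeForm]
        linear_combination e
      rw [this]
      simp only [coords_of_ne_zero hQ, map_mul, MvPolynomial.eval_X]
      simp
      field_simp
  have h2 := (h1.const_mul 2).add (((regVal_inv_xc_zero (W := W)).const_mul W.a₁).add
    ((regVal_inv_xc_zero.pow 2).const_mul W.a₃))
  simp only [mul_zero, add_zero, ne_eq, OfNat.ofNat_ne_zero, not_false_eq_true, zero_pow] at h2
  refine h2.congr ?_
  filter_upwards [eventually_ne 0, eventually_xc_ne_zero] with Q hQ hx
  rw [ηc_eq hQ]
  field_simp
  ring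

variable [DecidableEq k] [NeZero (2 : k)] [IsAlgClosed k] [W.IsElliptic]

theorem regVal_zero_of_degree_le {f : W.Point → k} {a c : k[X]} (hc : c ≠ 0)
    (h : ∀ᶠ P : W.Point in cofinite, c.eval (xc P) * f P = a.eval (xc P))
    (hdeg : a.natDegree ≤ c.natDegree) :
    RegVal f 0 (a.coeff c.natDegree / c.leadingCoeff) := by
  refine ((regVal_inv_pow_mul_eval a hdeg).div (regVal_inv_pow_mul_eval c le_rfl)
    (leadingCoeff_ne_zero.mpr hc)).congr ?_
  filter_upwards [h, eventually_xc_ne_zero, eventually_eval_xc_ne_zero hc] with P hP hx hcP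
  rw [mul_div_mul_left _ _ (pow_ne_zero _ (inv_ne_zero hx)), ← hP, mul_div_cancel_left₀ _ hcP]

/-- If the numerator had larger degree `n`, then `x⁻ⁿ c(x) f` would take the value zero at infinity,
while it equals `x⁻ⁿ a(x)`, with value the leading coefficient of `a`. -/
theorem RegVal.natDegree_le {f : W.Point → k} {a c : k[X]}
    (h : ∀ᶠ P : W.Point in cofinite, c.eval (xc P) * f P = a.eval (xc P)) {v : k}
    (hf : RegVal f 0 v) : a.natDegree ≤ c.natDegree := by
  by_contra! hlt
  have h1 := (regVal_inv_pow_mul_eval (W := W) c hlt.le).mul hf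
  have h2 := regVal_inv_pow_mul_eval (W := W) a le_rfl
  rw [coeff_eq_zero_of_natDegree_lt hlt, zero_mul] at h1
  have h3 := h1.unique (h2.congr (by
    filter_upwards [h] with P hP
    rw [mul_assoc, hP]))
  have : a = 0 := leadingCoeff_eq_zero.mp h3.symm
  simp [this] at hlt

theorem RegVal.degree_lt {f : W.Point → k} {a c : k[X]} (hc : c ≠ 0)
    (h : ∀ᶠ P : W.Point in cofinite, c.eval (xc P) * f P = a.eval (xc P))
    (hf : RegVal f 0 0) : a.degree < c.degree := by
  have hle := hf.natDegree_le h
  have h0 := (regVal_zero_of_degree_le hc h hle).unique hf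
  rw [div_eq_zero_iff, or_iff_left (leadingCoeff_ne_zero.mpr hc)] at h0
  rw [degree_eq_natDegree hc]
  refine lt_of_le_of_ne (natDegree_le_iff_degree_le.mp hle) fun h1 => ?_
  rw [← natDegree_eq_of_degree_eq_some h1] at h0
  rw [leadingCoeff_eq_zero.mp h0] at h1
  simp at h1

theorem RegVal.eval_denom_ne_zero {f : W.Point → k} {a c : k[X]} (hac : IsCoprime a c)
    (h : ∀ᶠ P : W.Point in cofinite, c.eval (xc P) * f P = a.eval (xc P)) {P : W.Point}
    (hP : P ≠ 0) {v : k} (hf : RegVal f P v) : c.eval (xc P) ≠ 0 := by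
  intro h0
  have h1 := ((regVal_xc hP).eval c).mul hf
  rw [h0, zero_mul] at h1
  have h2 := ((regVal_xc hP).eval a).unique (h1.congr h)
  obtain ⟨s, t, hst⟩ := hac
  have := congrArg (Polynomial.eval (xc P)) hst
  simp [h0, h2] at this

/-- An even rational function that is regular everywhere is constant. -/
theorem IsRat.eq_const_of_regVal {f : W.Point → k} (hf : IsRat f)
    (he : ∀ᶠ P in cofinite, f (-P) = f P) (hr : ∀ P, ∃ v, RegVal f P v) :
    ∃ v, ∀ᶠ P in cofinite, f P = v := by
  -- With `f = a(x) / c(x)` in lowest terms, a root of `c` would give a pole; so `c` is constant,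
  -- and regularity at infinity makes `a` constant too.
  obtain ⟨a, c, hc, hac, h⟩ := hf.exists_even he
  have hcdeg : c.degree = 0 := by
    by_contra hd
    obtain ⟨x, hx⟩ := IsAlgClosed.exists_root c hd
    obtain ⟨P, hP, rfl⟩ := exists_point_of_xc (W := W) x
    obtain ⟨v, hv⟩ := hr P
    exact hv.eval_denom_ne_zero hac h hP hx
  obtain ⟨v, hv⟩ := hr 0
  have ha := hv.natDegree_le h
  replace ha : a.natDegree = 0 := by
    have : c.natDegree = 0 := natDegree_eq_of_degree_eq_some hcdeg
    omega
  rw [eq_C_of_degree_eq_zero hcdeg, eq_C_of_natDegree_eq_zero ha] at h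
  have hc0 : c.coeff 0 ≠ 0 := fun h0 => hc (by rw [eq_C_of_degree_eq_zero hcdeg, h0, map_zero])
  refine ⟨a.coeff 0 / c.coeff 0, ?_⟩
  filter_upwards [h] with P hP
  rw [eval_C, eval_C] at hP
  rw [← hP, mul_div_cancel_left₀ _ hc0]

/-- An even function that vanishes at infinity does so to order at least two: it is a fraction in
`x` of negative degree, which absorbs one factor `x`. -/
theorem IsRat.regVal_xc_mul {f : W.Point → k} (hf : IsRat f)
    (he : ∀ᶠ P in cofinite, f (-P) = f P) (h0 : RegVal f 0 0) :
    ∃ v, RegVal (fun P => xc P * f P) 0 v := by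
  obtain ⟨a, c, hc, hac, h⟩ := hf.exists_even he
  have hlt := h0.degree_lt hc h
  have h' : ∀ᶠ P : W.Point in cofinite,
      c.eval (xc P) * (xc P * f P) = (Polynomial.X * a).eval (xc P) := by
    filter_upwards [h] with P hP
    rw [eval_mul, eval_X, ← hP]
    ring
  refine ⟨_, regVal_zero_of_degree_le hc h' ?_⟩
  by_cases ha : a = 0
  · simp [ha]
  · rw [natDegree_X_mul ha]
    exact natDegree_lt_natDegree ha hlt

theorem IsRat.regVal_of_sq {f : W.Point → k} (hf : IsRat f)
    (he : ∀ᶠ P in cofinite, f (-P) = f P) {v : k} (h0 : RegVal (fun P => f P ^ 2) 0 v) :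
    ∃ v, RegVal f 0 v := by
  obtain ⟨a, c, hc, hac, h⟩ := hf.exists_even he
  have h' : ∀ᶠ P : W.Point in cofinite,
      (c ^ 2).eval (xc P) * f P ^ 2 = (a ^ 2).eval (xc P) := by
    filter_upwards [h] with P hP
    rw [eval_pow, eval_pow, ← hP]
    ring
  have := h0.natDegree_le h'
  rw [natDegree_pow, natDegree_pow] at this
  exact ⟨_, regVal_zero_of_degree_le hc h (by omega)⟩

theorem IsRat.exists_pole_bound {f : W.Point → k} (hf : IsRat f)
    (he : ∀ᶠ P in cofinite, f (-P) = f P) :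
    ∃ n v, RegVal (fun P => (xc P)⁻¹ ^ n * f P) 0 v := by
  obtain ⟨a, c, hc, hac, h⟩ := hf.exists_even he
  have h' : ∀ᶠ P : W.Point in cofinite,
      (c * Polynomial.X ^ a.natDegree).eval (xc P) * ((xc P)⁻¹ ^ a.natDegree * f P) =
        a.eval (xc P) := by
    filter_upwards [h, eventually_xc_ne_zero] with P hP hx
    rw [eval_mul, eval_pow, eval_X, ← hP, inv_pow]
    field_simp
  refine ⟨a.natDegree, _, regVal_zero_of_degree_le (mul_ne_zero hc (pow_ne_zero _ X_ne_zero)) h' ?_⟩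
  rw [natDegree_mul hc (pow_ne_zero _ X_ne_zero), natDegree_X_pow]
  omega

theorem RegVal.eq_zero_of_odd {f : W.Point → k} {v : k} (hf : RegVal f 0 v)
    (ho : ∀ᶠ P in cofinite, f (-P) = -f P) : v = 0 := by
  have h1 : RegVal (fun P => f (-P)) 0 v := RegVal.comp_neg (by rwa [neg_zero])
  have h2 := (h1.congr ho).unique hf.neg
  have : (2 : k) * v = 0 := by linear_combination h2
  exact (mul_eq_zero.mp this).resolve_left two_ne_zero

/-- Let `m` be odd and regular at infinity; then `y m / x` is regular at infinity. -/
theorem IsRat.regVal_ηc_mul_odd {m : W.Point → k} {v : k} (hm : RegVal m 0 v)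
    (ho : ∀ᶠ P in cofinite, m (-P) = -m P) :
    ∃ w, RegVal (fun P => (xc P)⁻¹ * (ηc P * m P)) 0 w := by
  have hv := hm.eq_zero_of_odd ho
  subst hv
  have h1 : RegVal (fun P => m P ^ 2) 0 0 := by simpa using hm.pow 2
  -- The square of `ηm / x` is `(Ψ₂Sq(x) / x³) · (x m²)`. Here `m²` is even and vanishes at
  -- infinity, so both factors are regular there; an even function with regular square is regular.
  obtain ⟨w, hw⟩ := h1.isRat.regVal_xc_mul (by
    filter_upwards [ho] with P hP
    rw [hP]
    ring) h1
  have h2 := (regVal_inv_pow_mul_eval W.Ψ₂Sq natDegree_twoTorsion.le).mul hw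
  have h3 : RegVal (fun P => ((xc P)⁻¹ * (ηc P * m P)) ^ 2) 0 (W.Ψ₂Sq.coeff 3 * w) := by
    refine h2.congr ?_
    filter_upwards [eventually_ne 0, eventually_xc_ne_zero] with P hP hx
    rw [← ηc_sq hP]
    field_simp
  refine IsRat.regVal_of_sq ?_ ?_ h3
  · exact isRat_xc.inv.mul (isRat_ηc.mul hm.isRat)
  · filter_upwards [ho] with P hP
    rw [hP, xc_neg, ηc_neg]
    ring

/-- Subtracting a polynomial in a function with the same principal part as `x` removes the pole at
infinity of an even function. -/
theorem IsRat.exists_sub_eval_regVal {X : W.Point → k} (hX : ∃ w, RegVal (fun P => X P - xc P) 0 w)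
    (heX : ∀ᶠ P in cofinite, X (-P) = X P) (n : ℕ) {f : W.Point → k} (hf : IsRat f)
    (he : ∀ᶠ P in cofinite, f (-P) = f P)
    (hn : ∃ v, RegVal (fun P => (xc P)⁻¹ ^ n * f P) 0 v) :
    ∃ g : k[X], g.natDegree ≤ n ∧ ∃ v, RegVal (fun P => f P - g.eval (X P)) 0 v := by
  obtain ⟨w, hw⟩ := hX
  have hXr : IsRat X := (hw.isRat.add isRat_xc).congr (by simp)
  have hX1 : RegVal (fun P => (xc P)⁻¹ * X P) 0 1 := by
    have := (regVal_inv_xc_zero.mul hw).add (RegVal.const 1 0)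
    rw [zero_mul, zero_add] at this
    refine this.congr ?_
    filter_upwards [eventually_xc_ne_zero] with P hP
    field_simp
    ring
  induction n generalizing f with
  | zero =>
    obtain ⟨v, hv⟩ := hn
    exact ⟨0, by simp, v, by simpa using hv⟩
  | succ n ih =>
    obtain ⟨v, hv⟩ := hn
    -- Removing the leading term leaves an even function with value zero, so a whole factor `x` of
    -- the pole is gained and the induction goes from `n + 1` to `n`.
    have h1 : RegVal (fun P => (xc P)⁻¹ ^ (n + 1) * (f P - v * X P ^ (n + 1))) 0 0 := by
      have := hv.sub ((hX1.pow (n + 1)).const_mul v)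
      rw [one_pow, mul_one, sub_self] at this
      refine this.congr (Eventually.of_forall fun P => ?_)
      simp only
      ring
    have hf' : IsRat (fun P => f P - v * X P ^ (n + 1)) := hf.sub ((hXr.pow _).const_mul v)
    have he' : ∀ᶠ P in cofinite, f (-P) - v * X (-P) ^ (n + 1) = f P - v * X P ^ (n + 1) := by
      filter_upwards [he, heX] with P h h'
      rw [h, h']
    obtain ⟨w', hw'⟩ := h1.isRat.regVal_xc_mul (by
      filter_upwards [he'] with P h
      rw [xc_neg, h]) h1
    obtain ⟨g, hg, v', hv'⟩ := ih hf' he' ⟨w', hw'.congr (by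
      filter_upwards [eventually_xc_ne_zero] with P hP
      rw [pow_succ]
      field_simp)⟩
    refine ⟨g + Polynomial.C v * Polynomial.X ^ (n + 1), ?_, v', ?_⟩
    · refine (natDegree_add_le _ _).trans (max_le (hg.trans n.le_succ) ?_)
      exact natDegree_C_mul_X_pow_le _ _
    · refine hv'.congr (Eventually.of_forall fun P => ?_)
      simp only [eval_add, eval_mul, eval_C, eval_pow, eval_X]
      ring

end Infinity

/-! ### Functions invariant under translation by a finite subgroup -/

section Invariants

variable {k : Type u} [Field k] [DecidableEq k] {W : Affine k} (C : AddSubgroup W.Point)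

/-- A rational function that is invariant under translation by `C` and regular outside `C`. -/
structure InvFun (f : W.Point → k) : Prop where
  inv : ∀ Q ∈ C, ∀ᶠ P in cofinite, f (P + Q) = f P
  reg : ∀ P ∉ C, ∃ v, RegVal f P v

variable {C}

theorem InvFun.const (c : k) : InvFun C (fun _ => c) where
  inv _ _ := Eventually.of_forall fun _ => rfl
  reg P _ := ⟨c, RegVal.const c P⟩

theorem InvFun.add {f g : W.Point → k} (hf : InvFun C f) (hg : InvFun C g) :
    InvFun C (fun P => f P + g P) where
  inv Q hQ := by
    filter_upwards [hf.inv Q hQ, hg.inv Q hQ] with P h h'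
    rw [h, h']
  reg P hP := by
    obtain ⟨v, hv⟩ := hf.reg P hP
    obtain ⟨w, hw⟩ := hg.reg P hP
    exact ⟨_, hv.add hw⟩

theorem InvFun.mul {f g : W.Point → k} (hf : InvFun C f) (hg : InvFun C g) :
    InvFun C (fun P => f P * g P) where
  inv Q hQ := by
    filter_upwards [hf.inv Q hQ, hg.inv Q hQ] with P h h'
    rw [h, h']
  reg P hP := by
    obtain ⟨v, hv⟩ := hf.reg P hP
    obtain ⟨w, hw⟩ := hg.reg P hP
    exact ⟨_, hv.mul hw⟩

theorem InvFun.const_mul {f : W.Point → k} (c : k) (hf : InvFun C f) :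
    InvFun C (fun P => c * f P) :=
  (InvFun.const c).mul hf

theorem InvFun.sub {f g : W.Point → k} (hf : InvFun C f) (hg : InvFun C g) :
    InvFun C (fun P => f P - g P) := by
  simpa [sub_eq_add_neg] using hf.add (hg.const_mul (-1))

theorem InvFun.eval {f : W.Point → k} (hf : InvFun C f) (a : k[X]) :
    InvFun C (fun P => a.eval (f P)) where
  inv Q hQ := by
    filter_upwards [hf.inv Q hQ] with P h
    rw [h]
  reg P hP := by
    obtain ⟨v, hv⟩ := hf.reg P hP
    exact ⟨_, hv.eval a⟩

theorem InvFun.comp_neg {f : W.Point → k} (hf : InvFun C f) : InvFun C (fun P => f (-P)) where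
  inv Q hQ := by
    filter_upwards [tendsto_neg.eventually (hf.inv (-Q) (C.neg_mem hQ))] with P h
    rw [neg_add, h]
  reg P hP := (hf.reg (-P) fun h => hP (by simpa using C.neg_mem h)).imp fun _ hv => hv.comp_neg

section Sums

variable [Fintype C] (f : W.Point → k)

/-- The sum of the translates of a function by the elements of `C`. -/
def traceFun (P : W.Point) : k := ∑ Q : C, f (P + Q)

/-- The product of the translates of a function by the elements of `C`. -/
def normFun (P : W.Point) : k := ∏ Q : C, f (P + Q)

theorem traceFun_add {Q : W.Point} (hQ : Q ∈ C) (P : W.Point) :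
    traceFun (C := C) f (P + Q) = traceFun (C := C) f P := by
  refine Fintype.sum_equiv (Equiv.addLeft (⟨Q, hQ⟩ : C)) _ _ fun R => ?_
  simp [add_assoc]

theorem normFun_add {Q : W.Point} (hQ : Q ∈ C) (P : W.Point) :
    normFun (C := C) f (P + Q) = normFun (C := C) f P := by
  refine Fintype.prod_equiv (Equiv.addLeft (⟨Q, hQ⟩ : C)) _ _ fun R => ?_
  simp [add_assoc]

theorem traceFun_neg (P : W.Point) :
    traceFun (C := C) f (-P) = traceFun (C := C) (fun P => f (-P)) P := by
  refine Fintype.sum_equiv (Equiv.neg C) _ _ fun R => ?_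
  simp [add_comm]

theorem normFun_neg (P : W.Point) :
    normFun (C := C) f (-P) = normFun (C := C) (fun P => f (-P)) P := by
  refine Fintype.prod_equiv (Equiv.neg C) _ _ fun R => ?_
  simp [add_comm]

theorem eventually_normFun_ne_zero {f : W.Point → k} (hf : ∀ᶠ P in cofinite, f P ≠ 0) :
    ∀ᶠ P in cofinite, normFun (C := C) f P ≠ 0 := by
  have : ∀ᶠ P in cofinite, ∀ Q : C, f (P + Q) ≠ 0 :=
    eventually_all.mpr fun Q => (tendsto_add_right (Q : W.Point)).eventually hf
  filter_upwards [this] with P hP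
  exact Finset.prod_ne_zero_iff.mpr fun Q _ => hP Q

variable [NeZero (2 : k)] [IsAlgClosed k] [W.IsElliptic] {f}

theorem regVal_traceFun (hf : ∀ P, P ≠ 0 → RegVal f P (f P)) {P : W.Point} (hP : P ∉ C) :
    RegVal (traceFun (C := C) f) P (traceFun (C := C) f P) := by
  refine RegVal.sum _ fun Q _ => RegVal.comp_add _ (hf _ fun h => hP ?_)
  rw [eq_neg_of_add_eq_zero_left h]
  exact C.neg_mem Q.2

theorem regVal_normFun (hf : ∀ P, P ≠ 0 → RegVal f P (f P)) {P : W.Point} (hP : P ∉ C) :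
    RegVal (normFun (C := C) f) P (normFun (C := C) f P) := by
  refine RegVal.prod _ fun Q _ => RegVal.comp_add _ (hf _ fun h => hP ?_)
  rw [eq_neg_of_add_eq_zero_left h]
  exact C.neg_mem Q.2

theorem invFun_traceFun (hf : ∀ P, P ≠ 0 → RegVal f P (f P)) : InvFun C (traceFun (C := C) f) where
  inv _ hQ := Eventually.of_forall (traceFun_add f hQ)
  reg _ hP := ⟨_, regVal_traceFun hf hP⟩

theorem invFun_normFun (hf : ∀ P, P ≠ 0 → RegVal f P (f P)) : InvFun C (normFun (C := C) f) where
  inv _ hQ := Eventually.of_forall (normFun_add f hQ)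
  reg _ hP := ⟨_, regVal_normFun hf hP⟩

/-- The summand for `Q = 0` is `f` itself, and all other translates are regular at infinity. So the
trace has the same principal part there as `f`. -/
theorem regVal_traceFun_sub (hf : ∀ P, P ≠ 0 → RegVal f P (f P)) :
    ∃ w, RegVal (fun P => traceFun (C := C) f P - f P) 0 w := by
  classical
  have h : RegVal (fun P : W.Point => ∑ Q ∈ (Finset.univ.erase (0 : C)), f (P + Q)) 0
      (∑ Q ∈ (Finset.univ.erase (0 : C)), f Q) := by
    refine RegVal.sum _ fun Q hQ => RegVal.comp_add _ ?_
    rw [zero_add]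
    exact hf _ fun h => Finset.ne_of_mem_erase hQ (Subtype.ext h)
  refine ⟨_, h.congr (Eventually.of_forall fun P => ?_)⟩
  simp only [traceFun]
  rw [← Finset.add_sum_erase _ _ (Finset.mem_univ (0 : C))]
  simp

/-- `m` is the product of the translates by nonzero `Q`, which have no pole at infinity; hence the
norm has there no worse pole than `f`. -/
theorem exists_normFun_eq_mul (hf : ∀ P, P ≠ 0 → RegVal f P (f P)) :
    ∃ m : W.Point → k, (∃ w, RegVal m 0 w) ∧ (∀ P ∉ C, ∃ w, RegVal m P w) ∧
      ∀ P, normFun (C := C) f P = f P * m P := by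
  classical
  refine ⟨fun P => ∏ Q ∈ (Finset.univ.erase (0 : C)), f (P + Q),
    ⟨∏ Q ∈ (Finset.univ.erase (0 : C)), f Q, RegVal.prod _ fun Q hQ => RegVal.comp_add _ ?_⟩,
    fun P hP => ⟨∏ Q ∈ (Finset.univ.erase (0 : C)), f (P + Q),
      RegVal.prod _ fun Q hQ => RegVal.comp_add _ (hf _ fun h => hP ?_)⟩, fun P => ?_⟩
  · rw [zero_add]
    exact hf _ fun h => Finset.ne_of_mem_erase hQ (Subtype.ext h)
  · rw [eq_neg_of_add_eq_zero_left h]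
    exact C.neg_mem Q.2
  · simp only [normFun]
    rw [← Finset.mul_prod_erase _ _ (Finset.mem_univ (0 : C))]
    simp

end Sums

variable [NeZero (2 : k)] [IsAlgClosed k] [W.IsElliptic] [Finite C]

theorem InvFun.isRat {f : W.Point → k} (hf : InvFun C f) : IsRat f := by
  obtain ⟨P, hP⟩ := (Set.toFinite (C : Set W.Point)).eventually_cofinite_notMem.exists
  obtain ⟨v, hv⟩ := hf.reg P hP
  exact hv.isRat

/-- Subtracting a polynomial in `X` removes the pole at infinity; by invariance the difference is
then regular on all of `C`, so everywhere, and an even function regular everywhere is constant. Here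
`n` bounds half the pole order. -/
theorem InvFun.exists_eval_of_pole_le {X f : W.Point → k} (hXi : InvFun C X)
    (hX : ∃ w, RegVal (fun P => X P - xc P) 0 w) (heX : ∀ᶠ P in cofinite, X (-P) = X P)
    (hf : InvFun C f) (he : ∀ᶠ P in cofinite, f (-P) = f P) {n : ℕ}
    (hn : ∃ v, RegVal (fun P => (xc P)⁻¹ ^ n * f P) 0 v) :
    ∃ g : k[X], g.natDegree ≤ n ∧ ∀ᶠ P in cofinite, f P = g.eval (X P) := by
  obtain ⟨g, hg, v, hv⟩ := hf.isRat.exists_sub_eval_regVal hX heX n he hn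
  have hd : InvFun C (fun P => f P - g.eval (X P)) := hf.sub (hXi.eval g)
  obtain ⟨c, hc⟩ := hd.isRat.eq_const_of_regVal (by
      filter_upwards [he, heX] with P h h'
      rw [h, h']) (fun P => by
    by_cases hP : P ∈ C
    · have := RegVal.comp_add (f := fun P => f P - g.eval (X P)) (P := P) (v := v) (-P)
        (by rwa [add_neg_cancel])
      exact ⟨v, this.congr (hd.inv (-P) (C.neg_mem hP))⟩
    · exact hd.reg P hP)
  refine ⟨g + Polynomial.C c, ?_, ?_⟩
  · rw [natDegree_add_C]
    exact hg
  · filter_upwards [hc] with P hP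
    rw [eval_add, eval_C, ← hP]
    ring

theorem InvFun.exists_eval {X f : W.Point → k} (hXi : InvFun C X)
    (hX : ∃ w, RegVal (fun P => X P - xc P) 0 w) (heX : ∀ᶠ P in cofinite, X (-P) = X P)
    (hf : InvFun C f) (he : ∀ᶠ P in cofinite, f (-P) = f P) :
    ∃ g : k[X], ∀ᶠ P in cofinite, f P = g.eval (X P) := by
  obtain ⟨n, hn⟩ := hf.isRat.exists_pole_bound he
  obtain ⟨g, -, hg⟩ := hXi.exists_eval_of_pole_le hX heX hf he hn
  exact ⟨g, hg⟩

end Invariants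

/-! ### The coordinate functions of the quotient by `C` -/

section Quotient

variable {k : Type u} [Field k] {W : Affine k}

theorem sum_eq_of_cubic_roots {A B D x y z : k} (hxy : x ≠ y) (hxz : x ≠ z) (hyz : y ≠ z)
    (hx : x ^ 3 + A * x ^ 2 + B * x + D = 0) (hy : y ^ 3 + A * y ^ 2 + B * y + D = 0)
    (hz : z ^ 3 + A * z ^ 2 + B * z + D = 0) : z = -A - x - y := by
  have h1 : x ^ 2 + x * y + y ^ 2 + A * (x + y) + B = 0 :=
    mul_left_cancel₀ (sub_ne_zero.mpr hxy) (by linear_combination hx - hy)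
  have h2 : x ^ 2 + x * z + z ^ 2 + A * (x + z) + B = 0 :=
    mul_left_cancel₀ (sub_ne_zero.mpr hxz) (by linear_combination hx - hz)
  have h3 : x + y + z + A = 0 :=
    mul_left_cancel₀ (sub_ne_zero.mpr hyz) (by linear_combination h1 - h2)
  linear_combination h3

theorem eq_of_xc_eq_of_ηc_eq [NeZero (2 : k)] {P Q : W.Point} (hP : P ≠ 0) (hQ : Q ≠ 0)
    (hx : xc P = xc Q) (hη : ηc P = ηc Q) : P = Q :=
  point_ext hP hQ hx (by rw [yc_eq hP, yc_eq hQ, hx, hη])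

variable [DecidableEq k]

theorem eq_of_three_roots {G : k[X]} (hG : G.natDegree ≤ 3) {x y z : k} (hxy : x ≠ y)
    (hxz : x ≠ z) (hyz : y ≠ z) (hx : G.eval x = 0) (hy : G.eval y = 0) (hz : G.eval z = 0)
    (t : k) : G.eval t = G.coeff 3 * ((t - x) * (t - y) * (t - z)) := by
  set p : k[X] := (Polynomial.X - Polynomial.C x) * (Polynomial.X - Polynomial.C y) *
    (Polynomial.X - Polynomial.C z) with hp
  have hpm : p.Monic := ((monic_X_sub_C x).mul (monic_X_sub_C y)).mul (monic_X_sub_C z)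
  have hpd : p.natDegree = 3 := by
    rw [hp, ((monic_X_sub_C x).mul (monic_X_sub_C y)).natDegree_mul (monic_X_sub_C z),
      (monic_X_sub_C x).natDegree_mul (monic_X_sub_C y)]
    simp
  have hp3 : p.coeff 3 = 1 := by
    rw [← hpd]
    exact hpm
  have h0 : G - Polynomial.C (G.coeff 3) * p = 0 := by
    by_contra hne
    have hle : (G - Polynomial.C (G.coeff 3) * p).natDegree ≤ 3 :=
      (natDegree_sub_le _ _).trans (max_le hG ((natDegree_C_mul_le _ _).trans hpd.le))
    have hlt : (G - Polynomial.C (G.coeff 3) * p).natDegree < 3 := by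
      refine lt_of_le_of_ne hle fun h => hne ?_
      rw [← leadingCoeff_eq_zero, leadingCoeff, h]
      simp [hp3]
    refine hne (eq_zero_of_natDegree_lt_card_of_eval_eq_zero' _ ({x, y, z} : Finset k) ?_ ?_)
    · intro i hi
      simp only [Finset.mem_insert, Finset.mem_singleton] at hi
      rcases hi with rfl | rfl | rfl <;> simp [hp, hx, hy, hz]
    · rwa [Finset.card_eq_three.mpr ⟨x, y, z, hxy, hxz, hyz, rfl⟩]
  have := congrArg (Polynomial.eval t) h0
  simp only [eval_sub, eval_mul, eval_C, eval_zero, hp, eval_X] at this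
  linear_combination this

/-- The points of order two lie over the roots of `Ψ₂Sq`, which are distinct because its
discriminant is `16Δ`. -/
theorem exists_two_torsion [NeZero (2 : k)] [IsAlgClosed k] [W.IsElliptic] :
    ∃ T₁ T₂ T₃ : W.Point, T₁ ≠ T₂ ∧ T₁ ≠ T₃ ∧ T₂ ≠ T₃ ∧
      (T₁ ≠ 0 ∧ -T₁ = T₁) ∧ (T₂ ≠ 0 ∧ -T₂ = T₂) ∧ (T₃ ≠ 0 ∧ -T₃ = T₃) := by
  have hpt : ∀ x : k, W.Ψ₂Sq.eval x = 0 → ∃ T : W.Point, T ≠ 0 ∧ xc T = x ∧ -T = T := by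
    intro x hx
    obtain ⟨T, hT, hTx, hTη⟩ := exists_point_of_ηc (W := W) (x := x) (η := 0) (by simp [hx])
    exact ⟨T, hT, hTx, eq_of_xc_eq_of_ηc_eq (neg_ne_zero.mpr hT) hT (xc_neg T)
      (by rw [ηc_neg, hTη, neg_zero])⟩
  have ha : W.twoTorsionPolynomial.a ≠ 0 := four_ne_zero_of_two
  have hs := IsAlgClosed.splits (W.twoTorsionPolynomial.toPoly.map (RingHom.id k))
  obtain ⟨x, y, z, h3⟩ := (Cubic.splits_iff_roots_eq_three (φ := RingHom.id k) ha).mp hs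
  have hd : W.twoTorsionPolynomial.discr ≠ 0 := by
    rw [WeierstrassCurve.twoTorsionPolynomial_discr]
    have h16 : (16 : k) = 4 * 4 := by norm_num
    rw [h16]
    exact mul_ne_zero (mul_ne_zero four_ne_zero_of_two four_ne_zero_of_two) W.isUnit_Δ.ne_zero
  obtain ⟨hxy, hxz, hyz⟩ := (Cubic.discr_ne_zero_iff_roots_ne ha h3).mp hd
  have hroot : ∀ t ∈ ({x, y, z} : Multiset k), W.Ψ₂Sq.eval t = 0 := by
    intro t ht
    rw [← h3] at ht
    have : t ∈ W.Ψ₂Sq.roots := by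
      simpa [Cubic.map, WeierstrassCurve.Ψ₂Sq_eq, Cubic.roots] using ht
    exact (mem_roots'.mp this).2
  obtain ⟨T₁, h1, h1x, h1n⟩ := hpt x (hroot x (by simp))
  obtain ⟨T₂, h2, h2x, h2n⟩ := hpt y (hroot y (by simp))
  obtain ⟨T₃, h3', h3x, h3n⟩ := hpt z (hroot z (by simp))
  refine ⟨T₁, T₂, T₃, ?_, ?_, ?_, ⟨h1, h1n⟩, ⟨h2, h2n⟩, ⟨h3', h3n⟩⟩
  · rintro rfl
    exact hxy (h1x.symm.trans h2x)
  · rintro rfl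
    exact hxz (h1x.symm.trans h3x)
  · rintro rfl
    exact hyz (h2x.symm.trans h3x)

variable (C : AddSubgroup W.Point) [Fintype C]

/-- The `x`-coordinate of the quotient by `C`. -/
def quotX (P : W.Point) : k := traceFun (C := C) xc P

/-- Twice the `y`-coordinate of the quotient by `C`. -/
def quotY (P : W.Point) : k := traceFun (C := C) ηc P

variable {C}

theorem quotX_add {Q : W.Point} (hQ : Q ∈ C) (P : W.Point) : quotX C (P + Q) = quotX C P :=
  traceFun_add xc hQ P

theorem quotY_add {Q : W.Point} (hQ : Q ∈ C) (P : W.Point) : quotY C (P + Q) = quotY C P :=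
  traceFun_add ηc hQ P

@[simp] theorem quotX_neg (P : W.Point) : quotX C (-P) = quotX C P := by
  rw [quotX, traceFun_neg]
  simp only [xc_neg]
  rfl

@[simp] theorem quotY_neg (P : W.Point) : quotY C (-P) = -quotY C P := by
  rw [quotY, traceFun_neg]
  simp only [ηc_neg, traceFun, quotY, Finset.sum_neg_distrib]

theorem eventually_notMem : ∀ᶠ P in cofinite, P ∉ C :=
  (Set.toFinite (C : Set W.Point)).eventually_cofinite_notMem

variable [NeZero (2 : k)] [IsAlgClosed k] [W.IsElliptic]

theorem regVal_quotX {P : W.Point} (hP : P ∉ C) : RegVal (quotX C) P (quotX C P) :=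
  regVal_traceFun (fun _ h => regVal_xc h) hP

theorem regVal_quotY {P : W.Point} (hP : P ∉ C) : RegVal (quotY C) P (quotY C P) :=
  regVal_traceFun (fun _ h => regVal_ηc h) hP

theorem invFun_quotX : InvFun C (quotX C) := invFun_traceFun fun _ h => regVal_xc h

theorem invFun_quotY : InvFun C (quotY C) := invFun_traceFun fun _ h => regVal_ηc h

theorem regVal_quotX_sub : ∃ w, RegVal (fun P => quotX C P - xc P) 0 w :=
  regVal_traceFun_sub fun _ h => regVal_xc h

theorem regVal_quotY_sub : ∃ w, RegVal (fun P => quotY C P - ηc P) 0 w :=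
  regVal_traceFun_sub fun _ h => regVal_ηc h

theorem regVal_inv_mul_quotX : RegVal (fun P => (xc P)⁻¹ * quotX C P) 0 1 := by
  obtain ⟨w, hw⟩ := regVal_quotX_sub (C := C)
  have := (regVal_inv_xc_zero.mul hw).add (RegVal.const 1 0)
  rw [zero_mul, zero_add] at this
  refine this.congr ?_
  filter_upwards [eventually_xc_ne_zero] with P hP
  field_simp
  ring

theorem regVal_inv_mul_quotX_pow_mul (n : ℕ) {f : W.Point → k} {g : k[X]} (hg : g.natDegree ≤ n)
    (hf : ∀ᶠ P in cofinite, f P = g.eval (quotX C P)) :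
    RegVal (fun P => (xc P)⁻¹ ^ n * f P) 0 (g.coeff n) := by
  have h1 : RegVal (fun P : W.Point => ∑ i ∈ Finset.range (n + 1),
      g.coeff i * ((xc P)⁻¹ ^ (n - i) * ((xc P)⁻¹ * quotX C P) ^ i)) 0
      (∑ i ∈ Finset.range (n + 1), g.coeff i * (0 ^ (n - i) * 1 ^ i)) :=
    RegVal.sum _ fun i _ =>
      ((regVal_inv_xc_zero.pow (n - i)).mul (regVal_inv_mul_quotX.pow i)).const_mul _
  rw [Finset.sum_eq_single n] at h1
  · simp only [Nat.sub_self, pow_zero, mul_one, one_pow] at h1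
    refine h1.congr ?_
    filter_upwards [hf] with P hP
    rw [hP, eval_eq_sum_range' (Nat.lt_succ_of_le hg), Finset.mul_sum]
    refine Finset.sum_congr rfl fun i hi => ?_
    have hi' : i ≤ n := Nat.lt_succ_iff.mp (Finset.mem_range.mp hi)
    have : (xc P)⁻¹ ^ n = (xc P)⁻¹ ^ (n - i) * (xc P)⁻¹ ^ i := by
      rw [← pow_add, Nat.sub_add_cancel hi']
    rw [this, mul_pow]
    ring
  · intro i hi hin
    have : n - i ≠ 0 := by
      have := Finset.mem_range.mp hi
      omega
    rw [zero_pow this, zero_mul, mul_zero]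
  · simp

theorem exists_eval_quotX {f : W.Point → k} (hf : InvFun C f)
    (he : ∀ᶠ P in cofinite, f (-P) = f P) :
    ∃ g : k[X], ∀ᶠ P in cofinite, f P = g.eval (quotX C P) :=
  invFun_quotX.exists_eval regVal_quotX_sub (Eventually.of_forall quotX_neg) hf he

theorem exists_eval_quotX_of_pole_le {f : W.Point → k} (hf : InvFun C f)
    (he : ∀ᶠ P in cofinite, f (-P) = f P) {n : ℕ}
    (hn : ∃ v, RegVal (fun P => (xc P)⁻¹ ^ n * f P) 0 v) :
    ∃ g : k[X], g.natDegree ≤ n ∧ ∀ᶠ P in cofinite, f P = g.eval (quotX C P) :=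
  invFun_quotX.exists_eval_of_pole_le regVal_quotX_sub (Eventually.of_forall quotX_neg) hf he hn

theorem eq_eval_quotX {f : W.Point → k} {g : k[X]}
    (h : ∀ᶠ P in cofinite, f P = g.eval (quotX C P)) {P : W.Point} (hP : P ∉ C) {v : k}
    (hf : RegVal f P v) : v = g.eval (quotX C P) :=
  (hf.congr h).unique ((regVal_quotX hP).eval g)

/-- The norm of `x - x(P)` over `C` is a polynomial in `quotX`. It vanishes at `P`, hence at `R`, so
some translate of `R` by `C` has the same `x`-coordinate as `P`. -/
theorem exists_of_quotX_eq {P R : W.Point} (hP : P ∉ C) (hR : R ∉ C)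
    (h : quotX C P = quotX C R) : ∃ Q ∈ C, R = P + Q ∨ R = -P + Q := by
  have hP0 : P ≠ 0 := fun h => hP (h ▸ C.zero_mem)
  have hreg : ∀ Z : W.Point, Z ≠ 0 → RegVal (fun Z => xc Z - xc P) Z (xc Z - xc P) :=
    fun Z hZ => (regVal_xc hZ).sub (RegVal.const _ _)
  obtain ⟨g, hg⟩ := exists_eval_quotX (C := C) (invFun_normFun hreg)
    (Eventually.of_forall fun Z => by rw [normFun_neg]; simp only [xc_neg])
  have h1 := eq_eval_quotX hg hP (regVal_normFun hreg hP)
  have h2 := eq_eval_quotX hg hR (regVal_normFun hreg hR)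
  rw [← h, ← h1] at h2
  have h3 : normFun (C := C) (fun Z => xc Z - xc P) P = 0 :=
    Finset.prod_eq_zero (Finset.mem_univ (0 : C)) (by simp)
  rw [h3] at h2
  obtain ⟨Q, -, hQ⟩ := Finset.prod_eq_zero_iff.mp h2
  have hRQ : R + Q ≠ 0 := fun h => hR (by
    rw [eq_neg_of_add_eq_zero_left h]
    exact C.neg_mem Q.2)
  refine ⟨-Q, C.neg_mem Q.2, ?_⟩
  rcases eq_or_eq_neg_of_xc_eq hRQ hP0 (sub_eq_zero.mp hQ) with h | h
  · exact .inl (by rw [← h]; abel)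
  · exact .inr (by rw [← h]; abel)

/-- If the value `x` were omitted, `1 / (quotX - x)` would be regular off `C` and zero at infinity,
hence constant and equal to zero. -/
theorem quotX_surjective (x : k) : ∃ P ∉ C, quotX C P = x := by
  by_contra! hcon
  have hreg : ∀ P ∉ C, RegVal (fun P => (quotX C P - x)⁻¹) P (quotX C P - x)⁻¹ := fun P hP =>
    ((regVal_quotX hP).sub (RegVal.const x P)).inv (sub_ne_zero.mpr (hcon P hP))
  have hinv : InvFun C (fun P => (quotX C P - x)⁻¹) :=
    ⟨fun Q hQ => Eventually.of_forall fun P => by rw [quotX_add hQ], fun P hP => ⟨_, hreg P hP⟩⟩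
  have h0 : RegVal (fun P => (quotX C P - x)⁻¹) 0 0 := by
    have h1 : RegVal (fun P => (xc P)⁻¹ * (quotX C P - x)) 0 1 := by
      have := regVal_inv_mul_quotX (C := C) |>.sub (regVal_inv_xc_zero.const_mul x)
      rw [mul_zero, sub_zero] at this
      refine this.congr (Eventually.of_forall fun P => ?_)
      simp only
      ring
    have h2 := regVal_inv_xc_zero.mul (h1.inv one_ne_zero)
    rw [zero_mul] at h2
    refine h2.congr ?_
    filter_upwards [eventually_xc_ne_zero] with P hP
    rw [mul_inv, inv_inv, inv_mul_cancel_left₀ hP]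
  obtain ⟨g, hg, hg'⟩ := exists_eval_quotX_of_pole_le (n := 0) hinv
    (Eventually.of_forall fun P => by rw [quotX_neg]) ⟨0, by simpa using h0⟩
  rw [eq_C_of_natDegree_le_zero hg] at hg'
  simp only [eval_C] at hg'
  have h3 := h0.unique ((RegVal.const (g.coeff 0) 0).congr (by
    filter_upwards [hg'] with P hP using hP.symm))
  obtain ⟨P, hP1, hP2⟩ := (hg'.and (eventually_notMem (C := C))).exists
  rw [← h3] at hP1
  exact inv_ne_zero (sub_ne_zero.mpr (hcon P hP2)) hP1

theorem regVal_inv_sq_mul_quotY : RegVal (fun P => (xc P)⁻¹ ^ 2 * quotY C P) 0 0 := by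
  obtain ⟨w, hw⟩ := regVal_quotY_sub (C := C)
  have := regVal_inv_sq_mul_ηc.add ((regVal_inv_xc_zero.pow 2).mul hw)
  norm_num at this
  refine this.congr (Eventually.of_forall fun P => ?_)
  simp only
  ring

/-- `quotY` and `η` have the same principal part, so the value is the leading coefficient `4` of
`Ψ₂Sq`. -/
theorem regVal_inv_cube_mul_ηc_mul_quotY :
    RegVal (fun P => (xc P)⁻¹ ^ 3 * (ηc P * quotY C P)) 0 4 := by
  obtain ⟨w, hw⟩ := regVal_quotY_sub (C := C)
  have h1 := regVal_inv_pow_mul_eval (W := W) W.Ψ₂Sq natDegree_twoTorsion.le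
  have h2 := h1.add ((regVal_inv_xc_zero.mul regVal_inv_sq_mul_ηc).mul hw)
  rw [WeierstrassCurve.coeff_Ψ₂Sq, zero_mul, zero_mul, add_zero] at h2
  refine h2.congr ?_
  filter_upwards [eventually_ne 0] with P hP
  rw [← ηc_sq hP]
  ring

theorem regVal_inv_cube_mul_quotY_sq : RegVal (fun P => (xc P)⁻¹ ^ 3 * quotY C P ^ 2) 0 4 := by
  obtain ⟨w, hw⟩ := regVal_quotY_sub (C := C)
  have h2 := (regVal_inv_cube_mul_ηc_mul_quotY (C := C)).add
    ((regVal_inv_xc_zero.mul (regVal_inv_sq_mul_quotY (C := C))).mul hw)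
  rw [zero_mul, zero_mul, add_zero] at h2
  refine h2.congr (Eventually.of_forall fun P => ?_)
  simp only
  ring

variable (C) in
/-- The points `T₁, T₂, T₃` map to the three points of order two on the quotient curve. -/
structure TwoTorsionTriple (T₁ T₂ T₃ : W.Point) : Prop where
  notMem₁ : T₁ ∉ C
  notMem₂ : T₂ ∉ C
  notMem₃ : T₃ ∉ C
  ne₁₂ : quotX C T₁ ≠ quotX C T₂
  ne₁₃ : quotX C T₁ ≠ quotX C T₃
  ne₂₃ : quotX C T₂ ≠ quotX C T₃
  quotY₁ : quotY C T₁ = 0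
  quotY₂ : quotY C T₂ = 0
  quotY₃ : quotY C T₃ = 0

/-- Since `C` has no point of order two, the three points of order two lie outside `C` and remain
distinct modulo `C`; the odd function `quotY` vanishes at each. -/
theorem exists_twoTorsionTriple (hC : ∀ P ∈ C, 2 • P = 0 → P = 0) :
    ∃ T₁ T₂ T₃, TwoTorsionTriple C T₁ T₂ T₃ := by
  obtain ⟨T₁, T₂, T₃, h12, h13, h23, ⟨h1, h1'⟩, ⟨h2, h2'⟩, ⟨h3, h3'⟩⟩ := exists_two_torsion (W := W)
  have htor : ∀ T : W.Point, -T = T → 2 • T = 0 := fun T h => by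
    rw [two_nsmul]
    nth_rewrite 1 [← h]
    exact neg_add_cancel T
  have hmem : ∀ T : W.Point, T ≠ 0 → -T = T → T ∉ C := fun T hT h hTC => hT (hC T hTC (htor T h))
  have hY : ∀ T : W.Point, -T = T → quotY C T = 0 := fun T h => by
    have h0 := quotY_neg (C := C) T
    rw [h] at h0
    have : (2 : k) * quotY C T = 0 := by linear_combination h0
    exact (mul_eq_zero.mp this).resolve_left two_ne_zero
  have hX : ∀ T T' : W.Point, T ≠ 0 → T' ≠ 0 → -T = T → -T' = T' → T ≠ T' →
      quotX C T ≠ quotX C T' := by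
    intro T T' hT hT' hn hn' hne heq
    obtain ⟨Q, hQ, hTQ⟩ := exists_of_quotX_eq (hmem T hT hn) (hmem T' hT' hn') heq
    rw [hn, or_self] at hTQ
    have hQ0 : Q = 0 := hC Q hQ (by
      have := htor T' hn'
      rwa [hTQ, nsmul_add, htor T hn, zero_add] at this)
    exact hne (by rw [hTQ, hQ0, add_zero])
  exact ⟨T₁, T₂, T₃, hmem T₁ h1 h1', hmem T₂ h2 h2', hmem T₃ h3 h3', hX _ _ h1 h2 h1' h2' h12,
    hX _ _ h1 h3 h1' h3' h13, hX _ _ h2 h3 h2' h3' h23, hY _ h1', hY _ h2', hY _ h3'⟩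

variable {T₁ T₂ T₃ : W.Point}

/-- `quotY²` is even with a pole of order six, hence a polynomial in `quotX` of degree at most
three. Its leading coefficient is `4`, and its roots are given by the three points where `quotY`
vanishes. -/
theorem TwoTorsionTriple.quotY_sq (hT : TwoTorsionTriple C T₁ T₂ T₃) {P : W.Point} (hP : P ∉ C) :
    quotY C P ^ 2 = 4 * ((quotX C P - quotX C T₁) * (quotX C P - quotX C T₂) *
      (quotX C P - quotX C T₃)) := by
  have hinv : InvFun C (fun P => quotY C P ^ 2) := by
    simpa only [sq] using invFun_quotY.mul invFun_quotY
  obtain ⟨F, hF, hF'⟩ := exists_eval_quotX_of_pole_le (n := 3) hinv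
    (Eventually.of_forall fun P => by rw [quotY_neg]; ring) ⟨4, regVal_inv_cube_mul_quotY_sq⟩
  have hval : ∀ P ∉ C, quotY C P ^ 2 = F.eval (quotX C P) := fun P hP =>
    eq_eval_quotX hF' hP ((regVal_quotY hP).pow 2)
  have hc : F.coeff 3 = 4 :=
    (regVal_inv_mul_quotX_pow_mul 3 hF hF').unique regVal_inv_cube_mul_quotY_sq
  rw [hval P hP, ← hc]
  refine eq_of_three_roots hF hT.ne₁₂ hT.ne₁₃ hT.ne₂₃ ?_ ?_ ?_ _
  · rw [← hval _ hT.notMem₁, hT.quotY₁]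
    ring
  · rw [← hval _ hT.notMem₂, hT.quotY₂]
    ring
  · rw [← hval _ hT.notMem₃, hT.quotY₃]
    ring

theorem TwoTorsionTriple.eventually_quotY_ne_zero (hT : TwoTorsionTriple C T₁ T₂ T₃) :
    ∀ᶠ P in cofinite, quotY C P ≠ 0 := by
  obtain ⟨x, hx⟩ := Infinite.exists_notMem_finset
    ({quotX C T₁, quotX C T₂, quotX C T₃} : Finset k)
  simp only [Finset.mem_insert, Finset.mem_singleton, not_or] at hx
  obtain ⟨P, hP, rfl⟩ := quotX_surjective (C := C) x
  refine (regVal_quotY hP).eventually_ne_zero fun h0 => ?_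
  have := hT.quotY_sq hP
  rw [h0] at this
  refine mul_ne_zero four_ne_zero_of_two (mul_ne_zero (mul_ne_zero ?_ ?_) ?_)
    (this.symm.trans (by ring))
  · exact sub_ne_zero.mpr hx.1
  · exact sub_ne_zero.mpr hx.2.1
  · exact sub_ne_zero.mpr hx.2.2

/-- An odd invariant function with a pole of order at most three is a multiple of `y`. -/
theorem TwoTorsionTriple.eq_mul_quotY (hT : TwoTorsionTriple C T₁ T₂ T₃) {f : W.Point → k}
    (hf : InvFun C f) (ho : ∀ᶠ P in cofinite, f (-P) = -f P)
    (hn : ∃ v, RegVal (fun P => (xc P)⁻¹ ^ 3 * (quotY C P * f P)) 0 v) :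
    ∃ c : k, ∀ᶠ P in cofinite, f P = c * quotY C P := by
  -- `quotY · f` is even, so it is a polynomial in `quotX` of degree at most three. It vanishes at
  -- the same three points as `quotY²`, of which it is therefore a multiple.
  obtain ⟨G, hG, hG'⟩ := exists_eval_quotX_of_pole_le (n := 3) (invFun_quotY.mul hf)
    (by
      filter_upwards [ho] with P h
      rw [quotY_neg, h]
      ring) hn
  have hval : ∀ T ∉ C, quotY C T = 0 → G.eval (quotX C T) = 0 := by
    intro T hTC hY
    obtain ⟨v, hv⟩ := hf.reg T hTC
    have := eq_eval_quotX hG' hTC ((regVal_quotY hTC).mul hv)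
    rw [← this, hY, zero_mul]
  refine ⟨G.coeff 3 / 4, ?_⟩
  filter_upwards [hG', hT.eventually_quotY_ne_zero, eventually_notMem (C := C)] with P hP hY hPC
  rw [eq_of_three_roots hG hT.ne₁₂ hT.ne₁₃ hT.ne₂₃ (hval _ hT.notMem₁ hT.quotY₁)
    (hval _ hT.notMem₂ hT.quotY₂) (hval _ hT.notMem₃ hT.quotY₃)] at hP
  apply mul_left_cancel₀ hY
  have h4 : (4 : k) ≠ 0 := four_ne_zero_of_two
  rw [hP]
  field_simp
  linear_combination -G.coeff 3 * hT.quotY_sq hPC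

/-- The norm of a line function is a linear combination of the coordinates on the quotient. -/
theorem TwoTorsionTriple.exists_normFun_line (hT : TwoTorsionTriple C T₁ T₂ T₃) (l m : k) :
    ∃ α β γ : k, (α ≠ 0 ∨ β ≠ 0 ∨ γ ≠ 0) ∧ ∀ P ∉ C,
      normFun (C := C) (fun Z : W.Point => yc Z - l * xc Z - m) P =
        α * quotY C P + β * quotX C P + γ := by
  set h : W.Point → k := fun Z => yc Z - l * xc Z - m with hh
  have hreg : ∀ Z : W.Point, Z ≠ 0 → RegVal h Z (h Z) := fun Z hZ =>
    ((regVal_yc hZ).sub ((regVal_xc hZ).const_mul l)).sub (RegVal.const m Z)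
  -- `h = η / 2 + L(x)` with `L` linear
  obtain ⟨r, s, hrs⟩ : ∃ r s : k, ∀ Z : W.Point, Z ≠ 0 → h Z = 2⁻¹ * ηc Z + (r * xc Z + s) := by
    refine ⟨-2⁻¹ * W.a₁ - l, -2⁻¹ * W.a₃ - m, fun Z hZ => ?_⟩
    simp only [hh, yc_eq hZ]
    ring
  have hne : ∀ᶠ P in cofinite, h P ≠ 0 := by
    by_contra hcon
    have hfr : ∃ᶠ P : W.Point in cofinite,
        (Polynomial.C r * Polynomial.X + Polynomial.C s).eval (xc P) +
          (Polynomial.C (2⁻¹ : k)).eval (xc P) * ηc P = 0 := by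
      have h1 : ∃ᶠ P in cofinite, h P = 0 := fun hc => hcon hc
      refine (h1.and_eventually (eventually_ne 0)).mono fun P ⟨h2, h3⟩ => ?_
      rw [hrs P h3] at h2
      simp only [eval_add, eval_mul, eval_C, eval_X]
      linear_combination h2
    have := (eq_zero_of_frequently hfr).2
    simp at this
    exact two_ne_zero this
  -- The norm is `h · M` with `M` regular at infinity, so its pole has order at most three, and such
  -- functions on the quotient are spanned by `1`, `quotX` and `quotY`. The even part contains `η
  -- (M(P) - M(-P))`, where the odd second factor vanishes at infinity and lowers the pole of `η`.
  obtain ⟨M, ⟨w, hM⟩, -, hgM⟩ := exists_normFun_eq_mul (C := C) hreg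
  have hg : InvFun C (normFun (C := C) h) := invFun_normFun hreg
  have hM' : RegVal (fun P => M (-P)) 0 w := RegVal.comp_neg (by rwa [neg_zero])
  have hlin : RegVal (fun P : W.Point => (xc P)⁻¹ * (r * xc P + s)) 0 r := by
    have := (RegVal.const r (0 : W.Point)).add (regVal_inv_xc_zero.const_mul s)
    rw [mul_zero, add_zero] at this
    refine this.congr ?_
    filter_upwards [eventually_xc_ne_zero] with P hP
    field_simp
  have hodd : RegVal (fun P => M P - M (-P)) 0 (w - w) := hM.sub hM'
  obtain ⟨w', hw'⟩ := IsRat.regVal_ηc_mul_odd hodd (Eventually.of_forall fun P => by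
    rw [neg_neg]
    ring)
  -- the even part
  obtain ⟨B, hB, hB'⟩ := exists_eval_quotX_of_pole_le (n := 1)
    (f := fun P => 2⁻¹ * (normFun (C := C) h P + normFun (C := C) h (-P)))
    ((hg.add hg.comp_neg).const_mul _) (Eventually.of_forall fun P => by rw [neg_neg, add_comm])
    ⟨_, ((hw'.const_mul (2⁻¹ * 2⁻¹)).add ((hlin.mul (hM.add hM')).const_mul 2⁻¹)).congr (by
      filter_upwards [eventually_ne 0] with P hP
      rw [hgM, hgM, hrs P hP, hrs (-P) (neg_ne_zero.mpr hP), xc_neg, ηc_neg, pow_one]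
      ring)⟩
  -- the odd part
  obtain ⟨α, hα⟩ := hT.eq_mul_quotY
    (f := fun P => 2⁻¹ * (normFun (C := C) h P - normFun (C := C) h (-P)))
    ((hg.sub hg.comp_neg).const_mul _) (Eventually.of_forall fun P => by
      rw [neg_neg]
      ring)
    ⟨_, (((regVal_inv_cube_mul_ηc_mul_quotY.mul (hM.add hM')).const_mul (2⁻¹ * 2⁻¹)).add
      (((regVal_inv_sq_mul_quotY (C := C)).mul (hlin.mul hodd)).const_mul 2⁻¹)).congr (by
      filter_upwards [eventually_ne 0] with P hP
      rw [hgM, hgM, hrs P hP, hrs (-P) (neg_ne_zero.mpr hP), xc_neg, ηc_neg]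
      ring)⟩
  have hsum : ∀ᶠ P in cofinite, normFun (C := C) h P =
      α * quotY C P + B.coeff 1 * quotX C P + B.coeff 0 := by
    filter_upwards [hB', hα] with P h1 h2
    have h3 : normFun (C := C) h P = 2⁻¹ * (normFun (C := C) h P + normFun (C := C) h (-P)) +
        2⁻¹ * (normFun (C := C) h P - normFun (C := C) h (-P)) := by
      field_simp
      ring
    rw [h3, h1, h2, eq_X_add_C_of_natDegree_le_one hB]
    simp
    ring
  refine ⟨α, B.coeff 1, B.coeff 0, ?_, fun P hP => ?_⟩
  · by_contra! hcon
    obtain ⟨P, h1, h2⟩ := (hsum.and (eventually_normFun_ne_zero (C := C) hne)).exists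
    rw [hcon.1, hcon.2.1, hcon.2.2] at h1
    exact h2 (by rw [h1]; ring)
  · exact (regVal_normFun hreg hP).unique (((((regVal_quotY hP).const_mul α).add
      ((regVal_quotX hP).const_mul (B.coeff 1))).add (RegVal.const (B.coeff 0) P)).congr (by
        filter_upwards [hsum] with P h using h.symm))

end Quotient

/-! ### The quotient curve and the quotient homomorphism -/

section QuotientCurve

variable {k : Type u} [Field k]

/-- The Weierstrass curve `y² = (x - e₁)(x - e₂)(x - e₃)`. -/
def rootCurve (e₁ e₂ e₃ : k) : Affine k :=
  ⟨0, -(e₁ + e₂ + e₃), 0, e₁ * e₂ + e₁ * e₃ + e₂ * e₃, -(e₁ * e₂ * e₃)⟩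

theorem rootCurve_a₁ (e₁ e₂ e₃ : k) : (rootCurve e₁ e₂ e₃).a₁ = 0 := rfl

theorem rootCurve_a₂ (e₁ e₂ e₃ : k) : (rootCurve e₁ e₂ e₃).a₂ = -(e₁ + e₂ + e₃) := rfl

theorem rootCurve_a₃ (e₁ e₂ e₃ : k) : (rootCurve e₁ e₂ e₃).a₃ = 0 := rfl

theorem rootCurve_equation_iff {e₁ e₂ e₃ x y : k} :
    (rootCurve e₁ e₂ e₃).Equation x y ↔ y ^ 2 = (x - e₁) * (x - e₂) * (x - e₃) := by
  rw [Affine.equation_iff]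
  simp only [rootCurve]
  constructor <;> intro h <;> linear_combination h

theorem isElliptic_rootCurve [NeZero (2 : k)] {e₁ e₂ e₃ : k} (h₁₂ : e₁ ≠ e₂) (h₁₃ : e₁ ≠ e₃)
    (h₂₃ : e₂ ≠ e₃) : (rootCurve e₁ e₂ e₃).IsElliptic := by
  constructor
  have : (rootCurve e₁ e₂ e₃).Δ = (4 * ((e₁ - e₂) * (e₁ - e₃) * (e₂ - e₃))) ^ 2 := by
    simp only [rootCurve, WeierstrassCurve.Δ, b₂, b₄, b₆, b₈]
    ring
  rw [this, isUnit_iff_ne_zero]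
  exact pow_ne_zero _ (mul_ne_zero four_ne_zero_of_two (mul_ne_zero (mul_ne_zero
    (sub_ne_zero.mpr h₁₂) (sub_ne_zero.mpr h₁₃)) (sub_ne_zero.mpr h₂₃)))

variable [DecidableEq k] [NeZero (2 : k)] [IsAlgClosed k] {W : Affine k} [W.IsElliptic]
  {C : AddSubgroup W.Point} [Fintype C] {T₁ T₂ T₃ : W.Point}

theorem TwoTorsionTriple.nonsingular (hT : TwoTorsionTriple C T₁ T₂ T₃) {P : W.Point}
    (hP : P ∉ C) : (rootCurve (quotX C T₁) (quotX C T₂) (quotX C T₃)).Nonsingular (quotX C P)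
      (2⁻¹ * quotY C P) := by
  have := isElliptic_rootCurve hT.ne₁₂ hT.ne₁₃ hT.ne₂₃
  rw [← Affine.equation_iff_nonsingular, rootCurve_equation_iff, mul_pow, hT.quotY_sq hP]
  have h4 : (2⁻¹ : k) ^ 2 * 4 = 1 := by
    have : (2⁻¹ : k) * 2 = 1 := inv_mul_cancel₀ two_ne_zero
    linear_combination (2⁻¹ * 2 + 1) * this
  rw [← mul_assoc, h4, one_mul]

open Classical in
/-- The quotient map by `C`, as a map of sets. -/
noncomputable def TwoTorsionTriple.map (hT : TwoTorsionTriple C T₁ T₂ T₃) (P : W.Point) :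
    (rootCurve (quotX C T₁) (quotX C T₂) (quotX C T₃)).Point :=
  if hP : P ∈ C then 0 else .some _ _ (hT.nonsingular hP)

namespace TwoTorsionTriple

variable (hT : TwoTorsionTriple C T₁ T₂ T₃)

theorem map_of_mem {P : W.Point} (hP : P ∈ C) : hT.map P = 0 := dif_pos hP

theorem map_eq_zero_iff {P : W.Point} : hT.map P = 0 ↔ P ∈ C := by
  refine ⟨fun h => ?_, hT.map_of_mem⟩
  by_contra hP
  rw [map, dif_neg hP] at h
  exact Affine.Point.some_ne_zero _ h

theorem xc_map {P : W.Point} (hP : P ∉ C) : xc (hT.map P) = quotX C P := by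
  rw [map, dif_neg hP, xc_some]

theorem yc_map {P : W.Point} (hP : P ∉ C) : yc (hT.map P) = 2⁻¹ * quotY C P := by
  rw [map, dif_neg hP, yc_some]

theorem ηc_map {P : W.Point} (hP : P ∉ C) : ηc (hT.map P) = quotY C P := by
  rw [ηc_eq (mt hT.map_eq_zero_iff.mp hP), hT.yc_map hP]
  simp only [rootCurve_a₁, rootCurve_a₃]
  field_simp
  ring

theorem map_neg (P : W.Point) : hT.map (-P) = -hT.map P := by
  by_cases hP : P ∈ C
  · rw [hT.map_of_mem hP, hT.map_of_mem (C.neg_mem hP), neg_zero]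
  · have hP' : -P ∉ C := fun h => hP (by simpa using C.neg_mem h)
    refine eq_of_xc_eq_of_ηc_eq (mt hT.map_eq_zero_iff.mp hP')
      (neg_ne_zero.mpr (mt hT.map_eq_zero_iff.mp hP)) ?_ ?_
    · rw [xc_neg, hT.xc_map hP, hT.xc_map hP', quotX_neg]
    · rw [ηc_neg, hT.ηc_map hP, hT.ηc_map hP', quotY_neg]

theorem map_add_of_mem {Q : W.Point} (hQ : Q ∈ C) (P : W.Point) : hT.map (P + Q) = hT.map P := by
  by_cases hP : P ∈ C
  · rw [hT.map_of_mem hP, hT.map_of_mem (C.add_mem hP hQ)]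
  · have hP' : P + Q ∉ C := fun h => hP (by simpa using C.sub_mem h hQ)
    refine eq_of_xc_eq_of_ηc_eq (mt hT.map_eq_zero_iff.mp hP')
      (mt hT.map_eq_zero_iff.mp hP) ?_ ?_
    · rw [hT.xc_map hP, hT.xc_map hP', quotX_add hQ]
    · rw [hT.ηc_map hP, hT.ηc_map hP', quotY_add hQ]

theorem quotX_ne {P R : W.Point} (hP : P ∉ C) (hR : R ∉ C) (h1 : P + R ∉ C) (h2 : P - R ∉ C) :
    quotX C P ≠ quotX C R := by
  intro h
  obtain ⟨Q, hQ, h | h⟩ := exists_of_quotX_eq hP hR h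
  · exact h2 (by rw [h]; simpa using hQ)
  · exact h1 (by rw [h]; simpa using hQ)

/-- The line through `P`, `R` and `-(P + R)` has as norm a line function on the quotient curve that
vanishes at the three images. Under the genericity hypotheses these have distinct `x`-coordinates,
so they are the three intersections of that line with the cubic, and Vieta gives the addition
formula. -/
theorem map_add_of_generic {P R : W.Point} (hP : P ∉ C) (hR : R ∉ C) (h1 : P + R ∉ C)
    (h2 : P - R ∉ C) (h3 : 2 • P + R ∉ C) (h4 : P + 2 • R ∉ C) :
    hT.map (P + R) = hT.map P + hT.map R := by
  have hne : ∀ {Z : W.Point}, Z ∉ C → Z ≠ 0 := fun hZ h => hZ (h ▸ C.zero_mem)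
  have hneg : ∀ {Z : W.Point}, Z ∉ C → -Z ∉ C := fun hZ h => hZ (by simpa using C.neg_mem h)
  have hx : xc P ≠ xc R := by
    intro h
    rcases eq_or_eq_neg_of_xc_eq (hne hP) (hne hR) h with h | h
    · exact h2 (by rw [h, sub_self]; exact C.zero_mem)
    · exact h1 (by rw [h, neg_add_cancel]; exact C.zero_mem)
  obtain ⟨hS0, hSx, hSy⟩ := xc_add_ne (hne hP) (hne hR) hx
  set l := (yc P - yc R) / (xc P - xc R) with hl
  have hlx : l * (xc P - xc R) = yc P - yc R := div_mul_cancel₀ _ (sub_ne_zero.mpr hx)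
  set m := yc P - l * xc P with hm
  obtain ⟨α, β, γ, hne0, hline⟩ := hT.exists_normFun_line l m
  have hzero : ∀ Z ∉ C, yc Z - l * xc Z - m = 0 → α * quotY C Z + β * quotX C Z + γ = 0 := by
    intro Z hZ h
    rw [← hline Z hZ]
    exact Finset.prod_eq_zero (Finset.mem_univ (0 : C)) (by simpa using h)
  have hS : -(P + R) ∉ C := hneg h1
  have e1 := hzero P hP (by rw [hm]; ring)
  have e2 := hzero R hR (by rw [hm]; linear_combination hlx)
  have e3 := hzero _ hS (by
    have hy : yc (-(P + R)) = -yc (P + R) - W.a₁ * xc (P + R) - W.a₃ := by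
      have h5 := ηc_neg (P + R)
      rw [ηc_eq (neg_ne_zero.mpr hS0), ηc_eq hS0, xc_neg] at h5
      apply mul_left_cancel₀ (two_ne_zero (α := k))
      linear_combination h5
    rw [hy, xc_neg, hSy, hm]
    ring)
  have hX12 := quotX_ne hP hR h1 h2
  have hX13 : quotX C P ≠ quotX C (-(P + R)) := by
    refine quotX_ne hP hS (fun h => hR ?_) (fun h => h3 ?_)
    · simpa using C.neg_mem h
    · convert h using 1
      rw [two_nsmul]
      abel
  have hX23 : quotX C R ≠ quotX C (-(P + R)) := by
    refine quotX_ne hR hS (fun h => hP ?_) (fun h => h4 ?_)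
    · simpa using C.neg_mem h
    · convert h using 1
      rw [two_nsmul]
      abel
  -- The image line is not vertical: with `α = 0`, the function `βX + γ` would vanish at two
  -- different values of `X`, hence identically.
  have hα : α ≠ 0 := by
    intro hα
    rw [hα] at e1 e2
    have hβ : β = 0 := by
      have : β * (quotX C P - quotX C R) = 0 := by linear_combination e1 - e2
      exact (mul_eq_zero.mp this).resolve_right (sub_ne_zero.mpr hX12)
    rw [hβ] at e1
    rcases hne0 with h | h | h
    · exact h hα
    · exact h hβ
    · exact h (by linear_combination e1)
  have q1 := hT.quotY_sq hP
  have q2 := hT.quotY_sq hR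
  have q3 := hT.quotY_sq hS
  obtain ⟨n0, n1, n2⟩ := xc_add_ne (mt hT.map_eq_zero_iff.mp hP) (mt hT.map_eq_zero_iff.mp hR)
    (by rwa [hT.xc_map hP, hT.xc_map hR])
  rw [← neg_neg (P + R), hT.map_neg]
  rw [hT.xc_map hP, hT.xc_map hR, hT.yc_map hP, hT.yc_map hR] at n1 n2
  simp only [rootCurve_a₁, rootCurve_a₂, rootCurve_a₃, zero_mul, sub_zero, add_zero] at n1 n2
  generalize quotX C P = x₁ at *
  generalize quotX C R = x₂ at *
  generalize hx₃ : quotX C (-(P + R)) = x₃ at *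
  generalize quotY C P = y₁ at *
  generalize quotY C R = y₂ at *
  generalize hy₃ : quotY C (-(P + R)) = y₃ at *
  -- Slope and intercept of the image line. The factor `2` appears because `quotY` is twice the
  -- `y`-coordinate.
  set μ := -(β / (2 * α)) with hμ
  set ν := -(γ / (2 * α)) with hν
  have hl1 : y₁ = 2 * (μ * x₁ + ν) := by
    rw [hμ, hν]
    field_simp
    linear_combination e1
  have hl2 : y₂ = 2 * (μ * x₂ + ν) := by
    rw [hμ, hν]
    field_simp
    linear_combination e2
  have hl3 : y₃ = 2 * (μ * x₃ + ν) := by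
    rw [hμ, hν]
    field_simp
    linear_combination e3
  have hslope : (2⁻¹ * y₁ - 2⁻¹ * y₂) / (x₁ - x₂) = μ := by
    rw [div_eq_iff (sub_ne_zero.mpr hX12), hl1, hl2]
    field_simp
    ring
  rw [hslope] at n1 n2
  have h40 : (4 : k) ≠ 0 := four_ne_zero_of_two
  have hx3 : x₃ = -(-(quotX C T₁ + quotX C T₂ + quotX C T₃) - μ ^ 2) - x₁ - x₂ := by
    refine sum_eq_of_cubic_roots (B := quotX C T₁ * quotX C T₂ + quotX C T₁ * quotX C T₃
      + quotX C T₂ * quotX C T₃ - 2 * μ * ν)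
      (D := -(quotX C T₁ * quotX C T₂ * quotX C T₃) - ν ^ 2) hX12 hX13 hX23 ?_ ?_ ?_
    · apply mul_left_cancel₀ h40
      rw [hl1] at q1
      linear_combination -q1
    · apply mul_left_cancel₀ h40
      rw [hl2] at q2
      linear_combination -q2
    · apply mul_left_cancel₀ h40
      rw [hl3] at q3
      linear_combination -q3
  have hxx : xc (-hT.map (-(P + R))) = xc (hT.map P + hT.map R) := by
    rw [xc_neg, hT.xc_map hS, n1, hx₃, hx3]
    ring
  refine eq_of_xc_eq_of_ηc_eq (neg_ne_zero.mpr (mt hT.map_eq_zero_iff.mp hS)) n0 hxx ?_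
  rw [ηc_neg, hT.ηc_map hS, ηc_eq n0, n2, ← hxx, xc_neg, hT.xc_map hS]
  simp only [hx₃, hy₃, hl3, hl1, rootCurve_a₁, rootCurve_a₃]
  field_simp
  ring

/-- Write `P + R = (P + Z) + (R - Z)`. A generic `Z` satisfies the finitely many conditions that
make the generic case apply to this sum and to both of its terms. -/
theorem map_add (P R : W.Point) : hT.map (P + R) = hT.map P + hT.map R := by
  by_cases hP : P ∈ C
  · rw [add_comm P, hT.map_add_of_mem hP, hT.map_of_mem hP, zero_add]
  by_cases hR : R ∈ C
  · rw [hT.map_add_of_mem hR, hT.map_of_mem hR, add_zero]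
  by_cases hPR : P + R ∈ C
  · have : hT.map R = -hT.map P := by
      rw [← hT.map_neg, ← hT.map_add_of_mem hPR (-P)]
      congr 1
      abel
    rw [this, add_neg_cancel, hT.map_of_mem hPR]
  have gen1 : ∀ S : W.Point, ∀ᶠ Z in cofinite, Z + S ∉ C := fun S =>
    (tendsto_add_right S).eventually eventually_notMem
  have gen2 : ∀ S : W.Point, ∀ᶠ Z in cofinite, -Z + S ∉ C := fun S =>
    tendsto_neg.eventually (gen1 S)
  have gen3 : ∀ S : W.Point, ∀ᶠ Z in cofinite, 2 • Z + S ∉ C := by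
    intro S
    have : ∀ᶠ Z : W.Point in cofinite, ∀ Q : C, 2 • Z ≠ Q - S :=
      eventually_all.mpr fun Q => eventually_two_nsmul_ne _
    filter_upwards [this] with Z hZ h
    exact hZ ⟨_, h⟩ (by simp)
  obtain ⟨Z, hZ⟩ := ((gen1 0).and ((gen1 P).and ((gen2 P).and ((gen1 (2 • P)).and ((gen3 P).and
    ((gen2 R).and ((gen1 R).and ((gen2 (2 • R)).and ((gen3 (-R)).and ((gen3 (P - R)).and
    ((gen1 (2 • P + R)).and (gen2 (P + 2 • R))))))))))))).exists
  obtain ⟨c1, c2, c3, c4, c5, c6, c7, c8, c9, c10, c11, c12⟩ := hZ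
  have neg_mem' : ∀ {S : W.Point}, S ∉ C → -S ∉ C := fun hS h => hS (by simpa using C.neg_mem h)
  have k1 : hT.map (P + Z) = hT.map P + hT.map Z := by
    refine hT.map_add_of_generic hP (by simpa using c1) (by rwa [add_comm])
      (by rwa [sub_eq_neg_add]) (by rwa [add_comm]) (by rwa [add_comm])
  have k2 : hT.map (R + -Z) = hT.map R + hT.map (-Z) := by
    refine hT.map_add_of_generic hR (neg_mem' (by simpa using c1)) (by rwa [add_comm])
      (by rwa [sub_neg_eq_add, add_comm]) (by rwa [add_comm]) ?_
    convert neg_mem' c9 using 2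
    rw [two_nsmul, two_nsmul]
    abel
  have k3 : hT.map ((P + Z) + (R + -Z)) = hT.map (P + Z) + hT.map (R + -Z) := by
    refine hT.map_add_of_generic (by rwa [add_comm]) (by rwa [add_comm]) ?_ ?_ ?_ ?_
    · convert hPR using 2
      abel
    · convert c10 using 2
      rw [two_nsmul]
      abel
    · convert c11 using 2
      rw [two_nsmul, two_nsmul]
      abel
    · convert c12 using 2
      rw [two_nsmul, two_nsmul]
      abel
  have : P + R = (P + Z) + (R + -Z) := by abel
  rw [this, k3, k1, k2, hT.map_neg]
  abel

/-- The quotient homomorphism. -/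
noncomputable def hom :
    W.Point →+ (rootCurve (quotX C T₁) (quotX C T₂) (quotX C T₃)).Point :=
  AddMonoidHom.mk' hT.map hT.map_add

theorem ker_hom : hT.hom.ker = C := by
  ext P
  exact hT.map_eq_zero_iff

theorem hom_surjective : Function.Surjective hT.hom := by
  intro S
  by_cases hS : S = 0
  · exact ⟨0, by rw [hS, _root_.map_zero]⟩
  obtain ⟨P, hP, hx⟩ := quotX_surjective (C := C) (xc S)
  have hP0 : hT.map P ≠ 0 := mt hT.map_eq_zero_iff.mp hP
  rcases eq_or_eq_neg_of_xc_eq hP0 hS (by rw [hT.xc_map hP, hx]) with h | h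
  · exact ⟨P, h⟩
  · exact ⟨-P, by rw [_root_.map_neg]; exact neg_eq_iff_eq_neg.mpr h⟩

theorem ratMap_hom : RatMap hT.hom := by
  refine ⟨(invFun_quotX (C := C)).isRat.congr ?_,
    ((invFun_quotY (C := C)).isRat.const_mul 2⁻¹).congr ?_, ?_⟩
  · filter_upwards [eventually_notMem (C := C)] with P hP using (hT.xc_map hP).symm
  · filter_upwards [eventually_notMem (C := C)] with P hP using (hT.yc_map hP).symm
  · filter_upwards [eventually_notMem (C := C)] with P hP using mt hT.map_eq_zero_iff.mp hP

/-- The norm over `C` of the denominator `c(x)` is invariant and divisible by `c(x)`. Multiplying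
`f` by it clears the poles off `C`, so both the product and the norm are polynomials in `quotX`. -/
theorem exists_even_eq_div {f : W.Point → k} (hf : IsRat f)
    (hinv : ∀ Q ∈ C, ∀ᶠ P in cofinite, f (P + Q) = f P)
    (he : ∀ᶠ P in cofinite, f (-P) = f P) :
    ∃ a b : k[X], ∀ᶠ P in cofinite, f P = a.eval (quotX C P) / b.eval (quotX C P) := by
  obtain ⟨a, c, hc, -, hac⟩ := hf.exists_even he
  have hreg : ∀ P : W.Point, P ≠ 0 → RegVal (fun Z => c.eval (xc Z)) P (c.eval (xc P)) :=
    fun P hP => (regVal_xc hP).eval c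
  have hN := invFun_normFun (C := C) hreg
  have hNe : ∀ P, normFun (C := C) (fun Z => c.eval (xc Z)) (-P) =
      normFun (C := C) (fun Z => c.eval (xc Z)) P := fun P => by
    rw [normFun_neg]
    simp only [xc_neg]
  obtain ⟨B, hB⟩ := exists_eval_quotX hN (Eventually.of_forall hNe)
  obtain ⟨m, -, hm, hmN⟩ := exists_normFun_eq_mul (C := C) hreg
  have hNf : InvFun C (fun P => normFun (C := C) (fun Z => c.eval (xc Z)) P * f P) := by
    refine ⟨fun Q hQ => ?_, fun P hP => ?_⟩
    · filter_upwards [hinv Q hQ] with P h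
      rw [h, normFun_add _ hQ]
    · obtain ⟨v, hv⟩ := hm P hP
      have hP0 : P ≠ 0 := fun h => hP (h ▸ C.zero_mem)
      refine ⟨_, (((regVal_xc hP0).eval a).mul hv).congr ?_⟩
      filter_upwards [hac] with Z hZ
      rw [hmN, ← hZ]
      ring
  obtain ⟨A, hA⟩ := exists_eval_quotX hNf (by
    filter_upwards [he] with P h
    rw [h, hNe])
  refine ⟨A, B, ?_⟩
  filter_upwards [hA, hB, eventually_normFun_ne_zero (C := C)
    (eventually_eval_xc_ne_zero (W := W) hc)] with P h1 h2 h3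
  rw [← h1, ← h2, mul_div_cancel_left₀ _ h3]

/-- Every rational function invariant under `C` comes from the quotient curve. -/
theorem exists_eq_comp {f : W.Point → k} (hf : IsRat f)
    (hinv : ∀ Q ∈ C, ∀ᶠ P in cofinite, f (P + Q) = f P) :
    ∃ R : (rootCurve (quotX C T₁) (quotX C T₂) (quotX C T₃)).Point → k,
      IsRat R ∧ ∀ᶠ P in cofinite, f P = R (hT.hom P) := by
  have := isElliptic_rootCurve hT.ne₁₂ hT.ne₁₃ hT.ne₂₃
  have hfn : IsRat (fun P => f (-P)) := hf.comp isRegularMap_neg tendsto_neg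
  have hinvn : ∀ Q ∈ C, ∀ᶠ P in cofinite, f (-(P + Q)) = f (-P) := fun Q hQ => by
    filter_upwards [tendsto_neg.eventually (hinv (-Q) (C.neg_mem hQ))] with P h
    rw [neg_add, h]
  -- Split `f` into its even and odd parts. The odd part becomes even after multiplication by
  -- `quotY`, which is divided out again as `η` on the quotient.
  obtain ⟨a, b, hab⟩ := exists_even_eq_div (C := C) (f := fun P => 2⁻¹ * (f P + f (-P)))
    ((hf.add hfn).const_mul _) (fun Q hQ => by
      filter_upwards [hinv Q hQ, hinvn Q hQ] with P h h'
      rw [h, h']) (Eventually.of_forall fun P => by rw [neg_neg, add_comm])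
  obtain ⟨a', b', hab'⟩ := exists_even_eq_div (C := C)
    (f := fun P => quotY C P * (2⁻¹ * (f P - f (-P))))
    (invFun_quotY.isRat.mul ((hf.sub hfn).const_mul _)) (fun Q hQ => by
      filter_upwards [hinv Q hQ, hinvn Q hQ] with P h h'
      rw [h, h', quotY_add hQ]) (Eventually.of_forall fun P => by
        rw [neg_neg, quotY_neg]
        ring)
  refine ⟨fun S => a.eval (xc S) / b.eval (xc S) + a'.eval (xc S) / b'.eval (xc S) / ηc S, ?_, ?_⟩
  · exact ((isRat_xc.eval a).div (isRat_xc.eval b)).add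
      (((isRat_xc.eval a').div (isRat_xc.eval b')).div isRat_ηc)
  · filter_upwards [hab, hab', eventually_notMem (C := C), hT.eventually_quotY_ne_zero]
      with P h1 h2 h3 h4
    have h5 : xc (hT.hom P) = quotX C P := hT.xc_map h3
    have h6 : ηc (hT.hom P) = quotY C P := hT.ηc_map h3
    rw [h5, h6, ← h1, ← h2, mul_div_cancel_left₀ _ h4]
    field_simp
    ring

end TwoTorsionTriple

end QuotientCurve

/-! ### Existence and universal property of the quotient -/

section IsQuotient

variable {k : Type u} [Field k] [DecidableEq k] [NeZero (2 : k)] [IsAlgClosed k]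
  {W : Affine k} [W.IsElliptic]

/-- The quotient of an elliptic curve by a finite subgroup without points of order two exists. -/
theorem exists_quotient (C : AddSubgroup W.Point) [Finite C]
    (hC : ∀ P ∈ C, 2 • P = 0 → P = 0) :
    ∃ (V : Affine k) (π : W.Point →+ V.Point), V.IsElliptic ∧ Function.Surjective π ∧
      IsQuotientMap C π := by
  have : Fintype C := Fintype.ofFinite C
  obtain ⟨T₁, T₂, T₃, hT⟩ := exists_twoTorsionTriple hC
  have hell := isElliptic_rootCurve hT.ne₁₂ hT.ne₁₃ hT.ne₂₃
  refine ⟨_, hT.hom, hell, hT.hom_surjective, isRegularMap_of_ratMap hT.ratMap_hom, hT.ker_hom,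
    fun V hV ψ hψ hψC => ?_⟩
  -- As a group homomorphism the factorisation is formal. Its regularity follows because `x ∘ ψ` and
  -- `y ∘ ψ` are invariant under `C` and so come from rational functions on the quotient.
  obtain ⟨χ, hχ⟩ : ∃ χ, χ.comp hT.hom = ψ :=
    ⟨hT.hom.liftOfSurjective hT.hom_surjective ⟨ψ, by rwa [hT.ker_hom]⟩,
      hT.hom.liftOfRightInverse_comp _ _ _⟩
  have hχ' : ∀ P, χ (hT.hom P) = ψ P := fun P => DFunLike.congr_fun hχ P
  refine ⟨χ, ⟨?_, hχ⟩, fun χ' hχ'' => ?_⟩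
  · by_cases h0 : ∃ P, ψ P ≠ 0
    · have hψ0 := eventually_ne_zero_of_regular hψ h0
      have hψt := tendsto_of_eventually_ne_zero hψ0
      have hψinv : ∀ Q ∈ C, ∀ P, ψ (P + Q) = ψ P := fun Q hQ P => by
        rw [_root_.map_add, AddMonoidHom.mem_ker.mp (hψC hQ), add_zero]
      obtain ⟨hx, hy, -⟩ := ratMap_of_regular hψ hψt
      obtain ⟨X, hX, hX'⟩ := hT.exists_eq_comp hx fun Q hQ =>
        Eventually.of_forall fun P => by simp only [hψinv Q hQ]
      obtain ⟨Y, hY, hY'⟩ := hT.exists_eq_comp hy fun Q hQ =>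
        Eventually.of_forall fun P => by simp only [hψinv Q hQ]
      have push : ∀ {p : _ → Prop}, (∀ᶠ P in cofinite, p (hT.hom P)) →
          ∀ᶠ S in cofinite, p S := by
        intro p hp
        have hfin : {P | ¬ p (hT.hom P)}.Finite := hp
        refine (hfin.image hT.hom).subset fun S hS => ?_
        obtain ⟨P, rfl⟩ := hT.hom_surjective S
        exact ⟨P, hS, rfl⟩
      refine isRegularMap_of_ratMap ⟨hX.congr ?_, hY.congr ?_, ?_⟩
      · refine push (p := fun S => X S = xc (χ S)) ?_
        filter_upwards [hX'] with P h
        rw [hχ', h]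
      · refine push (p := fun S => Y S = yc (χ S)) ?_
        filter_upwards [hY'] with P h
        rw [hχ', h]
      · refine push (p := fun S => χ S ≠ 0) ?_
        filter_upwards [hψ0] with P h
        rwa [hχ']
    · push Not at h0
      have : (fun S => χ S) = fun _ => 0 := by
        funext S
        obtain ⟨P, rfl⟩ := hT.hom_surjective S
        rw [hχ', h0]
      rw [this]
      exact isRegularMap_zero
  · rw [← AddMonoidHom.cancel_right hT.hom_surjective, hχ, hχ''.2]

end IsQuotient

/-! ### Coprime polynomials and proportional triples -/

section Polynomials

variable {k : Type u} [Field k] [IsAlgClosed k]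

theorem isCoprime_of_no_common_root {a c : k[X]} (hc : c ≠ 0)
    (h : ∀ x, a.eval x = 0 → c.eval x ≠ 0) : IsCoprime a c := by
  obtain ⟨g, a', c', hg, ha, hc', hcop⟩ := exists_coprime_factors a hc
  have hdeg : g.degree = 0 := by
    by_contra hd
    obtain ⟨x, hx⟩ := IsAlgClosed.exists_root g hd
    have hx' : g.eval x = 0 := hx
    exact h x (by rw [ha, eval_mul, hx', zero_mul]) (by rw [hc', eval_mul, hx', zero_mul])
  have hu : IsUnit g := isUnit_iff_degree_eq_zero.mpr hdeg
  rw [ha, hc', isCoprime_mul_unit_left hu]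
  exact hcop

theorem exists_bezout_triple {p q w : k[X]} (hw : w ≠ 0)
    (h : ∀ x, p.eval x = 0 → q.eval x = 0 → w.eval x ≠ 0) :
    ∃ r s t : k[X], r * p + s * q + t * w = 1 := by
  obtain ⟨g, p', w', hg, hp, hw', ⟨u, v, huv⟩⟩ := exists_coprime_factors p hw
  obtain ⟨α, β, hαβ⟩ := isCoprime_of_no_common_root (a := q) hg fun x hq hgx =>
    h x (by rw [hp, eval_mul, hgx, zero_mul]) hq (by rw [hw', eval_mul, hgx, zero_mul])
  refine ⟨β * u, α, β * v, ?_⟩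
  rw [hp, hw']
  linear_combination hαβ + β * g * huv

/-- Two triples of polynomials that are proportional and without common zeros differ by a
constant. -/
theorem exists_const_of_proportional {p₁ p₂ p₃ q₁ q₂ q₃ : k[X]} (hp : p₃ ≠ 0) (hq : q₃ ≠ 0)
    (hp' : ∀ x, p₁.eval x = 0 → p₂.eval x = 0 → p₃.eval x ≠ 0)
    (hq' : ∀ x, q₁.eval x = 0 → q₂.eval x = 0 → q₃.eval x ≠ 0)
    (h₁ : q₃ * p₁ = q₁ * p₃) (h₂ : q₃ * p₂ = q₂ * p₃) :
    ∃ c : k, c ≠ 0 ∧ p₁ = Polynomial.C c * q₁ ∧ p₂ = Polynomial.C c * q₂ := by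
  obtain ⟨r, s, t, hrst⟩ := exists_bezout_triple hp hp'
  obtain ⟨r', s', t', hrst'⟩ := exists_bezout_triple hq hq'
  have hd : q₃ ∣ p₃ := ⟨r' * p₁ + s' * p₂ + t' * p₃, by
    linear_combination -p₃ * hrst' - r' * h₁ - s' * h₂⟩
  have hd' : p₃ ∣ q₃ := ⟨r * q₁ + s * q₂ + t * q₃, by
    linear_combination -q₃ * hrst + r * h₁ + s * h₂⟩
  obtain ⟨c, hc⟩ := associated_of_dvd_dvd hd hd'
  obtain ⟨e, he, he'⟩ := Polynomial.isUnit_iff.mp c.isUnit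
  rw [← he'] at hc
  refine ⟨e, he.ne_zero, ?_, ?_⟩
  · apply mul_left_cancel₀ hq
    rw [h₁, ← hc]
    ring
  · apply mul_left_cancel₀ hq
    rw [h₂, ← hc]
    ring

end Polynomials

/-! ### Addition and duplication formulas for the `x`-coordinate -/

section Multiplication

variable {k : Type u} [Field k] {W : Affine k}

theorem yc_neg {P : W.Point} (hP : P ≠ 0) : yc (-P) = -yc P - W.a₁ * xc P - W.a₃ := by
  cases P with
  | zero => exact absurd rfl hP
  | some x y h => rfl

variable [DecidableEq k]

/-- The sum and product of `x(P + R)` and `x(P - R)` are unchanged by `R ↦ -R`, so the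
`y`-coordinates drop out. With `P` replaced by `(n + 1)P` and `R` by `P`, this is the recursion for
`x(nP)`. -/
theorem xc_add_xc_sub {P R : W.Point} (hP : P ≠ 0) (hR : R ≠ 0) (h : xc P ≠ xc R) :
    (xc P - xc R) ^ 2 * (xc (P + R) + xc (P - R)) =
      2 * (xc P + xc R) * (xc P * xc R) + W.b₂ * (xc P * xc R) + W.b₄ * (xc P + xc R) + W.b₆ ∧
    (xc P - xc R) ^ 2 * (xc (P + R) * xc (P - R)) =
      (xc P * xc R) ^ 2 - W.b₄ * (xc P * xc R) - W.b₆ * (xc P + xc R) - W.b₈ := by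
  obtain ⟨-, h1, -⟩ := xc_add_ne hP hR h
  obtain ⟨-, h2, -⟩ := xc_add_ne hP (neg_ne_zero.mpr hR) (by rwa [xc_neg])
  have e1 := equation_of_ne_zero hP
  have e2 := equation_of_ne_zero hR
  rw [xc_neg, yc_neg hR] at h2
  rw [sub_eq_add_neg P R, h1, h2]
  have h0 : xc P - xc R ≠ 0 := sub_ne_zero.mpr h
  simp only [b₂, b₄, b₆, b₈]
  generalize xc P = x at *
  generalize yc P = y at *
  generalize xc R = x' at *
  generalize yc R = y' at *
  constructor
  · field_simp
    linear_combination 2 * e1 + 2 * e2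
  · field_simp
    linear_combination (-x ^ 3 + 2 * x ^ 2 * x' - x ^ 2 * W.a₂ + x * y * W.a₁ + 2 * x * x' ^ 2
      + x * x' * W.a₁ ^ 2 + 4 * x * x' * W.a₂ + x * W.a₁ * W.a₃ + x * W.a₄ + y ^ 2 + y * W.a₃
      - 2 * x' ^ 3 - x' ^ 2 * W.a₁ ^ 2 - 2 * x' ^ 2 * W.a₂ - 2 * x' * y' * W.a₁
      - x' * W.a₁ * W.a₃ - 2 * y' ^ 2 - 2 * y' * W.a₃ + W.a₆) * e1
      + (-4 * x ^ 3 + 2 * x ^ 2 * x' - x ^ 2 * W.a₁ ^ 2 - 4 * x ^ 2 * W.a₂ + 2 * x * x' ^ 2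
      + x * x' * W.a₁ ^ 2 + 4 * x * x' * W.a₂ - x * W.a₁ * W.a₃ - 2 * x * W.a₄ - x' ^ 3
      - x' ^ 2 * W.a₂ + x' * y' * W.a₁ + x' * W.a₁ * W.a₃ + x' * W.a₄ + y' ^ 2 + y' * W.a₃
      - W.a₆) * e2

theorem xc_two_nsmul [NeZero (2 : k)] {P : W.Point} (hP : P ≠ 0) (h : ηc P ≠ 0) :
    2 • P ≠ 0 ∧ W.Ψ₂Sq.eval (xc P) * xc (2 • P) =
      xc P ^ 4 - W.b₄ * xc P ^ 2 - 2 * W.b₆ * xc P - W.b₈ := by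
  rw [← ηc_sq hP]
  cases P with
  | zero => exact absurd rfl hP
  | some x y hxy =>
    have e := (W.equation_iff x y).mp hxy.1
    have hη : y - W.negY x y = ηc (.some x y hxy) := by
      simp only [Affine.negY, ηc]
      ring
    have hy : y ≠ W.negY x y := fun h' => h (by rw [← hη, sub_eq_zero]; exact h')
    rw [two_nsmul, Affine.Point.add_self_of_Y_ne hy]
    refine ⟨Affine.Point.some_ne_zero _, ?_⟩
    rw [xc_some, xc_some, Affine.addX, Affine.slope_of_Y_ne rfl hy, hη]
    field_simp
    simp only [ηc, b₄, b₆, b₈]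
    linear_combination (-8 * x - W.a₁ ^ 2 - 4 * W.a₂) * e

end Multiplication

/-! ### The degree `n²` of multiplication by `n` -/

section MulX

variable {k : Type u} [Field k] [DecidableEq k]

/-- The rational function `a / b`, in lowest terms, expresses the `x`-coordinate of `n • P` in terms
of that of `P`. -/
structure MulX (W : Affine k) (n : ℕ) (a b : k[X]) : Prop where
  coprime : IsCoprime a b
  denom_ne_zero : b ≠ 0
  natDegree_num : a.natDegree = n ^ 2
  natDegree_denom : b.natDegree < n ^ 2
  eventually : ∀ᶠ P : W.Point in cofinite, n • P ≠ 0 ∧ b.eval (xc P) * xc (n • P) = a.eval (xc P)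

/-- With `s = xx'`, `t = x + x'`, `u = 1` the three forms are, up to sign, the numerators and
denominator of `xc_add_xc_sub`. That they have no common zero prevents cancellation in the
recursion, which makes the degrees exact. -/
theorem addSub_ne_zero (W : Affine k) [W.IsElliptic] {s t u : k}
    (h₁ : s ^ 2 - W.b₄ * s * u - W.b₆ * t * u - W.b₈ * u ^ 2 = 0)
    (h₂ : 2 * t * s + W.b₂ * s * u + W.b₄ * t * u + W.b₆ * u ^ 2 = 0)
    (h₃ : t ^ 2 - 4 * s * u = 0) : s = 0 ∧ t = 0 ∧ u = 0 := by
  by_contra hne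
  have hx : ![s, t, u] ≠ 0 := fun h => hne ⟨congrFun h 0, congrFun h 1, congrFun h 2⟩
  refine addSubMap_ne_zero W hx (funext fun i => ?_)
  fin_cases i <;> simp [addSubMap, h₁, h₂, h₃]

theorem mulX_one (W : Affine k) [W.IsElliptic] : MulX W 1 Polynomial.X 1 where
  coprime := isCoprime_one_right
  denom_ne_zero := one_ne_zero
  natDegree_num := by simp
  natDegree_denom := by simp
  eventually := (eventually_ne 0).mono fun P hP => by simpa using hP

variable [NeZero (2 : k)] [IsAlgClosed k] {W : Affine k} [W.IsElliptic]

theorem mulX_two (W : Affine k) [W.IsElliptic] :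
    MulX W 2 (Polynomial.X ^ 4 - Polynomial.C W.b₄ * Polynomial.X ^ 2
      - Polynomial.C (2 * W.b₆) * Polynomial.X - Polynomial.C W.b₈) W.Ψ₂Sq where
  coprime := isCoprime_of_no_common_root twoTorsion_ne_zero fun x h₁ h₂ => by
    refine one_ne_zero (addSub_ne_zero W (s := x ^ 2) (t := 2 * x) (u := 1) ?_ ?_ ?_).2.2
    · simp only [eval_sub, eval_pow, eval_mul, eval_X, eval_C] at h₁
      linear_combination h₁
    · simp only [WeierstrassCurve.Ψ₂Sq, eval_add, eval_pow, eval_mul, eval_X, eval_C] at h₂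
      linear_combination h₂
    · ring
  denom_ne_zero := twoTorsion_ne_zero
  natDegree_num := by compute_degree!
  natDegree_denom := by rw [natDegree_twoTorsion]; norm_num
  eventually := by
    filter_upwards [eventually_ne 0, eventually_ηc_ne_zero] with P hP hη
    obtain ⟨h, h'⟩ := xc_two_nsmul hP hη
    refine ⟨h, h'.trans ?_⟩
    simp

/-- `(T₁ : T₂ : T₃)` encodes product and sum of `x((n+2)P)` and `x(nP)`, as does `(a'a₀ : a'b₀ +
a₀b' : b'b₀)`. Both triples are free of common zeros, so they differ by a constant. Then `deg a' +
n² = deg T₁ = 2(n+1)² + 2`, that is `deg a' = (n+2)²`, and the bound on `deg T₂` controls `b'`. -/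
theorem MulX.exists_succ {n : ℕ} (hn : 1 ≤ n) {a b a₀ b₀ : k[X]} (h₀ : MulX W n a₀ b₀)
    (h : MulX W (n + 1) a b) : ∃ a' b', MulX W (n + 2) a' b' := by
  have hab : a - Polynomial.X * b ≠ 0 := fun h0 => by
    have hd : b ∣ a := ⟨Polynomial.X, by linear_combination h0⟩
    have hu : IsUnit b := h.coprime.symm.isUnit_of_dvd' dvd_rfl hd
    have := congrArg natDegree (sub_eq_zero.mp h0)
    rw [h.natDegree_num, natDegree_mul X_ne_zero h.denom_ne_zero, natDegree_X,
      natDegree_eq_zero_of_isUnit hu] at this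
    nlinarith
  obtain ⟨T₁, hT₁⟩ : ∃ T, T = (a * Polynomial.X) ^ 2
      - Polynomial.C W.b₄ * (a * Polynomial.X) * b
      - Polynomial.C W.b₆ * (a + Polynomial.X * b) * b - Polynomial.C W.b₈ * b ^ 2 := ⟨_, rfl⟩
  obtain ⟨T₂, hT₂⟩ : ∃ T, T = 2 * (a + Polynomial.X * b) * (a * Polynomial.X)
      + Polynomial.C W.b₂ * (a * Polynomial.X) * b
      + Polynomial.C W.b₄ * (a + Polynomial.X * b) * b + Polynomial.C W.b₆ * b ^ 2 := ⟨_, rfl⟩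
  obtain ⟨T₃, hT₃⟩ : ∃ T, T = (a - Polynomial.X * b) ^ 2 := ⟨_, rfl⟩
  have hT₃0 : T₃ ≠ 0 := hT₃ ▸ pow_ne_zero _ hab
  have hT : ∀ x, T₁.eval x = 0 → T₂.eval x = 0 → T₃.eval x ≠ 0 := by
    intro x h₁ h₂ h₃
    subst hT₁ hT₂ hT₃
    simp only [eval_add, eval_sub, eval_pow, eval_mul, eval_X, eval_C, eval_ofNat] at h₁ h₂ h₃
    obtain ⟨h1, h2, h3⟩ := addSub_ne_zero W (s := a.eval x * x) (t := a.eval x + x * b.eval x)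
      (u := b.eval x) h₁ h₂ (by linear_combination h₃)
    obtain ⟨r, s, hrs⟩ := h.coprime
    have := congrArg (eval x) hrs
    rw [h3, mul_zero, add_zero] at h2
    simp [h2, h3] at this
  -- The new fraction is `T₂ / T₃ - a₀ / b₀`, the sum of the two `x`-coordinates minus the known
  -- one, in lowest terms.
  obtain ⟨g, a', b', hg, ha', hb', hcop⟩ :=
    exists_coprime_factors (T₂ * b₀ - a₀ * T₃) (mul_ne_zero h₀.denom_ne_zero hT₃0)
  have hb'0 : b' ≠ 0 := fun h0 => mul_ne_zero h₀.denom_ne_zero hT₃0 (by rw [hb', h0, mul_zero])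
  have hev : ∀ᶠ P : W.Point in cofinite, (n + 2) • P ≠ 0 ∧
      b'.eval (xc P) * xc ((n + 2) • P) = a'.eval (xc P) ∧
      T₃.eval (xc P) * (xc ((n + 2) • P) * xc (n • P)) = T₁.eval (xc P) ∧
      T₃.eval (xc P) * (xc ((n + 2) • P) + xc (n • P)) = T₂.eval (xc P) := by
    filter_upwards [eventually_ne 0, h₀.eventually, h.eventually,
      eventually_eval_xc_ne_zero h.denom_ne_zero, eventually_eval_xc_ne_zero h₀.denom_ne_zero,
      eventually_eval_xc_ne_zero hab, eventually_eval_xc_ne_zero hg] with P hP h1 h2 hb hb₀ hne hgx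
    have hx : xc ((n + 1) • P) ≠ xc P := fun h0 => hne (by
      simp only [eval_sub, eval_mul, eval_X]
      rw [← h2.2, h0]
      ring)
    have e : (n + 1) • P + P = (n + 2) • P := (succ_nsmul P (n + 1)).symm
    have e' : (n + 1) • P - P = n • P := by rw [succ_nsmul, add_sub_cancel_right]
    obtain ⟨hs, hp⟩ := xc_add_xc_sub h2.1 hP hx
    have hne' := (xc_add_ne h2.1 hP hx).1
    rw [e, e'] at hs hp
    rw [e] at hne'
    have hp' : T₃.eval (xc P) * (xc ((n + 2) • P) * xc (n • P)) = T₁.eval (xc P) := by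
      rw [hT₁, hT₃]
      simp only [eval_add, eval_sub, eval_pow, eval_mul, eval_X, eval_C]
      rw [← h2.2]
      linear_combination b.eval (xc P) ^ 2 * hp
    have hs' : T₃.eval (xc P) * (xc ((n + 2) • P) + xc (n • P)) = T₂.eval (xc P) := by
      rw [hT₂, hT₃]
      simp only [eval_add, eval_sub, eval_pow, eval_mul, eval_X, eval_C, eval_ofNat]
      rw [← h2.2]
      linear_combination b.eval (xc P) ^ 2 * hs
    refine ⟨hne', ?_, hp', hs'⟩
    apply mul_left_cancel₀ hgx
    have ea := congrArg (eval (xc P)) ha'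
    have eb := congrArg (eval (xc P)) hb'
    simp only [eval_mul, eval_sub] at ea eb
    linear_combination ea - xc ((n + 2) • P) * eb + b₀.eval (xc P) * hs'
      - T₃.eval (xc P) * h1.2
  have heq : ∀ f : k[X], (∀ᶠ P : W.Point in cofinite, f.eval (xc P) = 0) → f = 0 :=
    fun f hf => eq_zero_of_frequently_eval_xc hf.frequently
  obtain ⟨c, hc, hc₁, hc₂⟩ := exists_const_of_proportional (p₁ := T₁) (p₂ := T₂) (p₃ := T₃)
    (q₁ := a' * a₀) (q₂ := a' * b₀ + a₀ * b') (q₃ := b' * b₀) hT₃0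
    (mul_ne_zero hb'0 h₀.denom_ne_zero) hT
    (by
      intro x h1 h2 h3
      obtain ⟨r, s, hrs⟩ := hcop
      obtain ⟨r', s', hrs'⟩ := h₀.coprime
      have e := congrArg (eval x) hrs
      have e' := congrArg (eval x) hrs'
      simp only [eval_add, eval_mul, eval_one] at h1 h2 h3 e e'
      grind)
    (sub_eq_zero.mp <| heq _ <| by
      filter_upwards [hev, h₀.eventually] with P h1 h2
      simp only [eval_sub, eval_mul]
      rw [← h1.2.2.1, ← h1.2.1, ← h2.2]
      ring)
    (sub_eq_zero.mp <| heq _ <| by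
      filter_upwards [hev, h₀.eventually] with P h1 h2
      simp only [eval_sub, eval_mul, eval_add]
      rw [← h1.2.2.2, ← h1.2.1, ← h2.2]
      ring)
  have ha0 : a ≠ 0 := fun h0 => by
    have := h.natDegree_num
    rw [h0, natDegree_zero] at this
    nlinarith
  have ha₀0 : a₀ ≠ 0 := fun h0 => by
    have := h₀.natDegree_num
    rw [h0, natDegree_zero] at this
    nlinarith
  have dX : (Polynomial.X : k[X]).natDegree = 1 := natDegree_X
  have da := h.natDegree_num
  have db := h.natDegree_denom
  have dXb : (Polynomial.X * b).natDegree ≤ (n + 1) ^ 2 :=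
    natDegree_mul_le.trans (by rw [dX]; omega)
  have dab : (a + Polynomial.X * b).natDegree ≤ (n + 1) ^ 2 :=
    (natDegree_add_le _ _).trans (max_le da.le dXb)
  have daX : (a * Polynomial.X).natDegree = (n + 1) ^ 2 + 1 := by
    rw [natDegree_mul ha0 X_ne_zero, da, dX]
  have dC : ∀ (r : k) (f : k[X]), (Polynomial.C r * f).natDegree ≤ f.natDegree :=
    fun r f => natDegree_C_mul_le r f
  have d1 : (Polynomial.C W.b₄ * (a * Polynomial.X) * b).natDegree ≤ 2 * (n + 1) ^ 2 :=
    natDegree_mul_le.trans (by have := dC W.b₄ (a * Polynomial.X); omega)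
  have d2 : ∀ r, (Polynomial.C r * (a + Polynomial.X * b) * b).natDegree ≤ 2 * (n + 1) ^ 2 :=
    fun r => natDegree_mul_le.trans (by have := dC r (a + Polynomial.X * b); omega)
  have d3 : ∀ r, (Polynomial.C r * b ^ 2).natDegree ≤ 2 * (n + 1) ^ 2 :=
    fun r => (dC _ _).trans (natDegree_pow_le.trans (by omega))
  have dT₁ : T₁.natDegree = 2 * (n + 1) ^ 2 + 2 := by
    have e : ((a * Polynomial.X) ^ 2).natDegree = 2 * (n + 1) ^ 2 + 2 := by
      rw [natDegree_pow, daX]; ring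
    rw [hT₁, sub_sub, sub_sub, natDegree_sub_eq_left_of_natDegree_lt, e]
    rw [e]
    refine (natDegree_add_le _ _).trans_lt (max_lt (by omega) ?_)
    refine (natDegree_add_le _ _).trans_lt (max_lt ?_ ?_)
    · have := d2 W.b₆; omega
    · have := d3 W.b₈; omega
  have dT₂ : T₂.natDegree ≤ 2 * (n + 1) ^ 2 + 1 := by
    rw [hT₂]
    refine (natDegree_add_le _ _).trans (max_le ((natDegree_add_le _ _).trans
      (max_le ((natDegree_add_le _ _).trans (max_le ?_ ?_)) ?_)) ?_)
    · have := dC 2 (a + Polynomial.X * b)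
      exact natDegree_mul_le.trans (by
        rw [show (2 : k[X]) = Polynomial.C 2 from rfl]
        omega)
    · exact natDegree_mul_le.trans (by have := dC W.b₂ (a * Polynomial.X); omega)
    · have := d2 W.b₄; omega
    · have := d3 W.b₆; omega
  have ha'0 : a' ≠ 0 := fun h0 => by
    rw [hc₁, h0, zero_mul, mul_zero, natDegree_zero] at dT₁
    omega
  have da₀ := h₀.natDegree_num
  have db₀ := h₀.natDegree_denom
  have da' : a'.natDegree = (n + 2) ^ 2 := by
    rw [hc₁, natDegree_C_mul hc, natDegree_mul ha'0 ha₀0, da₀] at dT₁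
    nlinarith
  refine ⟨a', b', hcop, hb'0, da', ?_, hev.mono fun P hP => ⟨hP.1, hP.2.1⟩⟩
  have e1 : (a' * b₀ + a₀ * b').natDegree ≤ 2 * (n + 1) ^ 2 + 1 := by
    rwa [hc₂, natDegree_C_mul hc] at dT₂
  have e2 : (a' * b₀).natDegree ≤ 2 * (n + 1) ^ 2 + 1 := by
    refine natDegree_mul_le.trans ?_
    rw [da']
    nlinarith
  have e3 : (a₀ * b').natDegree ≤ 2 * (n + 1) ^ 2 + 1 := by
    have : a₀ * b' = (a' * b₀ + a₀ * b') - a' * b₀ := by ring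
    rw [this]
    exact (natDegree_sub_le _ _).trans (max_le e1 e2)
  rw [natDegree_mul ha₀0 hb'0, da₀] at e3
  nlinarith

theorem exists_mulX (W : Affine k) [W.IsElliptic] {n : ℕ} (hn : 1 ≤ n) : ∃ a b, MulX W n a b := by
  suffices H : ∀ n, (∃ a b, MulX W (n + 1) a b) ∧ ∃ a b, MulX W (n + 2) a b by
    obtain ⟨m, rfl⟩ := Nat.exists_eq_add_of_le' hn
    exact (H m).1
  intro n
  induction n with
  | zero => exact ⟨⟨_, _, mulX_one W⟩, _, _, mulX_two W⟩
  | succ n ih =>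
    obtain ⟨⟨a₀, b₀, h₀⟩, a, b, h⟩ := ih
    exact ⟨⟨a, b, h⟩, h₀.exists_succ (Nat.le_add_left 1 n) h⟩

end MulX

/-! ### Counting fibres: kernel and degree -/

section Fibres

variable {k : Type u} [Field k]

theorem eval_ne_zero_of_isCoprime {a b : k[X]} (h : IsCoprime a b) {x : k} (hb : b.eval x = 0) :
    a.eval x ≠ 0 := fun ha => by
  obtain ⟨r, s, hrs⟩ := h
  have := congrArg (eval x) hrs
  simp [ha, hb] at this

variable [DecidableEq k] {W W' : Affine k}

/-- The rational function `a / b`, in lowest terms, expresses the `x`-coordinate of `φ P` in terms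
of that of `P`. -/
structure XMap (φ : W.Point →+ W'.Point) (a b : k[X]) : Prop where
  coprime : IsCoprime a b
  denom_ne_zero : b ≠ 0
  natDegree_lt : b.natDegree < a.natDegree
  eventually : ∀ᶠ P in cofinite, φ P ≠ 0 ∧ b.eval (xc P) * xc (φ P) = a.eval (xc P)

theorem MulX.xMap {n : ℕ} {a b : k[X]} (h : MulX W n a b) :
    XMap (nsmulAddMonoidHom (α := W.Point) n) a b where
  coprime := h.coprime
  denom_ne_zero := h.denom_ne_zero
  natDegree_lt := h.natDegree_num ▸ h.natDegree_denom
  eventually := h.eventually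

theorem XMap.natDegree_sub {φ : W.Point →+ W'.Point} {a b : k[X]} (h : XMap φ a b) (x : k) :
    (a - Polynomial.C x * b).natDegree = a.natDegree :=
  natDegree_sub_eq_left_of_natDegree_lt ((natDegree_C_mul_le x b).trans_lt h.natDegree_lt)

theorem card_fibre (φ : W.Point →+ W'.Point) (P₀ : W.Point) :
    Nat.card {P // φ P = φ P₀} = Nat.card φ.ker :=
  Nat.card_congr
    { toFun := fun P => ⟨P.1 - P₀, by rw [AddMonoidHom.mem_ker, map_sub, P.2, sub_self]⟩
      invFun := fun P => ⟨P.1 + P₀, by rw [map_add, P.2, zero_add]⟩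
      left_inv := fun P => by simp
      right_inv := fun P => by simp }

theorem XMap.tendsto {φ : W.Point →+ W'.Point} {a b : k[X]} (h : XMap φ a b) :
    Tendsto φ cofinite cofinite :=
  tendsto_of_eventually_ne_zero (h.eventually.mono fun _ hP => hP.1)

variable [NeZero (2 : k)]

theorem injOn_xc_fibre (φ : W.Point →+ W'.Point) {R : W'.Point} (hR : R ≠ 0) (hη : ηc R ≠ 0)
    {P Q : W.Point} (hP : φ P = R) (hQ : φ Q = R) (h : xc P = xc Q) : P = Q := by
  have hP0 : P ≠ 0 := fun h0 => hR (by rw [← hP, h0, map_zero])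
  have hQ0 : Q ≠ 0 := fun h0 => hR (by rw [← hQ, h0, map_zero])
  refine (eq_or_eq_neg_of_xc_eq hP0 hQ0 h).resolve_right fun hneg => hη ?_
  have h1 : R = -R := by rw [← hQ, ← map_neg, ← hneg, hP, hQ]
  have h2 : ηc R = -ηc R := by rw [← ηc_neg, ← h1]
  have h3 : (2 : k) * ηc R = 0 := by linear_combination h2
  exact (mul_eq_zero.mp h3).resolve_left (NeZero.ne 2)

/-- For generic `R` the points over `±R` are exactly those whose `x`-coordinate is a root of `a -
x(R) b`. Each `x` is a root for only one value of `x(R)` because `a` and `b` are coprime, so any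
finite set `Z` can be avoided. -/
theorem XMap.eventually_fibre {φ : W.Point →+ W'.Point} {a b : k[X]} (h : XMap φ a b) {Z : Set k}
    (hZ : Z.Finite) : ∀ᶠ R : W'.Point in cofinite, R ≠ 0 ∧ ηc R ≠ 0 ∧
      (∀ x ∈ Z, (a - Polynomial.C (xc R) * b).eval x ≠ 0) ∧
      (∀ P, φ P = R → (a - Polynomial.C (xc R) * b).eval (xc P) = 0) ∧
      ∀ P, (a - Polynomial.C (xc R) * b).eval (xc P) = 0 → φ P ≠ 0 ∧ xc (φ P) = xc R := by
  have hfin : {P | ¬(φ P ≠ 0 ∧ b.eval (xc P) * xc (φ P) = a.eval (xc P))}.Finite := h.eventually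
  set B := {P | ¬(φ P ≠ 0 ∧ b.eval (xc P) * xc (φ P) = a.eval (xc P))} with hB
  have hne : ∀ x : k, Polynomial.C (a.eval x) - Polynomial.C (b.eval x) * Polynomial.X ≠ 0 := by
    intro x h0
    have h1 := congrArg (coeff · 1) h0
    have h2 := congrArg (coeff · 0) h0
    simp [coeff_C] at h1 h2
    exact eval_ne_zero_of_isCoprime h.coprime h1 h2
  have hev : ∀ Y : Set k, Y.Finite → ∀ᶠ R : W'.Point in cofinite,
      ∀ x ∈ Y, (a - Polynomial.C (xc R) * b).eval x ≠ 0 := by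
    intro Y hY
    rw [eventually_all_finite hY]
    intro x _
    filter_upwards [eventually_eval_xc_ne_zero (hne x)] with R hR
    rw [eval_sub, eval_mul, eval_C, eval_C, eval_X] at hR
    rwa [eval_sub, eval_mul, eval_C, mul_comm]
  filter_upwards [eventually_ne 0, eventually_ηc_ne_zero, hev Z hZ, hev _ (hfin.image xc),
    (hfin.image φ).eventually_cofinite_notMem] with R h1 h2 h3 h4 h5
  refine ⟨h1, h2, h3, fun P hP => ?_, fun P hP => ?_⟩
  · have hPB : P ∉ B := fun hPB => h5 ⟨P, hPB, hP⟩
    rw [hB, Set.mem_ofPred_eq, not_not] at hPB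
    rw [eval_sub, eval_mul, eval_C, ← hPB.2, hP]
    ring
  · have hPB : P ∉ B := fun hPB => h4 _ ⟨P, hPB, rfl⟩ hP
    rw [hB, Set.mem_ofPred_eq, not_not] at hPB
    refine ⟨hPB.1, ?_⟩
    rw [eval_sub, eval_mul, eval_C, ← hPB.2] at hP
    have hb : b.eval (xc P) ≠ 0 := fun hb =>
      eval_ne_zero_of_isCoprime h.coprime hb (by rw [← hPB.2, hb, zero_mul])
    exact mul_left_cancel₀ hb (by linear_combination hP)

variable [IsAlgClosed k] [W.IsElliptic]

theorem XMap.card_ker_le {φ : W.Point →+ W'.Point} {a b : k[X]} (h : XMap φ a b) :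
    Nat.card φ.ker ≤ a.natDegree := by
  obtain ⟨P₀, h1, h2, -, h4, -⟩ :=
    (h.tendsto.eventually (h.eventually_fibre Set.finite_empty)).exists
  set f := a - Polynomial.C (xc (φ P₀)) * b with hf
  have hf0 : f ≠ 0 := fun h0 => by
    have := h.natDegree_sub (xc (φ P₀))
    rw [← hf, h0, natDegree_zero] at this
    have := h.natDegree_lt
    omega
  rw [← card_fibre φ P₀, ← h.natDegree_sub (xc (φ P₀)), ← hf]
  refine le_trans ?_ (card_roots' f)
  refine le_trans ?_ (Multiset.toFinset_card_le f.roots)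
  have hinj : Function.Injective (fun P : {P // φ P = φ P₀} =>
      (⟨xc P.1, by simpa [hf0] using h4 P.1 P.2⟩ : f.roots.toFinset)) := fun P Q hPQ =>
    Subtype.ext (injOn_xc_fibre φ h1 h2 P.2 Q.2 (congrArg Subtype.val hPQ))
  have hle := Nat.card_le_card_of_injective _ hinj
  rwa [Nat.card_eq_fintype_card (α := f.roots.toFinset), Fintype.card_coe] at hle

/-- A multiple root of `a - x(R) b` is a zero of the Wronskian `a'b - ab'`. This polynomial is
nonzero, as otherwise `a` would divide its nonzero derivative; so a generic `R` gives `deg a`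
distinct roots, matching the points of one fibre. -/
theorem XMap.card_ker {φ : W.Point →+ W'.Point} {a b : k[X]} (h : XMap φ a b)
    (ha : derivative a ≠ 0) : Nat.card φ.ker = a.natDegree := by
  have hw : derivative a * b - a * derivative b ≠ 0 := fun h0 => by
    have hd : a ∣ derivative a := h.coprime.dvd_of_dvd_mul_right ⟨derivative b, by
      linear_combination h0⟩
    have hle := natDegree_le_of_dvd hd ha
    have hlt := natDegree_derivative_lt (p := a) (by have := h.natDegree_lt; omega)
    omega
  obtain ⟨P₀, h1, h2, h3, h4, h5⟩ :=
    (h.tendsto.eventually (h.eventually_fibre (finite_setOfPred_isRoot hw))).exists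
  set f := a - Polynomial.C (xc (φ P₀)) * b with hf
  have hdeg := h.natDegree_sub (xc (φ P₀))
  rw [← hf] at hdeg
  have hlt := h.natDegree_lt
  have hf0 : f ≠ 0 := fun h0 => by
    rw [h0, natDegree_zero] at hdeg
    omega
  have hsep : f.Separable := (isCoprime_of_no_common_root hf0 fun x hx' hx => by
    refine h3 x ?_ hx
    rw [hf] at hx hx'
    simp only [derivative_sub, derivative_C_mul, eval_sub, eval_mul, eval_C] at hx hx'
    change eval x _ = 0
    simp only [eval_sub, eval_mul]
    linear_combination b.eval x * hx' - (derivative b).eval x * hx).symm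
  have hcard : f.roots.toFinset.card = a.natDegree := by
    rw [Multiset.toFinset_card_of_nodup (nodup_roots hsep), IsAlgClosed.card_roots_eq_natDegree,
      hdeg]
  have hbij : Function.Bijective (fun P : {P // φ P = φ P₀} =>
      (⟨xc P.1, by simpa [hf0] using h4 P.1 P.2⟩ : f.roots.toFinset)) := by
    refine ⟨fun P Q hPQ =>
      Subtype.ext (injOn_xc_fibre φ h1 h2 P.2 Q.2 (congrArg Subtype.val hPQ)), fun ⟨x, hx⟩ => ?_⟩
    have hx' : f.eval x = 0 := by simpa [hf0] using hx
    obtain ⟨P, hP, rfl⟩ := exists_point_of_xc (W := W) x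
    obtain ⟨hne, he⟩ := h5 P hx'
    rcases eq_or_eq_neg_of_xc_eq hne h1 he with he | he
    · exact ⟨⟨P, he⟩, rfl⟩
    · exact ⟨⟨-P, by rw [map_neg, he, neg_neg]⟩, Subtype.ext (xc_neg P)⟩
  rw [← card_fibre φ P₀, Nat.card_congr (Equiv.ofBijective _ hbij), ← hcard,
    Nat.card_eq_fintype_card, Fintype.card_coe]

/-- The image contains almost all points, and every point is a sum of two points of a cofinite set.
-/
theorem XMap.surjective [W'.IsElliptic] {φ : W.Point →+ W'.Point} {a b : k[X]} (h : XMap φ a b) :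
    Function.Surjective φ := by
  have hev : ∀ᶠ R : W'.Point in cofinite, R ∈ φ.range := by
    filter_upwards [h.eventually_fibre Set.finite_empty] with R ⟨h1, _, _, _, h5⟩
    have hd : (a - Polynomial.C (xc R) * b).degree ≠ 0 := fun hd => by
      have h0 : (a - Polynomial.C (xc R) * b).natDegree = 0 := natDegree_eq_of_degree_eq_some hd
      rw [h.natDegree_sub] at h0
      have := h.natDegree_lt
      omega
    obtain ⟨x, hx⟩ := IsAlgClosed.exists_root _ hd
    obtain ⟨P, hP, rfl⟩ := exists_point_of_xc (W := W) x
    obtain ⟨hne, he⟩ := h5 P hx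
    rcases eq_or_eq_neg_of_xc_eq hne h1 he with he | he
    · exact ⟨P, he⟩
    · exact ⟨-P, by rw [map_neg, he, neg_neg]⟩
  intro R
  have ht : Tendsto (fun S : W'.Point => R - S) cofinite cofinite :=
    (sub_right_injective (b := R)).tendsto_cofinite
  obtain ⟨S, h1, h2⟩ := (hev.and (ht.eventually hev)).exists
  have := φ.range.add_mem h2 h1
  rwa [sub_add_cancel] at this

end Fibres

/-! ### Torsion points and subgroups of order `p` -/

section Torsion

variable {k : Type u} [Field k] [DecidableEq k] [NeZero (2 : k)] [IsAlgClosed k]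

/-- Separability: the coefficient of `X ^ (n² - 1)` in the derivative of the numerator is `n²` times
its leading coefficient, nonzero in `k`. -/
theorem card_torsion (W : Affine k) [W.IsElliptic] {n : ℕ} (hn : (n : k) ≠ 0) :
    Nat.card (nsmulAddMonoidHom (α := W.Point) n).ker = n ^ 2 := by
  have hn1 : 1 ≤ n := Nat.one_le_iff_ne_zero.mpr fun h => hn (by rw [h, Nat.cast_zero])
  obtain ⟨a, b, h⟩ := exists_mulX W hn1
  rw [h.xMap.card_ker, h.natDegree_num]
  intro h0
  have hpos : 0 < n ^ 2 := by positivity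
  have hc := congrArg (coeff · (n ^ 2 - 1)) h0
  simp only [coeff_derivative, coeff_zero] at hc
  rw [Nat.sub_add_cancel hpos, ← h.natDegree_num, coeff_natDegree, h.natDegree_num,
    ← Nat.cast_succ, Nat.succ_eq_add_one, Nat.sub_add_cancel hpos] at hc
  have ha : a ≠ 0 := fun ha => by
    have := h.natDegree_num
    rw [ha, natDegree_zero] at this
    omega
  rcases mul_eq_zero.mp hc with hc | hc
  · exact ha (leadingCoeff_eq_zero.mp hc)
  · exact hn (by simpa using hc)

theorem nsmul_eq_zero_of_mem {A : Type*} [AddCommGroup A] {p : ℕ} {C : AddSubgroup A}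
    (hC : Nat.card C = p) {P : A} (hP : P ∈ C) : p • P = 0 := by
  have := card_nsmul_eq_zero' (G := C) (x := ⟨P, hP⟩)
  rw [hC] at this
  exact congrArg Subtype.val this

theorem eq_zmultiples_of_card_prime {A : Type*} [AddCommGroup A] {p : ℕ} [hp : Fact p.Prime]
    {C : AddSubgroup A} (hC : Nat.card C = p) {P : A} (hP : P ∈ C) (hP0 : P ≠ 0) :
    C = AddSubgroup.zmultiples P := by
  have : Finite C := Nat.finite_of_card_ne_zero (hC ▸ hp.out.ne_zero)
  refine (AddSubgroup.eq_of_le_of_card_ge (AddSubgroup.zmultiples_le_of_mem hP) ?_).symm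
  rw [Nat.card_zmultiples, addOrderOf_eq_prime (nsmul_eq_zero_of_mem hC hP) hP0, hC]

/-- Each nonzero point of `E[p]` generates the unique subgroup of order `p` containing it, so the
number `N` of subgroups satisfies `N(p - 1) = p² - 1`. -/
theorem card_subgroups (W : Affine k) [W.IsElliptic] {p : ℕ} [hp : Fact p.Prime]
    (hpk : (p : k) ≠ 0) : Nat.card {C : AddSubgroup W.Point // Nat.card C = p} = p + 1 := by
  let T := (nsmulAddMonoidHom (α := W.Point) p).ker
  have hT : Nat.card T = p ^ 2 := card_torsion W hpk
  have : Finite T := Nat.finite_of_card_ne_zero (by rw [hT]; exact pow_ne_zero _ hp.out.ne_zero)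
  have hcard : ∀ D : AddSubgroup W.Point, Finite D →
      Nat.card {P : D // P ≠ 0} = Nat.card D - 1 := by
    intro D _
    have := Fintype.ofFinite D
    classical
    rw [Nat.card_eq_fintype_card, Nat.card_eq_fintype_card, Fintype.card_subtype_compl]
    simp
  have e : (Σ C : {C : AddSubgroup W.Point // Nat.card C = p}, {P : C.1 // P ≠ 0}) ≃
      {P : T // P ≠ 0} := by
    refine Equiv.ofBijective (fun x => ⟨⟨x.2.1.1, nsmul_eq_zero_of_mem x.1.2 x.2.1.2⟩,
      fun h => x.2.2 (Subtype.ext (congrArg (fun z : T => (z : W.Point)) h))⟩) ⟨?_, ?_⟩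
    · rintro ⟨⟨C, hC⟩, ⟨P, hP⟩, hP0⟩ ⟨⟨C', hC'⟩, ⟨P', hP'⟩, hP0'⟩ h
      obtain rfl : P = P' := congrArg (fun z => (z.1.1 : W.Point)) h
      have hne : P ≠ 0 := fun h0 => hP0 (Subtype.ext h0)
      obtain rfl : C = C' := (eq_zmultiples_of_card_prime hC hP hne).trans
        (eq_zmultiples_of_card_prime hC' hP' hne).symm
      rfl
    · rintro ⟨⟨P, hP⟩, hP0⟩
      have hne : P ≠ 0 := fun h0 => hP0 (Subtype.ext h0)
      refine ⟨⟨⟨AddSubgroup.zmultiples P, ?_⟩, ⟨P, AddSubgroup.mem_zmultiples P⟩,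
        fun h0 => hne (congrArg Subtype.val h0)⟩, rfl⟩
      rw [Nat.card_zmultiples]
      exact addOrderOf_eq_prime hP hne
  have e' : ∀ C : {C : AddSubgroup W.Point // Nat.card C = p},
      Nonempty ({P : C.1 // P ≠ 0} ≃ Fin (p - 1)) := fun C => by
    have : Finite C.1 := Nat.finite_of_card_ne_zero (by rw [C.2]; exact hp.out.ne_zero)
    exact ⟨Finite.equivFinOfCardEq (by rw [hcard C.1 this, C.2])⟩
  have hc := Nat.card_congr e
  rw [Nat.card_congr (Equiv.sigmaEquivProdOfEquiv fun C => (e' C).some), Nat.card_prod,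
    Nat.card_fin, hcard T this, hT] at hc
  have h2 := hp.out.two_le
  obtain ⟨m, rfl⟩ := Nat.exists_eq_add_of_le h2
  refine Nat.eq_of_mul_eq_mul_right (show 0 < 2 + m - 1 by omega) (hc.trans ?_)
  rw [show 2 + m - 1 = m + 1 by omega]
  refine Nat.sub_eq_of_eq_add ?_
  ring

theorem ratMap_nsmul (W : Affine k) [W.IsElliptic] {n : ℕ} (hn : 1 ≤ n) :
    RatMap (fun P : W.Point => n • P) := by
  have h0 : ∀ {m : ℕ}, 1 ≤ m → ∀ᶠ P : W.Point in cofinite, m • P ≠ 0 := fun hm => by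
    obtain ⟨a, b, h⟩ := exists_mulX W hm
    exact h.eventually.mono fun P hP => hP.1
  have hid : RatMap (fun P : W.Point => P) := ⟨isRat_xc, isRat_yc, eventually_ne 0⟩
  induction n, hn using Nat.le_induction with
  | base => simpa using hid
  | succ n hn ih =>
    rcases hn.eq_or_lt with rfl | hn
    -- The chord formula does not apply to `P + P`. Doubling is written as `(P + R) + (P - R)` with
    -- `2R ≠ 0`, where the two terms generically have different `x`-coordinates.
    · obtain ⟨R, hR⟩ := (eventually_two_nsmul_ne (0 : W.Point)).exists
      have hadd : ∀ S : W.Point, RatMap (fun P : W.Point => P + S) := fun S =>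
        ratMap_of_regular (isRegularMap_add_right S) (add_left_injective S).tendsto_cofinite
      have hs := (hadd R).add (hadd (-R)) (by
        filter_upwards [eventually_two_nsmul_ne (0 : W.Point), eventually_ne (-R),
          eventually_ne R] with P hP h1 h2 h
        rcases eq_or_eq_neg_of_xc_eq (fun h0 => h1 (eq_neg_of_add_eq_zero_left h0))
          (fun h0 => h2 (by rw [eq_neg_of_add_eq_zero_left h0, neg_neg])) h with he | he
        · apply hR
          have := add_left_cancel he
          rw [two_nsmul]
          nth_rewrite 1 [this]
          exact neg_add_cancel R
        · apply hP
          rw [neg_add, neg_neg] at he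
          have := add_right_cancel he
          rw [two_nsmul]
          nth_rewrite 1 [this]
          exact neg_add_cancel P)
      have e : (fun P : W.Point => P + R + (P + -R)) = fun P => (1 + 1) • P := by
        funext P
        rw [two_nsmul]
        abel
      rwa [e] at hs
    · have hs := ih.add hid (by
        filter_upwards [h0 (m := n - 1) (by omega), h0 (m := n + 1) (by omega),
          h0 (m := n) (by omega), eventually_ne 0] with P h1 h2 h3 h4 h
        rcases eq_or_eq_neg_of_xc_eq h3 h4 h with he | he
        · apply h1
          have : (n - 1) • P + P = P := by rw [← succ_nsmul, Nat.sub_add_cancel (by omega), he]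
          simpa using this
        · apply h2
          rw [succ_nsmul, he, neg_add_cancel])
      simpa only [← succ_nsmul] using hs

theorem isRegularMap_nsmul (W : Affine k) [W.IsElliptic] {n : ℕ} (hn : 1 ≤ n) :
    IsRegularMap (fun P : W.Point => n • P) :=
  isRegularMap_of_ratMap (φ := nsmulAddMonoidHom (α := W.Point) n) (ratMap_nsmul W hn)

end Torsion

/-! ### Multiplicativity of the degree -/

section Composition

variable {k : Type u} [Field k]

/-- The numerator of `A(a / b)` over the denominator `b ^ d`. -/
noncomputable def substNum (A a b : k[X]) (d : ℕ) : k[X] :=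
  ∑ i ∈ Finset.range (d + 1), Polynomial.C (A.coeff i) * a ^ i * b ^ (d - i)

theorem eval_substNum {A : k[X]} (a b : k[X]) {d : ℕ} (hd : A.natDegree ≤ d) {x y : k}
    (h : b.eval x * y = a.eval x) :
    (substNum A a b d).eval x = b.eval x ^ d * A.eval y := by
  rw [substNum, eval_finsetSum, eval_eq_sum_range' (Nat.lt_succ_of_le hd), Finset.mul_sum]
  refine Finset.sum_congr rfl fun i hi => ?_
  have hi' : i ≤ d := Nat.lt_succ_iff.mp (Finset.mem_range.mp hi)
  simp only [eval_mul, eval_pow, eval_C]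
  rw [← h, ← Nat.sub_add_cancel hi', pow_add, Nat.sub_add_cancel hi']
  ring

theorem eval_substNum_of_eq_zero (A a : k[X]) {b : k[X]} (d : ℕ) {x : k} (h : b.eval x = 0) :
    (substNum A a b d).eval x = A.coeff d * a.eval x ^ d := by
  rw [substNum, Finset.sum_range_succ, eval_add, eval_finsetSum, Finset.sum_eq_zero]
  · simp
  · intro i hi
    have hi' : d - i ≠ 0 := by
      have := Finset.mem_range.mp hi
      omega
    simp [h, hi']

theorem natDegree_substNum {A a b : k[X]} (hA : 0 < A.natDegree) (h : b.natDegree < a.natDegree) :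
    (substNum A a b A.natDegree).natDegree = A.natDegree * a.natDegree := by
  set d := A.natDegree with hd
  have hA0 : A.coeff d ≠ 0 := by
    rw [hd, coeff_natDegree, leadingCoeff_ne_zero]
    rintro rfl
    simp [hd] at hA
  have htop : (Polynomial.C (A.coeff d) * a ^ d * b ^ (d - d)).natDegree = d * a.natDegree := by
    rw [Nat.sub_self, pow_zero, mul_one, natDegree_C_mul hA0, natDegree_pow]
  have hpos : 0 < d * a.natDegree := Nat.mul_pos hA (by omega)
  rw [substNum, Finset.sum_range_succ, natDegree_add_eq_right_of_natDegree_lt, htop]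
  rw [htop]
  refine lt_of_le_of_lt (natDegree_sum_le_of_forall_le (n := d * a.natDegree - 1) _ _ ?_)
    (by omega)
  intro i hi
  have hi' := Finset.mem_range.mp hi
  refine Nat.le_sub_one_of_lt ?_
  calc (Polynomial.C (A.coeff i) * a ^ i * b ^ (d - i)).natDegree
      ≤ i * a.natDegree + (d - i) * b.natDegree := by
        refine natDegree_mul_le.trans (add_le_add ?_ natDegree_pow_le)
        exact (natDegree_C_mul_le _ _).trans natDegree_pow_le
    _ < i * a.natDegree + (d - i) * a.natDegree :=
        Nat.add_lt_add_left (Nat.mul_lt_mul_of_pos_left h (by omega)) _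
    _ = d * a.natDegree := by rw [← add_mul, Nat.add_sub_cancel' hi'.le]

variable [DecidableEq k] [NeZero (2 : k)] [IsAlgClosed k] {W W' W'' : Affine k} [W.IsElliptic]

/-- Substituting the reduced fraction `a / b` into the reduced fraction `A / B` gives a reduced
fraction: a common zero is excluded separately where `b` vanishes and where it does not. Reduced
fractions for the same function have associated numerators. -/
theorem XMap.natDegree_comp {φ : W.Point →+ W'.Point} {ψ : W'.Point →+ W''.Point}
    {a b A B a' b' : k[X]} (hφ : XMap φ a b) (hψ : XMap ψ A B) (h : XMap (ψ.comp φ) a' b') :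
    a'.natDegree = A.natDegree * a.natDegree := by
  have hA : 0 < A.natDegree := lt_of_le_of_lt (Nat.zero_le _) hψ.natDegree_lt
  have hev : ∀ᶠ P : W.Point in cofinite, ψ (φ P) ≠ 0 ∧
      B.eval (xc (φ P)) * xc (ψ (φ P)) = A.eval (xc (φ P)) :=
    hφ.tendsto.eventually hψ.eventually
  obtain ⟨N, hN⟩ : ∃ N, N = substNum A a b A.natDegree := ⟨_, rfl⟩
  obtain ⟨D, hD⟩ : ∃ D, D = substNum B a b A.natDegree := ⟨_, rfl⟩
  have hroot : ∀ x, N.eval x = 0 → D.eval x ≠ 0 := by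
    intro x h1 h2
    rw [hN] at h1
    rw [hD] at h2
    by_cases hb : b.eval x = 0
    · rw [eval_substNum_of_eq_zero _ _ _ hb, coeff_natDegree] at h1
      refine mul_ne_zero (leadingCoeff_ne_zero.mpr ?_)
        (pow_ne_zero _ (eval_ne_zero_of_isCoprime hφ.coprime hb)) h1
      rintro rfl
      simp at hA
    · have hy : b.eval x * (a.eval x / b.eval x) = a.eval x := mul_div_cancel₀ _ hb
      rw [eval_substNum a b le_rfl hy] at h1
      rw [eval_substNum a b hψ.natDegree_lt.le hy] at h2
      have hbd := pow_ne_zero A.natDegree hb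
      exact eval_ne_zero_of_isCoprime hψ.coprime ((mul_eq_zero.mp h2).resolve_left hbd)
        ((mul_eq_zero.mp h1).resolve_left hbd)
  have hDeq : ∀ᶠ P : W.Point in cofinite,
      D.eval (xc P) = b.eval (xc P) ^ A.natDegree * B.eval (xc (φ P)) := by
    filter_upwards [hφ.eventually] with P hP
    rw [hD]
    exact eval_substNum a b hψ.natDegree_lt.le hP.2
  have hD0 : D ≠ 0 := by
    rintro rfl
    obtain ⟨P, h1, h2, h4⟩ := (hDeq.and ((eventually_eval_xc_ne_zero hφ.denom_ne_zero).and
      (hφ.tendsto.eventually (eventually_eval_xc_ne_zero hψ.denom_ne_zero)))).exists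
    exact mul_ne_zero (pow_ne_zero _ h2) h4 (by rw [← h1, eval_zero])
  have hdeg : N.natDegree = A.natDegree * a.natDegree := by
    rw [hN, natDegree_substNum hA hφ.natDegree_lt]
  rw [← hdeg]
  have hcop : IsCoprime N D := isCoprime_of_no_common_root hD0 hroot
  have e : a' * D = N * b' := sub_eq_zero.mp <| eq_zero_of_frequently_eval_xc (W := W) <|
    Eventually.frequently <| by
      filter_upwards [h.eventually, hev, hφ.eventually, hDeq] with P h1 h2 h3 h4
      have h5 : N.eval (xc P) = b.eval (xc P) ^ A.natDegree * A.eval (xc (φ P)) := by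
        rw [hN]
        exact eval_substNum a b le_rfl h3.2
      have h6 := h1.2
      rw [AddMonoidHom.comp_apply] at h6
      rw [eval_sub, eval_mul, eval_mul, h4, h5, ← h6, ← h2.2]
      ring
  have h1 : a' ∣ N := h.coprime.dvd_of_dvd_mul_right ⟨D, e.symm⟩
  have h2 : N ∣ a' := hcop.dvd_of_dvd_mul_right ⟨b', e⟩
  exact natDegree_eq_of_degree_eq (degree_eq_degree_of_associated (associated_of_dvd_dvd h1 h2))

end Composition

/-! ### Inverting an isomorphism of degree one -/

section Inverse

variable {k : Type u} [Field k] [DecidableEq k] [NeZero (2 : k)] [IsAlgClosed k]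
variable {W W' : Affine k} [W.IsElliptic] [W'.IsElliptic]

theorem exists_xMap {φ : W.Point →+ W'.Point} (hφ : IsRegularMap (fun P => φ P))
    (h0 : ∀ᶠ P in cofinite, φ P ≠ 0) : ∃ a b, XMap φ a b := by
  have ht := tendsto_of_eventually_ne_zero h0
  obtain ⟨a, b, hb, hcop, h⟩ := (isRat_xc.comp hφ ht).exists_even
    (Eventually.of_forall fun P => by rw [map_neg, xc_neg])
  have hx : ∀ᶠ P in cofinite, xc (φ P) ≠ 0 := ht.eventually eventually_xc_ne_zero
  have ha : a ≠ 0 := by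
    rintro rfl
    obtain ⟨P, h1, h2, h3⟩ := (h.and (hx.and (eventually_eval_xc_ne_zero hb))).exists
    exact mul_ne_zero h3 h2 (by rw [h1, eval_zero])
  have hreg : RegVal (fun Q : W'.Point => (xc Q)⁻¹) (φ 0) 0 := by
    rw [map_zero]
    exact regVal_inv_xc_zero
  -- Infinity maps to infinity, so `1 / x(φ P) = b / a` vanishes there and `deg b < deg a`.
  have hdeg := (hreg.comp (hφ 0) ht).degree_lt (a := b) ha (by
    filter_upwards [h, hx] with P h1 h2
    rw [← h1, mul_assoc, mul_inv_cancel₀ h2, mul_one])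
  exact ⟨a, b, hcop, hb, natDegree_lt_natDegree hb hdeg, h0.and h⟩

/-- An isomorphism of groups that is a morphism of degree one has a regular inverse. -/
theorem isRegularMap_symm_of_natDegree_eq_one {ε : W.Point ≃+ W'.Point}
    (hε : IsRegularMap (fun P => ε P)) {a b : k[X]} (h : XMap (ε : W.Point →+ W'.Point) a b)
    (ha : a.natDegree = 1) : IsRegularMap (fun P => ε.symm P) := by
  have ht : Tendsto ε cofinite cofinite := ε.injective.tendsto_cofinite
  have ht' : Tendsto ε.symm cofinite cofinite := ε.symm.injective.tendsto_cofinite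
  have hx : IsRat (fun Q => xc (ε.symm Q)) := by
    -- In degree one the denominator is constant and `x ∘ ε` is affine in `x`, so it can be solved
    -- for `x`. Below, the odd function `η ∘ ε` is a fraction in `x` times `η`, which is solved for
    -- `η`.
    obtain ⟨r, rfl⟩ := natDegree_eq_zero.mp (Nat.lt_one_iff.mp (ha ▸ h.natDegree_lt))
    have hr : r ≠ 0 := fun hr => h.denom_ne_zero (by rw [hr, C_0])
    obtain ⟨s, hs, t, rfl⟩ := natDegree_eq_one.mp ha
    refine (((isRat_xc.const_mul r).sub (isRat_const t)).const_mul s⁻¹).congr ?_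
    filter_upwards [ht'.eventually h.eventually] with Q hQ
    have e := hQ.2
    simp only [AddMonoidHom.coe_coe, AddEquiv.apply_symm_apply, eval_C, eval_add, eval_mul,
      eval_X] at e
    rw [e, add_sub_cancel_right, inv_mul_cancel_left₀ hs]
  have hη : IsRat (fun Q => ηc (ε.symm Q)) := by
    obtain ⟨c, d, hd, hcd⟩ := (isRat_ηc.comp hε ht).exists_odd
      (Eventually.of_forall fun P => by rw [map_neg, ηc_neg])
    have hc : c ≠ 0 := by
      rintro rfl
      obtain ⟨P, h1, h2, h3⟩ := (hcd.and ((ht.eventually eventually_ηc_ne_zero).and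
        (eventually_eval_xc_ne_zero hd))).exists
      exact mul_ne_zero h3 h2 (by rw [h1, eval_zero, zero_mul])
    refine (((hx.eval d).mul isRat_ηc).div (hx.eval c)).congr ?_
    filter_upwards [ht'.eventually hcd, ht'.eventually (eventually_eval_xc_ne_zero hc)] with Q h1 h2
    rw [AddEquiv.apply_symm_apply] at h1
    rw [h1, mul_div_cancel_left₀ _ h2]
  have h0 : ∀ᶠ Q in cofinite, ε.symm Q ≠ 0 := ht'.eventually (eventually_ne 0)
  refine isRegularMap_of_ratMap (φ := (ε.symm : W'.Point →+ W.Point)) ⟨hx, ?_, h0⟩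
  refine (((hη.sub (hx.const_mul W.a₁)).sub (isRat_const W.a₃)).const_mul 2⁻¹).congr ?_
  filter_upwards [h0] with Q hQ
  exact (yc_eq hQ).symm

end Inverse

theorem eq_zero_of_two_nsmul {A : Type*} [AddCommGroup A] {p : ℕ} (hp : Odd p) {P : A}
    (h : p • P = 0) (h2 : 2 • P = 0) : P = 0 := by
  obtain ⟨m, rfl⟩ := hp
  rwa [add_nsmul, mul_comm, mul_nsmul', h2, nsmul_zero, zero_add, one_nsmul] at h

/-! ### Uniqueness of quotients and the dual isogeny -/

section Quotients

variable {k : Type u} [Field k] [DecidableEq k] {W W' V V' : Affine k}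

/-- Two quotients by the same subgroup are isomorphic. -/
theorem IsQuotientMap.exists_equiv (hV : V.IsElliptic) (hV' : V'.IsElliptic)
    {C : AddSubgroup W.Point} {π : W.Point →+ V.Point} {π' : W.Point →+ V'.Point}
    (h : IsQuotientMap C π) (h' : IsQuotientMap C π') :
    ∃ f : V.Point ≃+ V'.Point, IsRegularMap (fun P => f P) ∧ IsRegularMap (fun P => f.symm P) ∧
      ∀ P, f (π P) = π' P := by
  obtain ⟨f, ⟨hf, hfπ⟩, -⟩ := h.2.2 V' hV' π' h'.1 h'.2.1.ge
  obtain ⟨g, ⟨hg, hgπ⟩, -⟩ := h'.2.2 V hV π h.1 h.2.1.ge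
  have hgf : g.comp f = AddMonoidHom.id _ :=
    (h.2.2 V hV π h.1 h.2.1.ge).unique ⟨hg.comp hf, by rw [AddMonoidHom.comp_assoc, hfπ, hgπ]⟩
      ⟨isRegularMap_id, AddMonoidHom.id_comp π⟩
  have hfg : f.comp g = AddMonoidHom.id _ :=
    (h'.2.2 V' hV' π' h'.1 h'.2.1.ge).unique
      ⟨hf.comp hg, by rw [AddMonoidHom.comp_assoc, hgπ, hfπ]⟩
      ⟨isRegularMap_id, AddMonoidHom.id_comp π'⟩
  exact ⟨f.toAddEquiv g hgf hfg, hf, hg, fun P => DFunLike.congr_fun hfπ P⟩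

theorem IsQuotientMap.comp_equiv {g : W.Point ≃+ W'.Point} (hg : IsRegularMap (fun P => g P))
    (hg' : IsRegularMap (fun P => g.symm P)) {C : AddSubgroup W.Point} {C' : AddSubgroup W'.Point}
    (hC : ∀ P, g P ∈ C' ↔ P ∈ C) {π : W'.Point →+ V.Point} (h : IsQuotientMap C' π) :
    IsQuotientMap C (π.comp (g : W.Point →+ W'.Point)) := by
  refine ⟨h.1.comp hg, ?_, fun U hU ψ hψ hker => ?_⟩
  · ext P
    rw [← hC, ← h.2.1]
    rfl
  · have hψ' : IsRegularMap (fun P => (ψ.comp (g.symm : W'.Point →+ W.Point)) P) := hψ.comp hg'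
    obtain ⟨χ, ⟨hχ, hχπ⟩, huniq⟩ := h.2.2 U hU _ hψ' fun P hP => hker (by
      rw [← hC]
      exact (g.apply_symm_apply P).symm ▸ hP)
    refine ⟨χ, ⟨hχ, ?_⟩, fun χ' hχ' => huniq χ' ⟨hχ'.1, ?_⟩⟩
    · ext P
      have := DFunLike.congr_fun hχπ (g P)
      simpa using this
    · ext P
      have := DFunLike.congr_fun hχ'.2 (g.symm P)
      simpa using this

variable [NeZero (2 : k)] [IsAlgClosed k] [W.IsElliptic]

/-- The universal property does not mention surjectivity. It is inherited from the constructed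
quotient, to which any other is isomorphic. -/
theorem IsQuotientMap.surjective (hV : V.IsElliptic) {C : AddSubgroup W.Point} {p : ℕ}
    (hp : Odd p) (hC : Nat.card C = p) {π : W.Point →+ V.Point} (h : IsQuotientMap C π) :
    Function.Surjective π := by
  have : Finite C := Nat.finite_of_card_ne_zero (by rw [hC]; exact hp.pos.ne')
  obtain ⟨V', π', hV', hsurj, h'⟩ := exists_quotient C fun P hP h2 =>
    eq_zero_of_two_nsmul hp (nsmul_eq_zero_of_mem hC hP) h2
  obtain ⟨f, -, -, hf⟩ := h'.exists_equiv hV' hV h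
  intro Q
  obtain ⟨P, hP⟩ := hsurj (f.symm Q)
  exact ⟨P, by rw [← hf, hP, AddEquiv.apply_symm_apply]⟩

theorem nsmul_surjective (W : Affine k) [W.IsElliptic] {n : ℕ} (hn : 1 ≤ n) (P : W.Point) :
    ∃ Q : W.Point, n • Q = P := by
  obtain ⟨a, b, h⟩ := exists_mulX W hn
  exact h.xMap.surjective P

/-- Multiplication by `p`, prime to the characteristic, is the quotient by the `p`-torsion. -/
theorem isQuotientMap_nsmul (W : Affine k) [W.IsElliptic] {p : ℕ} (hp : Odd p)
    (hpk : (p : k) ≠ 0) :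
    IsQuotientMap (nsmulAddMonoidHom (α := W.Point) p).ker
      (nsmulAddMonoidHom (α := W.Point) p) := by
  set T := (nsmulAddMonoidHom (α := W.Point) p).ker with hT
  have hreg : IsRegularMap (fun P => nsmulAddMonoidHom (α := W.Point) p P) :=
    isRegularMap_nsmul W hp.pos
  have hcard : Nat.card T = p ^ 2 := card_torsion W hpk
  have hfin : Finite T :=
    Nat.finite_of_card_ne_zero (by rw [hcard]; exact pow_ne_zero _ hp.pos.ne')
  obtain ⟨V, ψ, hV, hψs, hψ⟩ := exists_quotient T fun P hP h2 => eq_zero_of_two_nsmul hp hP h2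
  -- Multiplication by `p` factors as `ε ∘ ψ` with `ψ` the constructed quotient. Bijectivity of `ε`
  -- on points would not suffice, since it could be purely inseparable; its degree must be shown to
  -- be one.
  obtain ⟨ε, ⟨hε, hεψ⟩, -⟩ := hψ.2.2 W ‹_› _ hreg le_rfl
  have hεψ' : ∀ P, ε (ψ P) = p • P := fun P => DFunLike.congr_fun hεψ P
  have hinj : Function.Injective ε := by
    rw [injective_iff_map_eq_zero]
    intro Q hQ
    obtain ⟨P, rfl⟩ := hψs Q
    rw [hεψ'] at hQ
    change P ∈ ψ.ker
    rw [hψ.2.1]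
    exact hQ
  have hsurj : Function.Surjective ε := fun Q => by
    obtain ⟨P, hP⟩ := nsmul_surjective W hp.pos Q
    exact ⟨ψ P, by rw [hεψ', hP]⟩
  have hε0 : ∀ᶠ P in cofinite, ε P ≠ 0 :=
    (eventually_ne 0).mono fun P hP h0 => hP (hinj (by rw [h0, map_zero]))
  have hψ0 : ∀ᶠ P in cofinite, ψ P ≠ 0 := by
    have : {P | P ∈ ψ.ker}.Finite := by
      rw [hψ.2.1]
      exact Set.toFinite (T : Set W.Point)
    exact this.eventually_cofinite_notMem
  obtain ⟨a, b, hab⟩ := exists_xMap hψ.1 hψ0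
  obtain ⟨A, B, hAB⟩ := exists_xMap hε hε0
  obtain ⟨c, d, hcd⟩ := exists_mulX W hp.pos
  have hcd' : XMap (ε.comp ψ) c d := hεψ ▸ hcd.xMap
  have hmul := hab.natDegree_comp hAB hcd'
  have hle := hab.card_ker_le
  rw [hψ.2.1, hcard] at hle
  rw [hcd.natDegree_num] at hmul
  -- `deg ε · deg ψ = p²`, while `deg ψ` is at least the order `p²` of its kernel.
  have hA : A.natDegree = 1 := by
    have h1 : 0 < A.natDegree := lt_of_le_of_lt (Nat.zero_le _) hAB.natDegree_lt
    have h2 : 0 < p ^ 2 := by have := hp.pos; positivity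
    by_contra hne
    have h3 : 2 ≤ A.natDegree := by omega
    have h4 := Nat.mul_le_mul h3 hle
    omega
  let e : V.Point ≃+ W.Point := AddEquiv.ofBijective ε ⟨hinj, hsurj⟩
  have he : IsRegularMap (fun P => e.symm P) :=
    isRegularMap_symm_of_natDegree_eq_one (ε := e) hε hAB hA
  have heψ : ∀ P, e.symm (p • P) = ψ P := fun P => by
    rw [AddEquiv.symm_apply_eq]
    exact (hεψ' P).symm
  refine ⟨hreg, rfl, fun U hU ζ hζ hker => ?_⟩
  obtain ⟨θ, ⟨hθ, hθψ⟩, -⟩ := hψ.2.2 U hU ζ hζ hker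
  refine ⟨θ.comp (e.symm : W.Point →+ V.Point), ⟨hθ.comp he, ?_⟩, fun ξ hξ => ?_⟩
  · ext P
    have := DFunLike.congr_fun hθψ P
    simp only [AddMonoidHom.comp_apply, nsmulAddMonoidHom_apply, AddMonoidHom.coe_coe]
    rw [heψ]
    exact this
  · ext Q
    obtain ⟨P, rfl⟩ := nsmul_surjective W hp.pos Q
    have h1 := DFunLike.congr_fun hθψ P
    have h2 := DFunLike.congr_fun hξ.2 P
    simp only [AddMonoidHom.comp_apply, nsmulAddMonoidHom_apply] at h1 h2
    simp only [AddMonoidHom.comp_apply, AddMonoidHom.coe_coe]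
    rw [heψ, h1, h2]

/-- The dual of the quotient by a subgroup of order `p`. -/
theorem IsQuotientMap.exists_dual (hV : V.IsElliptic) {p : ℕ} (hp : Odd p) (hpk : (p : k) ≠ 0)
    {C : AddSubgroup W.Point} (hC : Nat.card C = p) {π : W.Point →+ V.Point}
    (h : IsQuotientMap C π) :
    ∃ (D : AddSubgroup V.Point) (χ : V.Point →+ W.Point), Nat.card D = p ∧ IsQuotientMap D χ ∧
      (∀ P, χ (π P) = p • P) ∧ ∀ Q, π (χ Q) = p • Q := by
  have hsurj := h.surjective hV hp hC
  have hmul := isQuotientMap_nsmul W hp hpk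
  obtain ⟨χ, ⟨hχ, hχπ⟩, -⟩ := h.2.2 W ‹_› _ hmul.1 fun P hP => nsmul_eq_zero_of_mem hC hP
  have hχπ' : ∀ P, χ (π P) = p • P := fun P => DFunLike.congr_fun hχπ P
  have hπχ : ∀ Q, π (χ Q) = p • Q := fun Q => by
    obtain ⟨P, rfl⟩ := hsurj Q
    rw [hχπ', map_nsmul]
  refine ⟨χ.ker, χ, ?_, ⟨hχ, rfl, fun U hU ψ hψ hker => ?_⟩, hχπ', hπχ⟩
  -- The kernel of the dual is `π(E[p])`, of order `p² / p`.
  · let ρ : (nsmulAddMonoidHom (α := W.Point) p).ker →+ V.Point := π.comp (AddSubgroup.subtype _)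
    have hker : Nat.card ρ.ker = p := by
      have hmem : ∀ {P}, P ∈ C ↔ π P = 0 := fun {P} => by rw [← h.2.1, AddMonoidHom.mem_ker]
      exact (Nat.card_congr
        { toFun := fun P : ρ.ker => (⟨P.1.1, hmem.mpr P.2⟩ : C)
          invFun := fun P => ⟨⟨P.1, nsmul_eq_zero_of_mem hC P.2⟩, hmem.mp P.2⟩
          left_inv := fun _ => rfl
          right_inv := fun _ => rfl }).trans hC
    have hrange : ρ.range = χ.ker := by
      ext Q
      constructor
      · rintro ⟨P, rfl⟩
        exact (hχπ' P.1).trans P.2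
      · intro hQ
        obtain ⟨P, rfl⟩ := hsurj Q
        exact ⟨⟨P, (hχπ' P).symm.trans hQ⟩, rfl⟩
    have hmulcard := ρ.ker.card_mul_index
    rw [AddSubgroup.index_ker, hrange, hker, card_torsion W hpk, sq] at hmulcard
    exact Nat.eq_of_mul_eq_mul_left hp.pos hmulcard
  · have hker' : (nsmulAddMonoidHom (α := W.Point) p).ker ≤ (ψ.comp π).ker := fun P hP =>
      hker ((hχπ' P).trans hP)
    -- The universal property of `χ` is that of `[p] = χ ∘ π` applied to `ψ ∘ π`; surjectivity of
    -- `π` then cancels `π`.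
    obtain ⟨θ, ⟨hθ, hθp⟩, -⟩ := hmul.2.2 U hU (ψ.comp π) (hψ.comp h.1) hker'
    have hθp' : ∀ P, θ (p • P) = ψ (π P) := fun P => DFunLike.congr_fun hθp P
    refine ⟨θ, ⟨hθ, ?_⟩, fun ξ hξ => ?_⟩
    · ext Q
      obtain ⟨P, rfl⟩ := hsurj Q
      rw [AddMonoidHom.comp_apply, hχπ', hθp']
    · ext P
      obtain ⟨Q, rfl⟩ := nsmul_surjective W hp.pos P
      have := DFunLike.congr_fun hξ.2 (π Q)
      rw [AddMonoidHom.comp_apply, hχπ'] at this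
      rw [this, hθp']

end Quotients

/-! ### Comparing unit groups of endomorphism monoids -/

section Units

variable {A B : Type u} [AddCommGroup A] [AddCommGroup B]

theorem unitIndex_congr {M : Submonoid (AddMonoid.End A)} {N : Submonoid (AddMonoid.End B)}
    (hM : (-1 : AddMonoid.End A) ∈ M) (hN : (-1 : AddMonoid.End B) ∈ N) (e : M ≃* N)
    (he : e ⟨-1, hM⟩ = ⟨-1, hN⟩) : unitIndex M hM = unitIndex N hN := by
  have hu : Units.mapEquiv e (negOneUnit M hM) = negOneUnit N hN := Units.ext he
  have hmap : (Subgroup.zpowers (negOneUnit M hM)).map (Units.mapEquiv e).toMonoidHom =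
      Subgroup.zpowers (negOneUnit N hN) := by
    rw [MonoidHom.map_zpowers, ← hu]
    rfl
  change (Subgroup.zpowers _).index = (Subgroup.zpowers _).index
  rw [← hmap]
  exact (Subgroup.index_map_equiv _ (Units.mapEquiv e)).symm

/-- Two monoids of endomorphisms that are intertwined by a pair of surjections whose composites are
central have isomorphic unit groups. -/
theorem unitIndex_eq_of_intertwining {M : Submonoid (AddMonoid.End A)}
    {N : Submonoid (AddMonoid.End B)} (hM : (-1 : AddMonoid.End A) ∈ M)
    (hN : (-1 : AddMonoid.End B) ∈ N) (π : A →+ B) (χ : B →+ A) (hπ : Function.Surjective π)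
    (hχ : Function.Surjective χ) (h₁ : ∀ α ∈ M, ∃ β ∈ N, ∀ x, β (π x) = π (α x))
    (h₂ : ∀ β ∈ N, ∃ α ∈ M, ∀ y, α (χ y) = χ (β y))
    (h₃ : ∀ α ∈ M, ∀ x, χ (π (α x)) = α (χ (π x)))
    (h₄ : ∀ β ∈ N, ∀ y, π (χ (β y)) = β (π (χ y))) : unitIndex M hM = unitIndex N hN := by
  have h₁' : ∀ α : M, ∃ β : N, ∀ x, β.1 (π x) = π (α.1 x) := fun α => by
    obtain ⟨β, hβ, h⟩ := h₁ α.1 α.2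
    exact ⟨⟨β, hβ⟩, h⟩
  have h₂' : ∀ β : N, ∃ α : M, ∀ y, α.1 (χ y) = χ (β.1 y) := fun β => by
    obtain ⟨α, hα, h⟩ := h₂ β.1 β.2
    exact ⟨⟨α, hα⟩, h⟩
  choose f hf using h₁'
  choose g hg using h₂'
  have hfu : ∀ (α : M) (β : N), (∀ x, β.1 (π x) = π (α.1 x)) → f α = β := by
    intro α β h
    refine Subtype.ext (AddMonoidHom.ext fun y => ?_)
    obtain ⟨x, rfl⟩ := hπ y
    exact (hf α x).trans (h x).symm
  have hgf : ∀ α, g (f α) = α := by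
    intro α
    refine Subtype.ext (AddMonoidHom.ext fun x => ?_)
    obtain ⟨y, rfl⟩ := hχ x
    obtain ⟨x, rfl⟩ := hπ y
    exact ((hg (f α) (π x)).trans (by rw [hf])).trans (h₃ α.1 α.2 x)
  have hfg : ∀ β, f (g β) = β := by
    intro β
    refine Subtype.ext (AddMonoidHom.ext fun y => ?_)
    obtain ⟨x, rfl⟩ := hπ y
    obtain ⟨y, rfl⟩ := hχ x
    exact ((hf (g β) (χ y)).trans (by rw [hg])).trans (h₄ β.1 β.2 y)
  refine unitIndex_congr hM hN
    { toFun := f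
      invFun := g
      left_inv := hgf
      right_inv := hfg
      map_mul' := fun α α' => hfu _ _ fun x => ?_ } (hfu _ _ fun x => ?_)
  · change (f α).1 ((f α').1 (π x)) = π (α.1 (α'.1 x))
    rw [hf, hf]
  · change -(π x) = π (-x)
    rw [map_neg]

end Units

/-! ### Dual pairs and the involution on edges -/

section Duality

variable {q : ℕ} {k : Type u} [Field k] [DecidableEq k] {p : ℕ}

/-- The length of an edge, computed on an arbitrary representative. -/
noncomputable def pairIndex (P : CurveWithSubgroup q k p) : ℕ :=
  unitIndex (endPairMonoid P.curve P.subgroup) (neg_one_mem_endPairMonoid _ _)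

theorem pairIndex_congr {P Q : CurveWithSubgroup q k p} (h : P ≈ Q) :
    pairIndex P = pairIndex Q := by
  obtain ⟨f, hf, hf', hC⟩ := h
  refine unitIndex_eq_of_intertwining _ _ (f : P.curve.Point →+ Q.curve.Point)
    (f.symm : Q.curve.Point →+ P.curve.Point) f.surjective f.symm.surjective ?_ ?_ ?_ ?_
  · rintro α ⟨hα, hαC⟩
    refine ⟨((f : P.curve.Point →+ Q.curve.Point).comp α).comp
      (f.symm : Q.curve.Point →+ P.curve.Point), ⟨?_, fun x hx => ?_⟩, fun x => ?_⟩
    · exact hf.comp (IsRegularMap.comp (ψ := fun P => α P) hα hf')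
    · refine (hC _).mpr (hαC _ ((hC _).mp ?_))
      simpa using hx
    · change f (α (f.symm (f x))) = f (α x)
      rw [AddEquiv.symm_apply_apply]
  · rintro β ⟨hβ, hβC⟩
    refine ⟨((f.symm : Q.curve.Point →+ P.curve.Point).comp β).comp
      (f : P.curve.Point →+ Q.curve.Point), ⟨?_, fun x hx => ?_⟩, fun x => ?_⟩
    · exact hf'.comp (IsRegularMap.comp (ψ := fun P => β P) hβ hf)
    · refine (hC _).mp ?_
      change f (f.symm (β (f x))) ∈ Q.subgroup
      rw [AddEquiv.apply_symm_apply]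
      exact hβC _ ((hC x).mpr hx)
    · change f.symm (β (f (f.symm x))) = f.symm (β x)
      rw [AddEquiv.apply_symm_apply]
  · intros
    simp
  · intros
    simp

theorem shimuraLength_mk (P : CurveWithSubgroup q k p) :
    shimuraLength (⟦P⟧ : ShimuraEdge q k p) = pairIndex P :=
  pairIndex_congr (Quotient.mk_out P)

/-- The choice made in `target` is immaterial: its witness may use another representative of the
edge, but transporting the quotient along the isomorphism of pairs reduces to uniqueness of
quotients. -/
theorem target_mk {P : CurveWithSubgroup q k p} {E' : SupersingularCurve q k}
    {π : P.curve.Point →+ E'.curve.Point} (h : IsQuotientMap P.subgroup π) :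
    target (⟦P⟧ : ShimuraEdge q k p) = ⟦E'⟧ := by
  have hex : ∃ x, IsTarget (⟦P⟧ : ShimuraEdge q k p) x := ⟨⟦E'⟧, P, E', π, rfl, rfl, h⟩
  rw [target, dif_pos hex]
  obtain ⟨Q, F, ρ, hQ, hF, hρ⟩ := hex.choose_spec
  rw [← hF]
  obtain ⟨g, hg, hg', hC⟩ := Quotient.exact hQ
  obtain ⟨f, hf, hfs, -⟩ := hρ.exists_equiv F.isElliptic E'.isElliptic (h.comp_equiv hg hg' hC)
  exact Quotient.sound ⟨f, hf, hfs⟩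

/-- The two pairs are dual: each curve is the quotient of the other by its subgroup, and the
quotient maps compose to multiplication by `p`. -/
def IsDual (P P' : CurveWithSubgroup q k p) : Prop :=
  ∃ (π : P.curve.Point →+ P'.curve.Point) (χ : P'.curve.Point →+ P.curve.Point),
    IsQuotientMap P.subgroup π ∧ IsQuotientMap P'.subgroup χ ∧
      (∀ x, χ (π x) = p • x) ∧ ∀ y, π (χ y) = p • y

theorem IsDual.symm {P P' : CurveWithSubgroup q k p} (h : IsDual P P') : IsDual P' P := by
  obtain ⟨π, χ, h1, h2, h3, h4⟩ := h
  exact ⟨χ, π, h2, h1, h4, h3⟩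

variable [NeZero (2 : k)] [IsAlgClosed k]

theorem IsDual.pairIndex_eq (hp : Odd p) {P P' : CurveWithSubgroup q k p} (h : IsDual P P') :
    pairIndex P = pairIndex P' := by
  have := P.isElliptic
  have := P'.isElliptic
  obtain ⟨π, χ, hπ, hχ, hχπ, hπχ⟩ := h
  have hπs := hπ.surjective P'.isElliptic hp P.card_subgroup
  have hχs := hχ.surjective P.isElliptic hp P'.card_subgroup
  -- An `α` preserving `C = ker π` descends to `β` along `π`. Then `β` preserves `ker χ`: if `χ(πx)
  -- = px = 0`, then `χ(β(πx)) = p · α(x) = α(px) = 0`.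
  have key : ∀ {Q Q' : CurveWithSubgroup q k p} {π : Q.curve.Point →+ Q'.curve.Point}
      {χ : Q'.curve.Point →+ Q.curve.Point}, IsQuotientMap Q.subgroup π →
      IsQuotientMap Q'.subgroup χ → (∀ x, χ (π x) = p • x) → Function.Surjective π →
      ∀ α ∈ endPairMonoid Q.curve Q.subgroup, ∃ β ∈ endPairMonoid Q'.curve Q'.subgroup,
        ∀ x, β (π x) = π (α x) := by
    rintro Q Q' π χ hπ hχ hχπ hπs α ⟨hα, hαC⟩
    obtain ⟨β, ⟨hβ, hβπ⟩, -⟩ := hπ.2.2 Q'.curve Q'.isElliptic (π.comp α)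
      (IsRegularMap.comp (ψ := fun P => π P) hπ.1 hα) fun x hx => by
        have := hαC x hx
        rw [← hπ.2.1] at this
        exact this
    have hβπ' : ∀ x, β (π x) = π (α x) := fun x => DFunLike.congr_fun hβπ x
    refine ⟨β, ⟨hβ, fun y hy => ?_⟩, hβπ'⟩
    obtain ⟨x, rfl⟩ := hπs y
    rw [← hχ.2.1, AddMonoidHom.mem_ker, hχπ] at hy
    rw [← hχ.2.1, AddMonoidHom.mem_ker]
    exact (congrArg χ (hβπ' x)).trans (by rw [hχπ, ← map_nsmul, hy, map_zero])
  refine unitIndex_eq_of_intertwining _ _ π χ hπs hχs (key hπ hχ hχπ hπs) (key hχ hπ hπχ hχs) ?_ ?_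
  · intro α _ x
    rw [hχπ, hχπ, map_nsmul]
  · intro β _ y
    rw [hπχ, hπχ, map_nsmul]

/-- The dual subgroup consists of the `πx` with `px = 0`, so the isomorphism between the quotient
curves respects it. This makes the involution well defined on classes. -/
theorem IsDual.congr (hp : Odd p) {P P' Q Q' : CurveWithSubgroup q k p} (hPQ : P ≈ Q)
    (h : IsDual P P') (h' : IsDual Q Q') : P' ≈ Q' := by
  have := P.isElliptic
  obtain ⟨g, hg, hg', hC⟩ := hPQ
  obtain ⟨π, χ, hπ, hχ, hχπ, -⟩ := h
  obtain ⟨π', χ', hπ', hχ', hχπ', -⟩ := h'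
  obtain ⟨f, hf, hf', hfπ⟩ := hπ.exists_equiv P'.isElliptic Q'.isElliptic
    (hπ'.comp_equiv hg hg' hC)
  refine ⟨f, hf, hf', fun y => ?_⟩
  obtain ⟨x, rfl⟩ := hπ.surjective P'.isElliptic hp P.card_subgroup y
  rw [hfπ, ← hχ.2.1, ← hχ'.2.1, AddMonoidHom.mem_ker, AddMonoidHom.mem_ker, hχπ,
    AddMonoidHom.comp_apply, hχπ', AddMonoidHom.coe_coe, ← map_nsmul]
  exact map_eq_zero_iff g g.injective

/-- Supersingularity passes to the quotient: if `qπ(x) = 0` then `qx ∈ C`, so `pqx = 0` and `px = 0`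
by supersingularity of `E`; as `p` and `q` are coprime, `x` is a multiple of `qx` and lies in `C`.
-/
theorem exists_isQuotientMap (hp : Odd p) (hpq : p.Coprime q) (P : CurveWithSubgroup q k p) :
    ∃ (E' : SupersingularCurve q k) (π : P.curve.Point →+ E'.curve.Point),
      IsQuotientMap P.subgroup π := by
  have := P.isElliptic
  have hfin : Finite P.subgroup :=
    Nat.finite_of_card_ne_zero (by rw [P.card_subgroup]; exact hp.pos.ne')
  obtain ⟨V, π, hV, hsurj, h⟩ := exists_quotient P.subgroup fun x hx h2 =>
    eq_zero_of_two_nsmul hp (nsmul_eq_zero_of_mem P.card_subgroup hx) h2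
  refine ⟨⟨V, hV, fun y hy => ?_⟩, π, h⟩
  obtain ⟨x, rfl⟩ := hsurj y
  rw [← map_nsmul] at hy
  have hqx : q • x ∈ P.subgroup := by
    rw [← h.2.1]
    exact hy
  have hpx : p • x = 0 := P.supersingular _ (by
    rw [smul_comm]
    exact nsmul_eq_zero_of_mem P.card_subgroup hqx)
  have hx : x ∈ P.subgroup := by
    have hb := Nat.gcd_eq_gcd_ab p q
    rw [hpq.gcd_eq_one, Nat.cast_one] at hb
    have e : x = (Nat.gcdB p q) • (q • x) := by
      conv_lhs => rw [← one_zsmul x, hb, add_zsmul, mul_comm, mul_zsmul, natCast_zsmul, hpx,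
        zsmul_zero, zero_add, mul_comm, mul_zsmul, natCast_zsmul]
    rw [e]
    exact P.subgroup.zsmul_mem hqx _
  rw [← h.2.1] at hx
  exact hx

theorem exists_isDual (hp : Odd p) (hpk : (p : k) ≠ 0) {P : CurveWithSubgroup q k p}
    {E' : SupersingularCurve q k} {π : P.curve.Point →+ E'.curve.Point}
    (h : IsQuotientMap P.subgroup π) :
    ∃ P' : CurveWithSubgroup q k p, P'.toSupersingularCurve = E' ∧ IsDual P P' := by
  have := P.isElliptic
  obtain ⟨D, χ, hD, hχ, h1, h2⟩ := h.exists_dual E'.isElliptic hp hpk P.card_subgroup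
  exact ⟨⟨E', D, hD⟩, rfl, π, χ, h, hχ, h1, h2⟩

/-- The involution `(E, C) ↦ (E / C, E[p] / C)` of the edges. -/
theorem exists_involution (hp : Odd p) (hpq : p.Coprime q) (hpk : (p : k) ≠ 0) :
    ∃ w : ShimuraEdge q k p ≃ ShimuraEdge q k p,
      (∀ e, source (w e) = target e) ∧ ∀ e, shimuraLength (w e) = shimuraLength e := by
  have hex : ∀ P : CurveWithSubgroup q k p, ∃ P' : CurveWithSubgroup q k p,
      IsDual P P' ∧ target (⟦P⟧ : ShimuraEdge q k p) = ⟦P'.toSupersingularCurve⟧ := by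
    intro P
    obtain ⟨E', π, h⟩ := exists_isQuotientMap hp hpq P
    obtain ⟨P', rfl, hP'⟩ := exists_isDual hp hpk h
    exact ⟨P', hP', target_mk h⟩
  choose d hd ht using hex
  let w : ShimuraEdge q k p → ShimuraEdge q k p :=
    Quotient.map d fun P Q hPQ => IsDual.congr hp hPQ (hd P) (hd Q)
  -- Duality is symmetric, so `P` and the chosen dual of `d P` are both dual to `d P`, hence
  -- isomorphic.
  have hw : Function.Involutive w := by
    intro e
    induction e using Quotient.inductionOn with
    | h P =>
      exact Quotient.sound (IsDual.congr hp (Setoid.refl (d P)) (hd (d P)) (hd P).symm)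
  refine ⟨hw.toPerm, fun e => ?_, fun e => ?_⟩
  · induction e using Quotient.inductionOn with
    | h P => exact (ht P).symm
  · induction e using Quotient.inductionOn with
    | h P =>
      change shimuraLength (⟦d P⟧ : ShimuraEdge q k p) = _
      rw [shimuraLength_mk, shimuraLength_mk, (hd P).pairIndex_eq hp]

end Duality

/-! ### Orbits of the unit group on subgroups -/

section Orbits

variable {A : Type u} [AddCommGroup A]

/-- The units of `N` are the stabiliser of `C` in the units of `M`, so this is the tower of indices
`±1 ≤ Stab(C) ≤ Mˣ` combined with orbit-stabiliser. -/
theorem unitIndex_mul_card_orbit {M N : Submonoid (AddMonoid.End A)}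
    (hM : (-1 : AddMonoid.End A) ∈ M) (hN : (-1 : AddMonoid.End A) ∈ N) (C : AddSubgroup A)
    (hNM : ∀ α, α ∈ N ↔ α ∈ M ∧ ∀ x ∈ C, α x ∈ C) :
    unitIndex N hN * Nat.card (MulAction.orbit Mˣ C) = unitIndex M hM := by
  let j : Nˣ →* Mˣ := Units.map (Submonoid.inclusion fun α hα => ((hNM α).mp hα).1)
  have hj : Function.Injective j :=
    Units.map_injective (Submonoid.inclusion_injective _)
  have hmap : (Subgroup.zpowers (negOneUnit N hN)).map j =
      Subgroup.zpowers (negOneUnit M hM) := by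
    rw [MonoidHom.map_zpowers]
    rfl
  have hrange : (⊤ : Subgroup Nˣ).map j = MulAction.stabilizer Mˣ C := by
    ext u
    rw [Subgroup.mem_map, MulAction.mem_stabilizer_iff]
    constructor
    · rintro ⟨v, -, rfl⟩
      refine le_antisymm ?_ ?_
      · rintro _ ⟨x, hx, rfl⟩
        exact ((hNM _).mp v.1.2).2 x hx
      · intro x hx
        refine ⟨(v⁻¹).1.1 x, ((hNM _).mp (v⁻¹).1.2).2 x hx, ?_⟩
        exact DFunLike.congr_fun (congrArg Subtype.val v.mul_inv) x
    · intro h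
      have h' : u⁻¹ • C = C := by rw [inv_smul_eq_iff, h]
      have key : ∀ v : Mˣ, v • C = C → v.1.1 ∈ N := fun v hv => (hNM _).mpr ⟨v.1.2, fun x hx => by
        rw [← hv]
        exact AddSubgroup.smul_mem_pointwise_smul x v C hx⟩
      exact ⟨⟨⟨u.1.1, key u h⟩, ⟨(u⁻¹).1.1, key _ h'⟩,
        Subtype.ext (congrArg (fun v : M => v.1) u.mul_inv),
        Subtype.ext (congrArg (fun v : M => v.1) u.inv_mul)⟩, trivial, Units.ext rfl⟩
  have hle : Subgroup.zpowers (negOneUnit M hM) ≤ MulAction.stabilizer Mˣ C := by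
    rw [← hmap, ← hrange]
    exact Subgroup.map_mono le_top
  change (Subgroup.zpowers _).index * _ = (Subgroup.zpowers _).index
  rw [← Subgroup.relIndex_mul_index hle, MulAction.index_stabilizer,
    Nat.card_coe_set_eq, ← (Subgroup.zpowers (negOneUnit N hN)).relIndex_top_right,
    ← Subgroup.relIndex_map_map_of_injective _ _ hj, hmap, hrange]

end Orbits

/-! ### The two push-forward identities -/

section Pushforward

variable {q : ℕ} {k : Type u} [Field k] [DecidableEq k] {p : ℕ}

theorem exists_subgroup_of_source {E : SupersingularCurve q k} {e : ShimuraEdge q k p}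
    (he : source e = ⟦E⟧) : ∃ (C : AddSubgroup E.curve.Point) (hC : Nat.card C = p),
      (⟦⟨E, C, hC⟩⟧ : ShimuraEdge q k p) = e := by
  induction e using Quotient.inductionOn with
  | h P =>
    obtain ⟨f, hf, hf'⟩ := Quotient.exact he
    refine ⟨P.subgroup.map (f : P.curve.Point →+ E.curve.Point), ?_, Quotient.sound ?_⟩
    · exact (Nat.card_congr (P.subgroup.equivMapOfInjective _ f.injective).symm.toEquiv).trans
        P.card_subgroup
    · refine Setoid.symm ⟨f, hf, hf', fun x => ?_⟩
      exact AddSubgroup.mem_map_iff_mem f.injective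

/-- An isomorphism `(E, C) ≅ (E, C₀)` is the same as a unit of `End(E)` carrying one subgroup to the
other. The subgroups giving the edge `e` therefore form one orbit. -/
theorem card_fibre_mul_shimuraLength (E : SupersingularCurve q k) (e : ShimuraEdge q k p)
    (he : source e = ⟦E⟧) :
    Nat.card {C : {C : AddSubgroup E.curve.Point // Nat.card C = p} //
        (⟦⟨E, C.1, C.2⟩⟧ : ShimuraEdge q k p) = e} * shimuraLength e =
      unitIndex (endMonoid E.curve) (neg_one_mem_endMonoid _) := by
  obtain ⟨C₀, hC₀, rfl⟩ := exists_subgroup_of_source he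
  have hlen : shimuraLength (⟦⟨E, C₀, hC₀⟩⟧ : ShimuraEdge q k p) = pairIndex ⟨E, C₀, hC₀⟩ :=
    shimuraLength_mk _
  have horb := unitIndex_mul_card_orbit (neg_one_mem_endMonoid E.curve)
    (neg_one_mem_endPairMonoid E.curve C₀) C₀ fun α => Iff.rfl
  rw [hlen, ← horb, mul_comm]
  congr 1
  have hmem : ∀ C : AddSubgroup E.curve.Point, C ∈ MulAction.orbit (endMonoid E.curve)ˣ C₀ ↔
      ∃ hC : Nat.card C = p, (⟦⟨E, C, hC⟩⟧ : ShimuraEdge q k p) = ⟦⟨E, C₀, hC₀⟩⟧ := by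
    intro C
    constructor
    · rintro ⟨u, rfl⟩
      let f : E.curve.Point ≃+ E.curve.Point := DistribMulAction.toAddEquiv _ u
      have hcard : Nat.card (u • C₀ : AddSubgroup E.curve.Point) = p := by
        rw [← hC₀]
        exact Nat.card_congr (C₀.equivMapOfInjective _ f.injective).symm.toEquiv
      refine ⟨hcard, Quotient.sound (Setoid.symm ⟨f, u.1.2, (u⁻¹).1.2, fun x => ?_⟩)⟩
      exact AddSubgroup.smul_mem_pointwise_smul_iff
    · rintro ⟨hC, h⟩
      obtain ⟨f, hf, hf', hfC⟩ := Quotient.exact h.symm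
      let u : (endMonoid E.curve)ˣ :=
        ⟨⟨(f : E.curve.Point →+ E.curve.Point), hf⟩,
          ⟨(f.symm : E.curve.Point →+ E.curve.Point), hf'⟩,
          Subtype.ext (AddMonoidHom.ext fun x => f.apply_symm_apply x),
          Subtype.ext (AddMonoidHom.ext fun x => f.symm_apply_apply x)⟩
      refine ⟨u, AddSubgroup.ext fun x => ?_⟩
      obtain ⟨y, rfl⟩ := f.surjective x
      exact (AddSubgroup.smul_mem_pointwise_smul_iff (a := u)).trans (hfC y).symm
  exact Nat.card_congr
    { toFun := fun C => ⟨C.1.1, (hmem _).mpr ⟨C.1.2, C.2⟩⟩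
      invFun := fun C => ⟨⟨C.1, ((hmem _).mp C.2).1⟩, ((hmem _).mp C.2).2⟩
      left_inv := fun _ => rfl
      right_inv := fun _ => rfl }

variable [NeZero (2 : k)] [IsAlgClosed k]

theorem pushforward_source [Fact p.Prime] (hpk : (p : k) ≠ 0) :
    pushforward source (eisensteinShimura q k p) = (p + 1 : ℚ) • eisensteinModular q k := by
  funext x
  have hE := x.out.isElliptic
  let X := {C : AddSubgroup x.out.curve.Point // Nat.card C = p}
  have hX : Nat.card X = p + 1 := card_subgroups x.out.curve hpk
  have : Finite X := Nat.finite_of_card_ne_zero (by rw [hX]; exact Nat.succ_ne_zero p)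
  let F : X → {e : ShimuraEdge q k p // source e = x} := fun C =>
    ⟨⟦⟨x.out, C.1, C.2⟩⟧, x.out_eq⟩
  have hfib : ∀ e : {e : ShimuraEdge q k p // source e = x},
      Nat.card {C // F C = e} * shimuraLength e.1 = modularLength x := by
    intro e
    rw [modularLength, ← card_fibre_mul_shimuraLength x.out e.1 (e.2.trans x.out_eq.symm)]
    congr 1
    exact Nat.card_congr (Equiv.subtypeEquivRight fun C => Subtype.ext_iff)
  have hFs : Function.Surjective F := fun e => by
    obtain ⟨C, hC, h⟩ := exists_subgroup_of_source (e.2.trans x.out_eq.symm)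
    exact ⟨⟨C, hC⟩, Subtype.ext h⟩
  have hpos : ∀ e, Nat.card {C // F C = e} ≠ 0 := fun e => by
    obtain ⟨C, hC⟩ := hFs e
    exact Nat.card_ne_zero.mpr ⟨⟨C, hC⟩, inferInstance⟩
  have : Finite {e : ShimuraEdge q k p // source e = x} := Finite.of_surjective F hFs
  have := Fintype.ofFinite {e : ShimuraEdge q k p // source e = x}
  have hsum : ∑ e, Nat.card {C // F C = e} = p + 1 := by
    rw [← Nat.card_sigma, Nat.card_congr (Equiv.sigmaFiberEquiv F), hX]
  -- Each edge contributes the number of subgroups giving it, divided by `ℓ(E)`. Only that nonzero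
  -- number is cancelled, so finiteness of the unit groups plays no role.
  have hval : ∀ e : {e : ShimuraEdge q k p // source e = x},
      eisensteinShimura q k p e = (Nat.card {C // F C = e} : ℚ) * (1 / (modularLength x : ℚ)) := by
    intro e
    have h0 : (Nat.card {C // F C = e} : ℚ) ≠ 0 := Nat.cast_ne_zero.mpr (hpos e)
    rw [eisensteinShimura, ← hfib e, Nat.cast_mul, mul_one_div, div_mul_eq_div_div, div_self h0]
  rw [pushforward, finsum_eq_sum_of_fintype, Finset.sum_congr rfl fun e _ => hval e,
    ← Finset.sum_mul, ← Nat.cast_sum, hsum, Pi.smul_apply, smul_eq_mul, eisensteinModular]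
  push_cast
  rfl

/-- The involution maps the fibre of `t` over `x` bijectively to the fibre of `s` and preserves
lengths, so the two sums agree term by term. -/
theorem pushforward_target [Fact p.Prime] (hp : Odd p) (hpq : p.Coprime q) (hpk : (p : k) ≠ 0) :
    pushforward target (eisensteinShimura q k p) = (p + 1 : ℚ) • eisensteinModular q k := by
  obtain ⟨w, hs, hl⟩ := exists_involution (q := q) (k := k) hp hpq hpk
  rw [← pushforward_source hpk]
  funext x
  refine finsum_eq_of_bijective (w.subtypeEquiv fun e => by rw [hs]) (Equiv.bijective _) fun e => ?_
  change (1 : ℚ) / _ = 1 / (shimuraLength (w e.1) : ℚ)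
  rw [hl]

end Pushforward

end EisensteinGraph

open EisensteinGraph
theorem mainTheorem9 (p q : ℕ) [Fact p.Prime] [Fact q.Prime] (hpq : p ≠ q) (hp : 5 ≤ p)
    (hq : 5 ≤ q) (k : Type*) [Field k] [DecidableEq k] [Algebra (ZMod q) k]
    [IsAlgClosure (ZMod q) k] :
    -- the quotients `E / C` exist, and `t` sends the class of `(E, C)` to the class of `E / C`
    (∀ P : CurveWithSubgroup q k p,
      (∃ (E' : SupersingularCurve q k) (π : P.curve.Point →+ E'.curve.Point),
        IsQuotientMap P.subgroup π) ∧
      ∀ (E' : SupersingularCurve q k) (π : P.curve.Point →+ E'.curve.Point),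
        IsQuotientMap P.subgroup π → target (⟦P⟧ : ShimuraEdge q k p) = ⟦E'⟧) ∧
    pushforward source (eisensteinShimura q k p) = (p + 1 : ℚ) • eisensteinModular q k ∧
    pushforward target (eisensteinShimura q k p) = (p + 1 : ℚ) • eisensteinModular q k := by
  have hpp : p.Prime := Fact.out
  have hqp : q.Prime := Fact.out
  have : IsAlgClosed k := IsAlgClosure.isAlgClosed (ZMod q)
  have : CharP k q := charP_of_injective_algebraMap (algebraMap (ZMod q) k).injective q
  have hodd : Odd p := hpp.odd_of_ne_two (by omega)
  have hcop : p.Coprime q := (Nat.coprime_primes hpp hqp).mpr hpq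
  have hpk : (p : k) ≠ 0 := fun h => by
    rw [CharP.cast_eq_zero_iff k q] at h
    exact hpq ((Nat.prime_dvd_prime_iff_eq hqp hpp).mp h).symm
  have : NeZero (2 : k) := ⟨fun h => by
    have h2 : ((2 : ℕ) : k) = 0 := by exact_mod_cast h
    rw [CharP.cast_eq_zero_iff k q] at h2
    exact absurd (Nat.le_of_dvd two_pos h2) (by omega)⟩
  exact ⟨fun P => ⟨exists_isQuotientMap hodd hcop P, fun _ _ h => target_mk h⟩,
    pushforward_source hpk, pushforward_target hodd hcop hpk⟩
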